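/- **Setting.** Let $d\in\{2,3\}$, let $\Omega\subset\mathbb{R}^d$ be a bounded open set with Lipschitz boundary, $\mathbb{S}=\{\mu\in\mathbb{R}^d:|\mu|_2=1\}$, $\mathbb{E}=[E_{\min},E_{\max}]$ with $0\le E_{\min}<E_{\max}<\infty$, and $\mathcal D=\Omega\times\mathbb{S}\times\mathbb{E}$. Let $\theta(x,\mu'\cdot\mu,E'\to E)\ge 0$ be a measurable scattering kernel with $\theta(x,\mu'\cdot\mu,E'\to E)=0$ for $E'<E$, let $\alpha(x,E)\ge 0$, and put $$\beta(x,E)=\int_{\mathbb{E}}\int_{\mathbb{S}}\theta(x,\mu\cdot\mu',E\to E')\,d\mu'\,dE',\qquad \gamma(x,E)=\int_{\mathbb{E}}\int_{\mathbb{S}}\theta(x,\mu'\cdot\mu,E'\to E)\,d\mu'\,dE',$$ where $\beta,\gamma$ are finite at every point and $\alpha,\beta$ are integrable over $\Omega\times\mathbb{E}$. Assume that there is $\alpha_0>0$ with $\alpha+\tfrac12(\beta-\gamma)\ge\alpha_0$ on $\Omega\times\mathbb{E}$. Let $f$ be integrable over $\mathcal D$ and let $g_D$ be integrable over the inflow boundary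 $\{(x,\mu,E):x\in\partial\Omega,\ \mu\cdot n(x)<0\}$ with weight $|\mu\cdot n|$, $n$ the outward unit normal. Let $S[w](x,\mu,E)=\int_{\mathbb{E}}\int_{\mathbb{S}}\theta(x,\mu'\cdot\mu,E'\to E)\,w(x,\mu',E')\,d\mu'\,dE'$, and $$q_\beta=\sup_{x\in\Omega,\,E\in\mathbb{E}}\frac{\beta(x,E)}{\alpha(x,E)+\beta(x,E)},\qquad q_\gamma=\sup_{x\in\Omega,\,E\in\mathbb{E}}\frac{\gamma(x,E)}{\alpha(x,E)+\beta(x,E)}.$$ **Discretisation.** Let $\mathcal T_\Omega$ be a finite subdivision of $\Omega$ into non-empty disjoint open elements $\kappa\subset\Omega$ with $\overline\Omega=\bigcup_{\kappa}\overline{\kappa}$, where each boundary $\partial\kappa$ has finite $(d-1)$-dimensional measure and is, away from a set of $(d-1)$-dimensional measure zero, locally a Lipschitz graph with $\kappa$ on one side. Let $\mathcal T_{\mathbb S}$ be a mesh of $\mathbb{S}$ obtained from a mesh of the surface of the cube $[-1,1]^d$ by axis-parallel boxes $\tilde\kappa$ through the radial projection $\phi(y)=y/|y|_2$, and let $E_{\max}=E_0>\dots>E_N=E_{\min}$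 be a partition of $\mathbb{E}$ into energy groups. For $p,q,r\ge0$ let $V_h=V_\Omega\otimes V_{\mathbb S}\otimes V_{\mathbb E}$, where $V_\Omega$ consists of the piecewise polynomials of total degree at most $p$ on $\mathcal T_\Omega$, $V_{\mathbb S}$ of the functions whose pull-back by $\phi$ to each $\tilde\kappa$ is a polynomial of degree at most $q$ in each of the $d-1$ coordinates, and $V_{\mathbb E}$ of the piecewise polynomials of degree at most $r$ on the energy groups. For $\kappa\in\mathcal T_\Omega$ and $\mu\in\mathbb{S}$ let $\partial_-\kappa$ and $\partial_+\kappa$ be the parts of $\partial\kappa$ where $\mu\cdot n_\kappa<0$ and $\mu\cdot n_\kappa\ge0$, respectively, and let $v^+$, $v^-$ be the traces of $v$ on $\partial\kappa$ from inside and outside $\kappa$. Put $$a(w,v)=\int_{\mathbb E}\int_{\mathbb S}\sum_{\kappa\in\mathcal T_\Omega}\Big[\int_\kappa\big(-w\,\mu\cdot\nabla_x v+(\alpha+\beta)wv\big)\,dx+\int_{\partial_+\kappa}|\mu\cdot n_\kappa|\,w^+v^+\,ds-\int_{\partial_-\kappa\setminus\partial\Omega}|\mu\cdot n_\kappa|\,w^-v^+\,ds\Big]\,d\mu\,dE,$$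 $$s(w,v)=\int_{\mathbb E}\int_{\mathbb S}\int_\Omega S[w]\,v\,dx\,d\mu\,dE,\qquad \ell(v)=\int_{\mathbb E}\int_{\mathbb S}\sum_{\kappa\in\mathcal T_\Omega}\Big[\int_\kappa fv\,dx+\int_{\partial_-\kappa\cap\partial\Omega}|\mu\cdot n_\kappa|\,g_Dv^+\,ds\Big]\,d\mu\,dE,$$ $$|||v|||_a^2=\|\sqrt{\alpha+\beta}\,v\|_{L_2(\mathcal D)}^2+\frac12\int_{\mathbb E}\int_{\mathbb S}\sum_{\kappa\in\mathcal T_\Omega}\Big[\int_{\partial_-\kappa\setminus\partial\Omega}|\mu\cdot n_\kappa|(v^+-v^-)^2\,ds+\int_{\partial\kappa\cap\partial\Omega}|\mu\cdot n_\kappa|(v^+)^2\,ds\Big]\,d\mu\,dE.$$ The DGFEM solution $u_h\in V_h$ is defined by $a(u_h,v_h)=s(u_h,v_h)+\ell(v_h)$ for all $v_h\in V_h$. Source iteration, for a given $u_h^{(0)}\in V_h$, finds $u_h^{(n+1)}\in V_h$, $n\ge0$, such that $a(u_h^{(n+1)},v_h)=s(u_h^{(n)},v_h)+\ell(v_h)$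 for all $v_h\in V_h$. **Statement.** If $\sqrt{q_\beta q_\gamma}<1$, then for every discretisation as above the DGFEM solution $u_h$ exists and is unique, the source iterates $u_h^{(n)}$ are well defined and unique for every $u_h^{(0)}\in V_h$, and $u_h^{(n)}\to u_h$ as $n\to\infty$, both in the finite-dimensional space $V_h$ and in the norm $|||\cdot|||_a$. The convergence is independent of the discretisation parameters: for all $n\ge0$, $$|||u_h-u_h^{(n)}|||_a\le\big(\sqrt{q_\beta q_\gamma}\big)^n\,|||u_h-u_h^{(0)}|||_a ,$$ where $q_\beta$ and $q_\gamma$ depend only on $\alpha$, $\theta$, $\Omega$ and $\mathbb{E}$, and not on the meshes or on $p,q,r$. -/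

import Mathlib

open MeasureTheory Set Filter Topology
open scoped RealInnerProductSpace Pointwise

noncomputable section

namespace LBT

/-- The ambient Euclidean space `ℝ^d`. -/
abbrev Space (d : ℕ) := EuclideanSpace ℝ (Fin d)

/-- The angular domain: the Euclidean unit sphere of `ℝ^d`. -/
abbrev Dir (d : ℕ) := Metric.sphere (0 : Space d) 1

/-- The surface measure on the unit sphere. -/
def dirMeasure (d : ℕ) : Measure (Dir d) := (volume : Measure (Space d)).toSphere

/-- The `(d-1)`-dimensional surface measure on `ℝ^d`: the Hausdorff measure, normalised to agree
with area on hyperplanes. -/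
def surf (d : ℕ) : Measure (Space d) := Measure.euclideanHausdorffMeasure (d - 1)

/-! ### Boundaries of open sets -/

/-- Near `x`, the set `U` is the strict subgraph of a Lipschitz function over a hyperplane `ν^⊥`. -/
def IsLipschitzBoundaryPoint {d : ℕ} (U : Set (Space d)) (x : Space d) : Prop :=
  ∃ (ν : Space d) (K : NNReal) (g : Space d → ℝ) (ρ : ℝ),
    ‖ν‖ = 1 ∧ LipschitzWith K g ∧ 0 < ρ ∧
      ∀ y ∈ Metric.ball x ρ, (y ∈ U ↔ ⟪ν, y⟫ < g (y - ⟪ν, y⟫ • ν))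

/-- Bounded open sets with Lipschitz boundary. -/
structure IsLipschitzDomain {d : ℕ} (U : Set (Space d)) : Prop where
  isOpen : IsOpen U
  isBounded : Bornology.IsBounded U
  lipschitz : ∀ x ∈ frontier U, IsLipschitzBoundaryPoint U x

/-- `n` is the outward unit normal of `U` at `x`: to first order at `x`, the set `U` is the
half-space `{y | ⟪y - x, n⟫ < 0}`. -/
def IsOutwardNormal {d : ℕ} (U : Set (Space d)) (x n : Space d) : Prop :=
  ‖n‖ = 1 ∧ ∀ ε > 0, ∃ δ > 0, ∀ y : Space d, ‖y - x‖ < δ →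
    (⟪y - x, n⟫ < -(ε * ‖y - x‖) → y ∈ U) ∧ (ε * ‖y - x‖ < ⟪y - x, n⟫ → y ∉ U)

/-- The boundary points at which the outward unit normal exists; for a polytope these are the points
of its open facets. -/
def faces {d : ℕ} (U : Set (Space d)) : Set (Space d) :=
  {x | x ∈ frontier U ∧ ∃ n, IsOutwardNormal U x n}

open Classical in
/-- The outward unit normal field on `faces U` (and `0` elsewhere). -/
def normal {d : ℕ} (U : Set (Space d)) (x : Space d) : Space d :=
  if h : ∃ n, IsOutwardNormal U x n then h.choose else 0

/-- The inflow boundary `∂₋U` for the direction `μ`. -/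
def inflow {d : ℕ} (U : Set (Space d)) (μ : Dir d) : Set (Space d) :=
  {x | x ∈ faces U ∧ ⟪(μ : Space d), normal U x⟫ < 0}

/-- The outflow boundary `∂₊U` for the direction `μ`. -/
def outflow {d : ℕ} (U : Set (Space d)) (μ : Dir d) : Set (Space d) :=
  {x | x ∈ faces U ∧ 0 ≤ ⟪(μ : Space d), normal U x⟫}

/-! ### Problem data -/

/-- The macroscopic scattering cross-section
`β(x,E) = ∫_𝔼 ∫_𝕊 θ(x, μ·μ', E → E') dμ' dE'`, where `θ x t E E'` stands for `θ(x, t, E → E')`.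
It does not depend on `μ`, see `scatterOut_eq`. -/
def scatterOut {d : ℕ} (Emin Emax : ℝ) (θ : Space d → ℝ → ℝ → ℝ → ℝ)
    (x : Space d) (μ : Dir d) (E : ℝ) : ℝ :=
  ∫ E' in Icc Emin Emax, ∫ μ' : Dir d, θ x ⟪(μ : Space d), (μ' : Space d)⟫ E E' ∂(dirMeasure d)

/-- The cross-section `γ(x,E) = ∫_𝔼 ∫_𝕊 θ(x, μ'·μ, E' → E) dμ' dE'`.
It does not depend on `μ`, see `scatterIn_eq`. -/
def scatterIn {d : ℕ} (Emin Emax : ℝ) (θ : Space d → ℝ → ℝ → ℝ → ℝ)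
    (x : Space d) (μ : Dir d) (E : ℝ) : ℝ :=
  ∫ E' in Icc Emin Emax, ∫ μ' : Dir d, θ x ⟪(μ' : Space d), (μ : Space d)⟫ E' E ∂(dirMeasure d)

/-- A linear isometry acting on the unit sphere. -/
def rotate {d : ℕ} (R : Space d ≃ₗᵢ[ℝ] Space d) (μ : Dir d) : Dir d :=
  ⟨R μ, by simp⟩

theorem measurePreserving_rotate {d : ℕ} (R : Space d ≃ₗᵢ[ℝ] Space d) :
    MeasurePreserving (rotate R) (dirMeasure d) (dirMeasure d) := by
  have hc : Continuous (rotate R) := by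
    unfold rotate
    exact Continuous.subtype_mk (R.continuous.comp continuous_subtype_val) _
  refine ⟨hc.measurable, ?_⟩
  ext s hs
  rw [Measure.map_apply hc.measurable hs, dirMeasure,
    Measure.toSphere_apply' _ (hc.measurable hs), Measure.toSphere_apply' _ hs]
  congr 1
  have key : (Ioo (0 : ℝ) 1 • ((↑) '' (rotate R ⁻¹' s) : Set (Space d)))
      = R ⁻¹' (Ioo (0 : ℝ) 1 • ((↑) '' s : Set (Space d))) := by
    ext y
    simp only [Set.mem_smul, mem_image, mem_preimage]
    constructor
    · rintro ⟨r, hr, _, ⟨μ, hμ, rfl⟩, rfl⟩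
      exact ⟨r, hr, _, ⟨rotate R μ, hμ, rfl⟩, by simp [rotate]⟩
    · rintro ⟨r, hr, _, ⟨μ, hμ, rfl⟩, h⟩
      refine ⟨r, hr, _, ⟨rotate R.symm μ, ?_, rfl⟩, ?_⟩
      · have : rotate R (rotate R.symm μ) = μ := by ext1; simp [rotate]
        rwa [this]
      · apply R.injective
        rw [← h]; simp [rotate]
  rw [key]
  exact R.measurePreserving.measure_preimage_equiv (f := R.toMeasurableEquiv) _

theorem integral_dir_eq {d : ℕ} (F : ℝ → ℝ) (μ ν : Dir d) :
    ∫ μ' : Dir d, F ⟪(μ : Space d), (μ' : Space d)⟫ ∂(dirMeasure d)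
      = ∫ μ' : Dir d, F ⟪(ν : Space d), (μ' : Space d)⟫ ∂(dirMeasure d) := by
  let R : Space d ≃ₗᵢ[ℝ] Space d := (Submodule.span ℝ {(μ : Space d) - ν})ᗮ.reflection
  have hR : R μ = ν := Submodule.reflection_sub (by simp)
  have hemb : MeasurableEmbedding (rotate R) := by
    have hc : Continuous (rotate R) := by
      unfold rotate
      exact Continuous.subtype_mk (R.continuous.comp continuous_subtype_val) _
    refine hc.measurableEmbedding ?_
    intro a b h
    have : R a = R b := congrArg Subtype.val h
    exact Subtype.ext (R.injective this)
  rw [← (measurePreserving_rotate R).integral_comp hemb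
    (fun μ' : Dir d => F ⟪(ν : Space d), (μ' : Space d)⟫)]
  congr 1
  ext μ'
  rw [← hR]
  simp [rotate]

theorem scatterOut_eq {d : ℕ} (Emin Emax : ℝ) (θ : Space d → ℝ → ℝ → ℝ → ℝ)
    (x : Space d) (μ ν : Dir d) (E : ℝ) :
    scatterOut Emin Emax θ x μ E = scatterOut Emin Emax θ x ν E := by
  unfold scatterOut
  congr 1
  ext E'
  exact integral_dir_eq (fun t => θ x t E E') μ ν

theorem scatterIn_eq {d : ℕ} (Emin Emax : ℝ) (θ : Space d → ℝ → ℝ → ℝ → ℝ)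
    (x : Space d) (μ ν : Dir d) (E : ℝ) :
    scatterIn Emin Emax θ x μ E = scatterIn Emin Emax θ x ν E := by
  unfold scatterIn
  congr 1
  ext E'
  simp_rw [real_inner_comm (μ : Space d), real_inner_comm (ν : Space d)]
  exact integral_dir_eq (fun t => θ x t E' E) μ ν

/-- The data of the stationary linear Boltzmann transport problem: spatial domain, energy interval,
absorption cross-section `α`, scattering kernel `θ x t E' E = θ(x, t, E' → E)`, forcing term `f`
and inflow datum `gD`. -/
structure TransportData (d : ℕ) where
  Ω : Set (Space d)
  Emin : ℝ
  Emax : ℝ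
  α : Space d → ℝ → ℝ
  θ : Space d → ℝ → ℝ → ℝ → ℝ
  f : Space d → Dir d → ℝ → ℝ
  gD : Space d → Dir d → ℝ → ℝ
  domain : IsLipschitzDomain Ω
  Emin_nonneg : 0 ≤ Emin
  Emin_lt : Emin < Emax
  /- The kernel is measurable, non-negative, without gain of energy, and the integrals that define
  `β` and `γ` converge. -/
  θ_measurable : Measurable fun z : Space d × ℝ × ℝ × ℝ => θ z.1 z.2.1 z.2.2.1 z.2.2.2
  θ_nonneg : ∀ x ∈ Ω, ∀ t ∈ Icc (-1 : ℝ) 1, ∀ E' ∈ Icc Emin Emax, ∀ E ∈ Icc Emin Emax,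
    0 ≤ θ x t E' E
  θ_eq_zero : ∀ x ∈ Ω, ∀ t ∈ Icc (-1 : ℝ) 1, ∀ E' ∈ Icc Emin Emax, ∀ E ∈ Icc Emin Emax,
    E' < E → θ x t E' E = 0
  θ_integrable_out : ∀ x ∈ Ω, ∀ μ : Dir d, ∀ E ∈ Icc Emin Emax,
    Integrable (fun z : Dir d × ℝ => θ x ⟪(μ : Space d), (z.1 : Space d)⟫ E z.2)
      ((dirMeasure d).prod (volume.restrict (Icc Emin Emax)))
  θ_integrable_in : ∀ x ∈ Ω, ∀ μ : Dir d, ∀ E ∈ Icc Emin Emax,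
    Integrable (fun z : Dir d × ℝ => θ x ⟪(z.1 : Space d), (μ : Space d)⟫ z.2 E)
      ((dirMeasure d).prod (volume.restrict (Icc Emin Emax)))
  α_nonneg : ∀ x ∈ Ω, ∀ E ∈ Icc Emin Emax, 0 ≤ α x E
  /- `α` and `β` are integrable over `Ω × 𝔼`. -/
  α_integrable : Integrable (fun z : Space d × ℝ => α z.1 z.2)
    ((volume.restrict Ω).prod (volume.restrict (Icc Emin Emax)))
  β_integrable : ∀ μ : Dir d, Integrable (fun z : Space d × ℝ => scatterOut Emin Emax θ z.1 μ z.2)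
    ((volume.restrict Ω).prod (volume.restrict (Icc Emin Emax)))
  /- `α + (β - γ) / 2` is bounded below by a positive constant. -/
  alphaBar_lower : ∃ α₀ > 0, ∀ x ∈ Ω, ∀ μ : Dir d, ∀ E ∈ Icc Emin Emax,
    α₀ ≤ α x E + 1 / 2 * (scatterOut Emin Emax θ x μ E - scatterIn Emin Emax θ x μ E)
  f_integrable : Integrable (fun z : Space d × Dir d × ℝ => f z.1 z.2.1 z.2.2)
    ((volume.restrict Ω).prod ((dirMeasure d).prod (volume.restrict (Icc Emin Emax))))
  /- `gD` is integrable over the inflow boundary with respect to the weight `|μ·n|`, which is there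
  the negative part of `μ·n`. -/
  gD_integrable : Integrable
    (fun z : Space d × Dir d × ℝ =>
      max 0 (-⟪(z.2.1 : Space d), normal Ω z.1⟫) * gD z.1 z.2.1 z.2.2)
    (((surf d).restrict (frontier Ω)).prod
      ((dirMeasure d).prod (volume.restrict (Icc Emin Emax))))

namespace TransportData

variable {d : ℕ} (D : TransportData d)

/-- The energy domain `𝔼`. -/
def energies : Set ℝ := Icc D.Emin D.Emax

def β (x : Space d) (μ : Dir d) (E : ℝ) : ℝ := scatterOut D.Emin D.Emax D.θ x μ E

def γ (x : Space d) (μ : Dir d) (E : ℝ) : ℝ := scatterIn D.Emin D.Emax D.θ x μ E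

/-- `q_β = sup β / (α + β)`. -/
def qβ : ℝ := sSup {c | ∃ x ∈ D.Ω, ∃ E ∈ D.energies, ∃ μ : Dir d,
  c = D.β x μ E / (D.α x E + D.β x μ E)}

/-- `q_γ = sup γ / (α + β)`. -/
def qγ : ℝ := sSup {c | ∃ x ∈ D.Ω, ∃ E ∈ D.energies, ∃ μ : Dir d,
  c = D.γ x μ E / (D.α x E + D.β x μ E)}

/-- The scattering operator. -/
def scatter (w : Space d → Dir d → ℝ → ℝ) (x : Space d) (μ : Dir d) (E : ℝ) : ℝ :=
  ∫ E' in D.energies, ∫ μ' : Dir d,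
    D.θ x ⟪(μ' : Space d), (μ : Space d)⟫ E' E * w x μ' E' ∂(dirMeasure d)

end TransportData

/-! ### Meshes -/

/-- A subdivision of `Ω` into finitely many disjoint open elements. The boundary of an element has
finite area and is a Lipschitz graph locally around each of its points, except for a set of zero area
(such as the union of the lower-dimensional facets of a polytope). -/
structure SpatialMesh {d : ℕ} (Ω : Set (Space d)) where
  card : ℕ
  elem : Fin card → Set (Space d)
  isOpen : ∀ i, IsOpen (elem i)
  nonempty : ∀ i, (elem i).Nonempty
  subset : ∀ i, elem i ⊆ Ω
  disjoint : ∀ i k, i ≠ k → Disjoint (elem i) (elem k)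
  cover : closure Ω = ⋃ i, closure (elem i)
  finite_area : ∀ i, surf d (frontier (elem i)) < ⊤
  regular : ∀ i, surf d {x | x ∈ frontier (elem i) ∧ ¬ IsLipschitzBoundaryPoint (elem i) x} = 0

/-- A tensor-product (box-shaped) element in a facet `{y | y face = sign}` of the cube `[-1,1]^d`. -/
structure CubeCell (d : ℕ) where
  face : Fin d
  sign : ℝ
  lo : Fin d → ℝ
  hi : Fin d → ℝ
  sign_eq : sign = 1 ∨ sign = -1
  lo_ge : ∀ k, k ≠ face → -1 ≤ lo k
  lo_lt_hi : ∀ k, k ≠ face → lo k < hi k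
  hi_le : ∀ k, k ≠ face → hi k ≤ 1

/-- The closed box. -/
def CubeCell.carrier {d : ℕ} (c : CubeCell d) : Set (Space d) :=
  {y | y c.face = c.sign ∧ ∀ k, k ≠ c.face → c.lo k ≤ y k ∧ y k ≤ c.hi k}

/-- The relatively open box. -/
def CubeCell.inner {d : ℕ} (c : CubeCell d) : Set (Space d) :=
  {y | y c.face = c.sign ∧ ∀ k, k ≠ c.face → c.lo k < y k ∧ y k < c.hi k}

/-- The image of the relatively open box under the radial projection `y ↦ y / |y|₂` onto the
sphere: a curved angular element. -/
def CubeCell.curved {d : ℕ} (c : CubeCell d) : Set (Dir d) :=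
  {μ | ∃ y ∈ c.inner, (μ : Space d) = ‖y‖⁻¹ • y}

/-- A cube-sphere mesh, given by a mesh of the surface of the cube `[-1,1]^d`, that is, of the unit
sphere of the sup norm. -/
structure AngularMesh (d : ℕ) where
  card : ℕ
  cell : Fin card → CubeCell d
  disjoint : ∀ i k, i ≠ k → Disjoint (cell i).inner (cell k).inner
  cover : {y : Space d | ‖(WithLp.ofLp y : Fin d → ℝ)‖ = 1} = ⋃ i, (cell i).carrier

/-- A partition `Emax = E_0 > E_1 > ⋯ > E_N = Emin` into energy groups. -/
structure EnergyMesh (Emin Emax : ℝ) where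
  card : ℕ
  node : Fin (card + 1) → ℝ
  anti : StrictAnti node
  first : node 0 = Emax
  last : node (Fin.last card) = Emin

/-- The energy group `(E_g, E_{g-1})`, with groups numbered from `0`. -/
def EnergyMesh.group {Emin Emax : ℝ} (T : EnergyMesh Emin Emax) (g : Fin T.card) : Set ℝ :=
  Ioo (T.node g.succ) (T.node g.castSucc)

/-! ### Finite element spaces -/

/-- Discontinuous piecewise polynomials of total degree at most `p`. Such a function is given by its
restriction to each element, extended to `ℝ^d` as a polynomial, so that the trace on the boundary of
an element from its inside is the value of that polynomial. -/
def spatialSpace {d : ℕ} {Ω : Set (Space d)} (T : SpatialMesh Ω) (p : ℕ) :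
    Set (Fin T.card → Space d → ℝ) :=
  {v | ∀ i, ∃ P : MvPolynomial (Fin d) ℝ, P.totalDegree ≤ p ∧
    ∀ x, v i x = MvPolynomial.eval (fun k => x k) P}

/-- Functions on the sphere which on each curved element are polynomials of degree at most `q` in
each coordinate of the flat element, composed with the inverse of the radial projection; they are
normalised to vanish on the null set outside the open curved elements. (The coordinate that is
constant on the flat element contributes only constants.) -/
def angularSpace {d : ℕ} (T : AngularMesh d) (q : ℕ) : Set (Dir d → ℝ) :=
  {v | (∀ j, ∃ P : MvPolynomial (Fin d) ℝ, (∀ k, P.degreeOf k ≤ q) ∧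
      ∀ y ∈ (T.cell j).inner, ∀ μ : Dir d, (μ : Space d) = ‖y‖⁻¹ • y →
        v μ = MvPolynomial.eval (fun k => y k) P) ∧
    ∀ μ, (∀ j, μ ∉ (T.cell j).curved) → v μ = 0}

/-- Functions of the energy which are polynomials of degree at most `r` on each energy group,
normalised to vanish outside the open groups. -/
def energySpace {Emin Emax : ℝ} (T : EnergyMesh Emin Emax) (r : ℕ) : Set (ℝ → ℝ) :=
  {v | (∀ g, ∃ P : Polynomial ℝ, P.natDegree ≤ r ∧ ∀ E ∈ T.group g, v E = P.eval E) ∧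
    ∀ E, (∀ g, E ∉ T.group g) → v E = 0}

/-- The discretisation parameters: the three meshes and the three polynomial degrees. -/
structure Discretisation {d : ℕ} (D : TransportData d) where
  space : SpatialMesh D.Ω
  angle : AngularMesh d
  energy : EnergyMesh D.Emin D.Emax
  p : ℕ
  q : ℕ
  r : ℕ

namespace Discretisation

variable {d : ℕ} {D : TransportData d} (T : Discretisation D)

/-- Broken functions of `(x, μ, E)`: one function of `(x, μ, E)` for each spatial element. -/
abbrev Broken := Fin T.space.card → Space d → Dir d → ℝ → ℝ

/-- The space-angle-energy finite element space: the tensor product of the three spaces. -/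
def feSpace : Submodule ℝ T.Broken :=
  Submodule.span ℝ {v | ∃ φ ∈ spatialSpace T.space T.p, ∃ ψ ∈ angularSpace T.angle T.q,
    ∃ χ ∈ energySpace T.energy T.r, v = fun i x μ E => φ i x * ψ μ * χ E}

open Classical in
/-- The function on `Ω × 𝕊 × 𝔼` that a broken function represents (it is set to `0` off the
spatial elements, a null set). -/
def glue (v : T.Broken) (x : Space d) (μ : Dir d) (E : ℝ) : ℝ :=
  ∑ i, if x ∈ T.space.elem i then v i x μ E else 0

open Classical in
/-- The exterior trace `v⁻` on the boundary of element `i`: the value from the neighbouring element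
(which is unique at almost every boundary point inside `Ω`). -/
def ext (v : T.Broken) (i : Fin T.space.card) (x : Space d) (μ : Dir d) (E : ℝ) : ℝ :=
  ∑ k, if k ≠ i ∧ x ∈ closure (T.space.elem k) then v k x μ E else 0

/-- The weight `|μ·n|` on the boundary of element `i`. -/
def weight (i : Fin T.space.card) (x : Space d) (μ : Dir d) : ℝ :=
  |⟪(μ : Space d), normal (T.space.elem i) x⟫|

/-- The transport bilinear form `a(w,v)`. -/
def formA (w v : T.Broken) : ℝ :=
  ∫ E in D.energies, ∫ μ : Dir d, (∑ i,
    ((∫ x in T.space.elem i,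
        (-(w i x μ E * fderiv ℝ (fun y => v i y μ E) x (μ : Space d))
          + (D.α x E + D.β x μ E) * w i x μ E * v i x μ E))
      + (∫ x in outflow (T.space.elem i) μ,
          T.weight i x μ * w i x μ E * v i x μ E ∂(surf d))
      - (∫ x in inflow (T.space.elem i) μ \ frontier D.Ω,
          T.weight i x μ * T.ext w i x μ E * v i x μ E ∂(surf d)))) ∂(dirMeasure d)

/-- The scattering bilinear form `s(w,v)`. -/
def formS (w v : T.Broken) : ℝ :=
  ∫ E in D.energies, ∫ μ : Dir d, (∫ x in D.Ω,
    D.scatter (T.glue w) x μ E * T.glue v x μ E) ∂(dirMeasure d)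

/-- The right-hand side functional `ℓ(v)`. -/
def load (v : T.Broken) : ℝ :=
  ∫ E in D.energies, ∫ μ : Dir d, (∑ i,
    ((∫ x in T.space.elem i, D.f x μ E * v i x μ E)
      + (∫ x in inflow (T.space.elem i) μ ∩ frontier D.Ω,
          T.weight i x μ * D.gD x μ E * v i x μ E ∂(surf d)))) ∂(dirMeasure d)

/-- The norm `|||v|||_a`. -/
def normA (v : T.Broken) : ℝ :=
  √((∫ E in D.energies, ∫ μ : Dir d, (∫ x in D.Ω,
        (D.α x E + D.β x μ E) * T.glue v x μ E ^ 2) ∂(dirMeasure d))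
    + 1 / 2 * ∫ E in D.energies, ∫ μ : Dir d, (∑ i,
        ((∫ x in inflow (T.space.elem i) μ \ frontier D.Ω,
            T.weight i x μ * (v i x μ E - T.ext v i x μ E) ^ 2 ∂(surf d))
          + (∫ x in faces (T.space.elem i) ∩ frontier D.Ω,
              T.weight i x μ * v i x μ E ^ 2 ∂(surf d)))) ∂(dirMeasure d))

/-- `u` solves the DGFEM problem `a(u,v) = s(u,v) + ℓ(v)` for all `v`. -/
def IsSolution (u : T.feSpace) : Prop :=
  ∀ v : T.feSpace, T.formA u v = T.formS u v + T.load v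

/-- `u` is a sequence of source iterates: `a(u_{n+1},v) = s(u_n,v) + ℓ(v)` for all `v` and `n`. -/
def IsSourceIteration (u : ℕ → T.feSpace) : Prop :=
  ∀ n, ∀ v : T.feSpace, T.formA (u (n + 1)) v = T.formS (u n) v + T.load v

end Discretisation

end LBT

end

open MeasureTheory Set Filter Topology
open scoped RealInnerProductSpace Pointwise

noncomputable section

namespace LBT

/-! ### Outward normals -/

namespace IsOutwardNormal

variable {d : ℕ} {U V : Set (Space d)} {x n m w : Space d}

/-! Source iteration is a contraction in the norm in which the transport form is exactly coercive.
Testing the upwind form with its own argument gives a(v,v) = |||v|||_a² (`transportForm_self`): on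
each element the divergence theorem for the field v²μ turns the streaming term into boundary
integrals, and after summation over the elements the fluxes through interior faces cancel up to the
squares of the jumps. Scattering satisfies |s(w,v)| ≤ √(qβ qγ) |||w|||_a |||v|||_a
(`abs_scatterForm_le`), by Cauchy–Schwarz with the kernel θ as weight: integrating θ over the state
after scattering leaves β against w², integrating it over the state before leaves γ against v², and
both are controlled by α + β. The errors satisfy a(e_{n+1}, v) = s(e_n, v), and the choice v =
e_{n+1} gives the factor √(qβ qγ) per step (`normA_error_le`). No inverse or trace inequality
enters, so no constant sees the meshes or the degrees.

Well-posedness is linear algebra: the space is finite-dimensional and |||·|||_a vanishes only at 0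
(`eq_zero_of_normA_eq_zero`), so a and a − s are definite on the diagonal, hence injective as maps
into the dual and therefore bijective (`existsUnique_form_eq`). Convergence in the finite element
space follows because every linear functional is bounded by the norm (`exists_abs_le_of_form`).

Most of the work is the divergence theorem on elements whose boundary is regular only up to null
sets (`integral_fderiv_eq_surf`). It is proved by slicing with lines in the direction μ. On almost
every line the fundamental theorem of calculus holds with one term per boundary hit
(`hitSum_balance`), and the area formula `lintegral_hitSum` turns sums over hits into surface
integrals with weight |μ·n|. The area formula comes from cutting the boundary into almost flat
pieces and comparing the volume they sweep out with the determinant of a shear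
(`volume_sweep_approx`). Rademacher's theorem supplies normals almost everywhere
(`surf_lipschitz_diff_faces_eq_zero`), and `exists_neighbour` supplies the unique neighbour with
opposite normal that the cancellation of fluxes needs. -/

theorem eventually_mem (h : IsOutwardNormal U x n) (hw : ⟪w, n⟫ < 0) :
    ∀ᶠ s : ℝ in 𝓝[>] 0, x + s • w ∈ U := by
  have hw0 : 0 < ‖w‖ := norm_pos_iff.2 (by rintro rfl; simp at hw)
  obtain ⟨δ, hδ, H⟩ := h.2 (-⟪w, n⟫ / (2 * ‖w‖)) (by have := neg_pos.2 hw; positivity)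
  have : Ioo (0 : ℝ) (δ / ‖w‖) ∈ 𝓝[>] (0 : ℝ) := Ioo_mem_nhdsGT (by positivity)
  filter_upwards [this] with s hs
  have e : x + s • w - x = s • w := by abel
  refine (H _ ?_).1 ?_
  · rw [e, norm_smul, Real.norm_of_nonneg hs.1.le]
    exact (lt_div_iff₀ hw0).1 hs.2
  · rw [e, norm_smul, Real.norm_of_nonneg hs.1.le, real_inner_smul_left]
    have : -⟪w, n⟫ / (2 * ‖w‖) * (s * ‖w‖) = - (s * ⟪w, n⟫) / 2 := by field_simp
    rw [this]
    nlinarith [hs.1]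

theorem eventually_notMem_closure (h : IsOutwardNormal U x n) (hw : 0 < ⟪w, n⟫) :
    ∀ᶠ s : ℝ in 𝓝[>] 0, x + s • w ∉ closure U := by
  have hw0 : 0 < ‖w‖ := norm_pos_iff.2 (by rintro rfl; simp at hw)
  set ε := ⟪w, n⟫ / (2 * ‖w‖) with hε
  obtain ⟨δ, hδ, H⟩ := h.2 ε (by positivity)
  have : Ioo (0 : ℝ) (δ / ‖w‖) ∈ 𝓝[>] (0 : ℝ) := Ioo_mem_nhdsGT (by positivity)
  filter_upwards [this] with s hs
  have e : x + s • w - x = s • w := by abel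
  have ho : IsOpen {y : Space d | ‖y - x‖ < δ ∧ ε * ‖y - x‖ < ⟪y - x, n⟫} :=
    (isOpen_lt (by fun_prop) (by fun_prop)).and (isOpen_lt (by fun_prop) (by fun_prop))
  intro hc
  obtain ⟨y, hy, hyU⟩ := mem_closure_iff.1 hc _ ho ⟨by
    rw [e, norm_smul, Real.norm_of_nonneg hs.1.le]
    exact (lt_div_iff₀ hw0).1 hs.2, by
    rw [e, norm_smul, Real.norm_of_nonneg hs.1.le, real_inner_smul_left]
    have : ε * (s * ‖w‖) = (s * ⟪w, n⟫) / 2 := by rw [hε]; field_simp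
    rw [this]
    nlinarith [hs.1]⟩
  exact (H y hy.1).2 hy.2 hyU

theorem mem_frontier (h : IsOutwardNormal U x n) : x ∈ frontier U := by
  have hn : ⟪n, n⟫ = 1 := by rw [real_inner_self_eq_norm_sq, h.1]; norm_num
  have ht : ∀ w : Space d, Tendsto (fun s : ℝ => x + s • w) (𝓝[>] 0) (𝓝 x) := fun w => by
    have : Tendsto (fun s : ℝ => x + s • w) (𝓝 0) (𝓝 (x + (0 : ℝ) • w)) :=
      Continuous.tendsto (by fun_prop) 0
    simpa using this.mono_left nhdsWithin_le_nhds
  rw [frontier_eq_closure_inter_closure]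
  refine ⟨mem_closure_of_tendsto (ht (-n)) (h.eventually_mem (by simp [h.1])),
    mem_closure_of_tendsto (ht n) ?_⟩
  filter_upwards [h.eventually_notMem_closure (w := n) (by simp [h.1])] with s hs
  exact fun hU => hs (subset_closure hU)

/-- If n ≠ m, the direction m − n enters U and at the same time leaves the closure of V. With U = V
this is uniqueness of the normal; with an element inside Ω it identifies the two normals at a common
boundary point. -/
theorem eq_of_subset (h : IsOutwardNormal U x n) (h' : IsOutwardNormal V x m) (hUV : U ⊆ V) :
    n = m := by
  by_contra hne
  have hlt : ⟪n, m⟫ < 1 := (inner_lt_one_iff_real_of_norm_eq_one h.1 h'.1).2 hne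
  have h1 := h.eventually_mem (w := m - n) (by
    rw [inner_sub_left, real_inner_self_eq_norm_sq, h.1, real_inner_comm]; linarith)
  have h2 := h'.eventually_notMem_closure (w := m - n) (by
    rw [inner_sub_left, real_inner_self_eq_norm_sq, h'.1]; linarith)
  obtain ⟨s, hs1, hs2⟩ := (h1.and h2).exists
  exact hs2 (subset_closure (hUV hs1))

/-- Otherwise the direction −(n + m) would point strictly into both sets. -/
theorem eq_neg_of_disjoint (h : IsOutwardNormal U x n) (h' : IsOutwardNormal V x m)
    (hUV : Disjoint U V) : m = -n := by
  by_contra hne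
  have hlt : ⟪m, -n⟫ < 1 := (inner_lt_one_iff_real_of_norm_eq_one h'.1 (by simp [h.1])).2 hne
  rw [inner_neg_right] at hlt
  have h1 := h.eventually_mem (w := -(n + m)) (by
    rw [inner_neg_left, inner_add_left, real_inner_self_eq_norm_sq, h.1]; linarith)
  have h2 := h'.eventually_mem (w := -(n + m)) (by
    rw [inner_neg_left, inner_add_left, real_inner_self_eq_norm_sq, h'.1, real_inner_comm]
    linarith)
  obtain ⟨s, hs1, hs2⟩ := (h1.and h2).exists
  exact Set.disjoint_left.1 hUV hs1 hs2

/-- Near x the set contains one open cone and avoids the opposite one, so its frontier is squeezed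
between them and is tangent to the hyperplane orthogonal to n. -/
theorem abs_inner_le (h : IsOutwardNormal U x n) (hU : IsOpen U) {ε : ℝ} (hε : 0 < ε) :
    ∃ δ > 0, ∀ y ∈ frontier U, ‖y - x‖ < δ → |⟪y - x, n⟫| ≤ ε * ‖y - x‖ := by
  obtain ⟨δ, hδ, H⟩ := h.2 ε hε
  refine ⟨δ, hδ, fun y hy hyx => ?_⟩
  rw [hU.frontier_eq] at hy
  by_contra! hlt
  rcases lt_abs.1 hlt with h1 | h1
  · have ho : IsOpen {y : Space d | ‖y - x‖ < δ ∧ ε * ‖y - x‖ < ⟪y - x, n⟫} :=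
      (isOpen_lt (by fun_prop) (by fun_prop)).and (isOpen_lt (by fun_prop) (by fun_prop))
    obtain ⟨z, hz, hzU⟩ := mem_closure_iff.1 hy.1 _ ho ⟨hyx, h1⟩
    exact (H z hz.1).2 hz.2 hzU
  · exact hy.2 ((H y hyx).1 (by linarith))

end IsOutwardNormal

section Normal

variable {d : ℕ} {U V : Set (Space d)} {x : Space d}

theorem isOutwardNormal_normal (hx : x ∈ faces U) : IsOutwardNormal U x (normal U x) := by
  have := hx.2
  rw [normal, dif_pos this]
  exact this.choose_spec

theorem normal_eq {n : Space d} (h : IsOutwardNormal U x n) : normal U x = n :=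
  (isOutwardNormal_normal ⟨h.mem_frontier, n, h⟩).eq_of_subset h Subset.rfl

theorem normal_eq_zero (hx : x ∉ faces U) : normal U x = 0 := by
  rw [normal, dif_neg]
  rintro ⟨n, h⟩
  exact hx ⟨h.mem_frontier, n, h⟩

theorem mem_faces_iff : x ∈ faces U ↔ ∃ n, IsOutwardNormal U x n :=
  ⟨fun h => h.2, fun ⟨n, h⟩ => ⟨h.mem_frontier, n, h⟩⟩

theorem norm_normal (hx : x ∈ faces U) : ‖normal U x‖ = 1 := (isOutwardNormal_normal hx).1

theorem norm_normal_le (U : Set (Space d)) (x : Space d) : ‖normal U x‖ ≤ 1 := by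
  by_cases hx : x ∈ faces U
  · exact (norm_normal hx).le
  · simp [normal_eq_zero hx]

/-- Both ε and δ may be restricted to the values 1/(k+1). For fixed ε, δ and y the condition is
violated on an open set of pairs (x, n), because all inequalities are strict; hence each set R ε δ
is closed. -/
theorem measurableSet_isOutwardNormal (U : Set (Space d)) :
    MeasurableSet {z : Space d × Space d | IsOutwardNormal U z.1 z.2} := by
  let R : ℝ → ℝ → Set (Space d × Space d) := fun ε δ => {z | ∀ y : Space d, ‖y - z.1‖ < δ →
    (⟪y - z.1, z.2⟫ < -(ε * ‖y - z.1‖) → y ∈ U) ∧ (ε * ‖y - z.1‖ < ⟪y - z.1, z.2⟫ → y ∉ U)}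
  have hR : ∀ ε δ, IsClosed (R ε δ) := by
    intro ε δ
    simp only [R, ofPred_forall]
    refine isClosed_iInter fun y => ?_
    have : {z : Space d × Space d | ‖y - z.1‖ < δ →
        (⟪y - z.1, z.2⟫ < -(ε * ‖y - z.1‖) → y ∈ U) ∧ (ε * ‖y - z.1‖ < ⟪y - z.1, z.2⟫ → y ∉ U)}
      = {z | ‖y - z.1‖ < δ ∧ ((⟪y - z.1, z.2⟫ < -(ε * ‖y - z.1‖) ∧ y ∉ U) ∨
          (ε * ‖y - z.1‖ < ⟪y - z.1, z.2⟫ ∧ y ∈ U))}ᶜ := by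
      ext z; simp only [mem_ofPred_eq, mem_compl_iff]; tauto
    rw [this]
    refine IsOpen.isClosed_compl ?_
    by_cases hy : y ∈ U
    · simp only [hy, not_true, and_false, and_true, false_or]
      exact (isOpen_lt (by fun_prop) (by fun_prop)).and (isOpen_lt (by fun_prop) (by fun_prop))
    · simp only [hy, not_false_eq_true, and_false, and_true, or_false]
      exact (isOpen_lt (by fun_prop) (by fun_prop)).and (isOpen_lt (by fun_prop) (by fun_prop))
  have key : {z : Space d × Space d | IsOutwardNormal U z.1 z.2}
      = {z | ‖z.2‖ = 1} ∩ ⋂ k : ℕ, ⋃ j : ℕ, R (1 / (k + 1)) (1 / (j + 1)) := by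
    ext z
    simp only [IsOutwardNormal, mem_ofPred_eq, mem_inter_iff, mem_iInter, mem_iUnion]
    refine and_congr_right fun hz => ⟨fun H k => ?_, fun H ε hε => ?_⟩
    · obtain ⟨δ, hδ, hδ'⟩ := H (1 / (k + 1)) (by positivity)
      obtain ⟨j, hj⟩ := exists_nat_one_div_lt hδ
      exact ⟨j, fun y hy => hδ' y (hy.trans hj)⟩
    · obtain ⟨k, hk⟩ := exists_nat_one_div_lt hε
      obtain ⟨j, hj⟩ := H k
      refine ⟨1 / (j + 1), by positivity, fun y hy => ?_⟩
      have hle : (1 / ((k : ℝ) + 1)) * ‖y - z.1‖ ≤ ε * ‖y - z.1‖ := by gcongr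
      exact ⟨fun h => (hj y hy).1 (by linarith), fun h => (hj y hy).2 (by linarith)⟩
  rw [key]
  refine (isClosed_eq (by fun_prop) (by fun_prop)).measurableSet.inter ?_
  exact MeasurableSet.iInter fun k => MeasurableSet.iUnion fun j => (hR _ _).measurableSet

/-- Projections of Borel sets need not be Borel, but uniqueness of the normal makes this projection
injective, and the Lusin–Souslin theorem applies. This is the source of measurability for `faces`
and `normal`. -/
theorem measurableSet_exists_isOutwardNormal (U : Set (Space d)) {B : Set (Space d)}
    (hB : MeasurableSet B) : MeasurableSet {x | ∃ n ∈ B, IsOutwardNormal U x n} := by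
  have : {x | ∃ n ∈ B, IsOutwardNormal U x n}
      = Prod.fst '' ({z : Space d × Space d | IsOutwardNormal U z.1 z.2} ∩ Prod.snd ⁻¹' B) := by
    ext x
    simp only [mem_ofPred_eq, mem_image, mem_inter_iff, mem_preimage, Prod.exists]
    constructor
    · rintro ⟨n, hn, h⟩; exact ⟨x, n, ⟨h, hn⟩, rfl⟩
    · rintro ⟨a, n, ⟨h, hn⟩, rfl⟩; exact ⟨n, hn, h⟩
  rw [this]
  refine MeasurableSet.image_of_measurable_injOn
    ((measurableSet_isOutwardNormal U).inter (measurable_snd hB)) measurable_fst ?_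
  rintro ⟨a, n⟩ ⟨h, -⟩ ⟨b, m⟩ ⟨h', -⟩ (rfl : a = b)
  exact Prod.ext rfl (IsOutwardNormal.eq_of_subset h h' Subset.rfl)

theorem measurableSet_faces (U : Set (Space d)) : MeasurableSet (faces U) := by
  convert measurableSet_exists_isOutwardNormal U MeasurableSet.univ using 1
  ext x
  simp [mem_faces_iff]

theorem measurable_normal (U : Set (Space d)) : Measurable (normal U) := by
  intro B hB
  have : normal U ⁻¹' B = {x | ∃ n ∈ B, IsOutwardNormal U x n}
      ∪ ((faces U)ᶜ ∩ {_x | (0 : Space d) ∈ B}) := by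
    ext x
    simp only [mem_preimage, mem_union, mem_ofPred_eq, mem_inter_iff, mem_compl_iff]
    by_cases hx : x ∈ faces U
    · simp only [hx, not_true, false_and, or_false]
      exact ⟨fun h => ⟨_, h, isOutwardNormal_normal hx⟩, fun ⟨n, hn, h⟩ => by rwa [normal_eq h]⟩
    · simp only [normal_eq_zero hx, hx, not_false_eq_true, true_and]
      refine ⟨Or.inr, ?_⟩
      rintro (⟨n, -, h⟩ | h)
      · exact absurd (mem_faces_iff.2 ⟨n, h⟩) hx
      · exact h
  rw [this]
  exact (measurableSet_exists_isOutwardNormal U hB).union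
    ((measurableSet_faces U).compl.inter (MeasurableSet.const _))

theorem faces_subset_frontier (U : Set (Space d)) : faces U ⊆ frontier U := fun _ h => h.1

end Normal

/-! ### Surface measure, projections and cylinders -/

section Surf

variable {d : ℕ}

theorem surf_image_le {K : NNReal} {f : Space d → Space d} {S : Set (Space d)}
    (hf : LipschitzOnWith K f S) : surf d (f '' S) ≤ (K : ENNReal) ^ (d - 1) * surf d S := by
  have h := hf.hausdorffMeasure_image_le (d := ((d - 1 : ℕ) : ℝ)) (by positivity)
  simp only [surf, Measure.euclideanHausdorffMeasure_def, Measure.smul_apply, ENNReal.smul_def,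
    smul_eq_mul]
  rw [ENNReal.rpow_natCast] at h
  calc _ ≤ _ * ((K : ENNReal) ^ (d - 1) * μH[((d - 1 : ℕ) : ℝ)] S) := mul_le_mul_right h _
    _ = _ := by ring

/-- A set of finite (d−1)-dimensional measure has zero d-dimensional measure. The case d = 0 has to
go because d − 1 is truncated subtraction. -/
theorem volume_eq_zero_of_surf_lt_top (hd : 1 ≤ d) {S : Set (Space d)} (hS : surf d S < ⊤) :
    volume S = 0 := by
  have h := Measure.euclideanHausdorffMeasure_zero_or_top (show d - 1 < d by omega) S
  rw [EuclideanSpace.euclideanHausdorffMeasure_eq_volume] at h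
  exact h.resolve_right hS.ne

/-- The component of a vector orthogonal to `c`, for a unit vector `c`. -/
def perp (c : Space d) : Space d →L[ℝ] Space d :=
  ContinuousLinearMap.id ℝ (Space d) - (innerSL ℝ c).smulRight c

theorem perp_apply (c y : Space d) : perp c y = y - ⟪c, y⟫ • c := rfl

theorem perp_eq_starProjection {c : Space d} (hc : ‖c‖ = 1) (y : Space d) :
    perp c y = (ℝ ∙ c)ᗮ.starProjection y := by
  rw [Submodule.starProjection_orthogonal_val, Submodule.starProjection_unit_singleton ℝ hc,
    perp_apply]

theorem norm_perp_le {c : Space d} (hc : ‖c‖ = 1) (y : Space d) : ‖perp c y‖ ≤ ‖y‖ := by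
  rw [perp_eq_starProjection hc]
  exact Submodule.norm_starProjection_apply_le _ _

theorem perp_self {c : Space d} (hc : ‖c‖ = 1) : perp c c = 0 := by
  rw [perp_apply, real_inner_self_eq_norm_sq, hc]; simp

theorem inner_perp {c : Space d} (hc : ‖c‖ = 1) (y : Space d) : ⟪c, perp c y⟫ = 0 := by
  rw [perp_apply, inner_sub_right, real_inner_smul_right, real_inner_self_eq_norm_sq, hc]; simp

theorem finrank_orthogonal_unit {c : Space d} (hc : ‖c‖ = 1) :
    Module.finrank ℝ (ℝ ∙ c)ᗮ = d - 1 := by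
  have h1 := (ℝ ∙ c).finrank_add_finrank_orthogonal
  rw [finrank_span_singleton (norm_ne_zero_iff.1 (by rw [hc]; exact one_ne_zero)),
    finrank_euclideanSpace, Fintype.card_fin] at h1
  omega

/-- The splitting of ℝ^d into the line of c and its orthogonal complement preserves measure. The
product measure of a rectangle factors for arbitrary sets, which spares all measurability questions
about projections. -/
theorem volume_cylinder {c : Space d} (hc : ‖c‖ = 1) (S : Set (Space d)) (J : Set ℝ) :
    volume {y | perp c y ∈ perp c '' S ∧ ⟪c, y⟫ ∈ J} = surf d (perp c '' S) * volume J := by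
  let e : Space d ≃ᵐ (ℝ ∙ c) × (ℝ ∙ c)ᗮ := (ℝ ∙ c).measurableEquivProd (0 : Space d)
  have he : MeasurePreserving e volume volume := by
    have h := (ℝ ∙ c).measurePreserving_measurableEquivProd (0 : Space d)
    rwa [InnerProductSpace.euclideanHausdorffMeasure_eq_volume] at h
  let i : ℝ ≃ₗᵢ[ℝ] (ℝ ∙ c) := LinearIsometryEquiv.toSpanUnitSingleton c hc
  let B : Set (ℝ ∙ c)ᗮ := {b | (b : Space d) ∈ perp c '' S}
  have hset : {y | perp c y ∈ perp c '' S ∧ ⟪c, y⟫ ∈ J} = e ⁻¹' ((i '' J) ×ˢ B) := by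
    ext y
    have h1 : (e y).1 = i ⟪c, y⟫ := by
      apply Subtype.ext
      simp only [e, i, Submodule.measurableEquivProd_apply, vsub_eq_sub, sub_zero,
        LinearIsometryEquiv.toSpanUnitSingleton_apply]
      rw [Submodule.coe_orthogonalProjectionOnto_apply,
        Submodule.starProjection_unit_singleton ℝ hc]
    have h2 : ((e y).2 : Space d) = perp c y := by
      simp only [e, Submodule.measurableEquivProd_apply, vsub_eq_sub, sub_zero]
      rw [Submodule.coe_orthogonalProjectionOnto_apply, perp_eq_starProjection hc]
    rw [mem_preimage, mem_prod, h1, i.injective.mem_set_image, and_comm]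
    simp only [B, mem_ofPred_eq, h2]
  rw [hset, he.measure_preimage_equiv, Measure.volume_eq_prod, Measure.prod_prod, mul_comm]
  congr 1
  · have hB : perp c '' S = Subtype.val '' B := by
      ext y
      constructor
      · rintro ⟨x, hx, rfl⟩
        refine ⟨⟨perp c x, ?_⟩, ⟨x, hx, rfl⟩, rfl⟩
        rw [perp_eq_starProjection hc]
        exact Submodule.starProjection_apply_mem _ _
      · rintro ⟨b, hb, rfl⟩; exact hb
    rw [hB, surf, isometry_subtype_coe.euclideanHausdorffMeasure_image,
      ← InnerProductSpace.euclideanHausdorffMeasure_eq_volume, finrank_orthogonal_unit hc]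
  · have := i.measurePreserving.measure_preimage_equiv (f := i.toMeasurableEquiv) (i '' J)
    rw [← this]
    congr 1
    exact i.injective.preimage_image J

/-- The image of `A × J` under the map `(x, t) ↦ x + t e`. -/
def sweep (e : Space d) (A : Set (Space d)) (J : Set ℝ) : Set (Space d) :=
  (fun z : Space d × ℝ => z.1 + z.2 • e) '' (A ×ˢ J)

/-- The linear map fixing `c^⊥` and sending the unit vector `c` to `e`. -/
def shear (c e : Space d) : Space d →L[ℝ] Space d :=
  ContinuousLinearMap.id ℝ (Space d) + (innerSL ℝ c).smulRight (e - c)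

theorem det_shear {c : Space d} (hc : ‖c‖ = 1) (e : Space d) : (shear c e).det = ⟪c, e⟫ := by
  have : (shear c e : Space d →ₗ[ℝ] Space d)
      = LinearMap.transvection (innerSL ℝ c : Space d →ₗ[ℝ] ℝ) (e - c) := by
    ext1 y; rfl
  rw [ContinuousLinearMap.det, this, LinearMap.transvection.det]
  change 1 + ⟪c, e - c⟫ = _
  rw [inner_sub_right, real_inner_self_eq_norm_sq, hc]
  ring

variable {c e : Space d} {r : ℝ} {A : Set (Space d)}

/-- A set that is r-flat with respect to c projects injectively along c, and the inverse of the
projection is Lipschitz with constant 1/(1 − r). -/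
theorem norm_le_of_abs_inner_le (hc : ‖c‖ = 1) {y : Space d}
    (hy : |⟪c, y⟫| ≤ r * ‖y‖) : (1 - r) * ‖y‖ ≤ ‖perp c y‖ := by
  have h : ‖y‖ ≤ ‖perp c y‖ + ‖⟪c, y⟫ • c‖ := by
    have := norm_add_le (perp c y) (⟪c, y⟫ • c)
    rwa [perp_apply, sub_add_cancel] at this
  rw [norm_smul, hc, mul_one, Real.norm_eq_abs] at h
  linarith

/-- Let g invert the projection `perp c` on A. Then y ↦ g(perp c y) + ⟪c,y⟫ e maps the straight
cylinder over the projection onto the swept set, and it differs from the shear by ⟪c, g(perp c y)⟫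
c. Flatness makes this height function Lipschitz with constant r/(1 − r) ≤ 2r. -/
theorem exists_approximatesLinearOn_shear (hc : ‖c‖ = 1) (hr0 : 0 ≤ r) (hr : r ≤ 1 / 2)
    (hA : ∀ x ∈ A, ∀ y ∈ A, |⟪c, x - y⟫| ≤ r * ‖x - y‖) (J : Set ℝ) :
    ∃ h : Space d → Space d, h '' {y | perp c y ∈ perp c '' A ∧ ⟪c, y⟫ ∈ J} = sweep e A J ∧
      ApproximatesLinearOn h (shear c e) {y | perp c y ∈ perp c '' A ∧ ⟪c, y⟫ ∈ J}
        (Real.toNNReal (2 * r)) := by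
  classical
  have hinj : InjOn (perp c) A := by
    intro x hx y hy hxy
    have h := norm_le_of_abs_inner_le hc (hA x hx y hy)
    rw [map_sub, hxy, sub_self, norm_zero] at h
    have : ‖x - y‖ ≤ 0 := by nlinarith [norm_nonneg (x - y)]
    exact sub_eq_zero.1 (norm_le_zero_iff.1 this)
  rcases A.eq_empty_or_nonempty with rfl | ⟨a, ha⟩
  · exact ⟨id, by simp [sweep], by simp⟩
  have : Nonempty (Space d) := ⟨a⟩
  let g : Space d → Space d := Function.invFunOn (perp c) A
  have hg : ∀ x ∈ A, g (perp c x) = x := fun x hx => hinj.leftInvOn_invFunOn hx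
  refine ⟨fun y => g (perp c y) + ⟪c, y⟫ • e, ?_, ?_⟩
  · ext z
    constructor
    · rintro ⟨y, ⟨⟨x, hx, hxy⟩, hJ⟩, rfl⟩
      refine ⟨(x, ⟪c, y⟫), ⟨hx, hJ⟩, ?_⟩
      simp only [← hxy, hg x hx]
    · rintro ⟨⟨x, t⟩, ⟨hx, ht⟩, rfl⟩
      have h1 : perp c (perp c x + t • c) = perp c x := by
        rw [map_add, map_smul, perp_self hc, smul_zero, add_zero, perp_apply c (perp c x),
          inner_perp hc, zero_smul, sub_zero]
      have h2 : ⟪c, perp c x + t • c⟫ = t := by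
        rw [inner_add_right, inner_perp hc, real_inner_smul_right, real_inner_self_eq_norm_sq, hc]
        ring
      refine ⟨perp c x + t • c, ⟨⟨x, hx, h1.symm⟩, by rwa [h2]⟩, ?_⟩
      simp only [h1, h2, hg x hx]
  · refine LipschitzOnWith.approximatesLinearOn (LipschitzOnWith.of_dist_le_mul fun y hy y' hy' => ?_)
    obtain ⟨⟨x, hx, hxy⟩, -⟩ := hy
    obtain ⟨⟨x', hx', hxy'⟩, -⟩ := hy'
    have hsub : perp c (y - y') = perp c (x - x') := by rw [map_sub, map_sub, hxy, hxy']
    have key : (g (perp c y) + ⟪c, y⟫ • e - shear c e y)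
        - (g (perp c y') + ⟪c, y'⟫ • e - shear c e y') = ⟪c, x - x'⟫ • c := by
      rw [← hxy, ← hxy', hg x hx, hg x' hx']
      have e1 : ∀ y, shear c e y = y + ⟪c, y⟫ • (e - c) := fun _ => rfl
      rw [perp_apply, perp_apply] at hsub
      have e2 : x - x' - ⟪c, x - x'⟫ • c = y - y' - ⟪c, y - y'⟫ • c := hsub.symm
      rw [e1, e1]
      have e3 : ⟪c, x - x'⟫ • c = x - x' - (y - y' - ⟪c, y - y'⟫ • c) := by rw [← e2]; abel
      rw [e3, inner_sub_right]
      module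
    rw [dist_eq_norm, dist_eq_norm]
    change ‖(g (perp c y) + ⟪c, y⟫ • e - shear c e y)
        - (g (perp c y') + ⟪c, y'⟫ • e - shear c e y')‖ ≤ _
    rw [key, norm_smul, hc, mul_one, Real.norm_eq_abs, Real.coe_toNNReal _ (by positivity)]
    have h1 := hA x hx x' hx'
    have h2 := norm_le_of_abs_inner_le hc h1
    rw [← hsub] at h2
    have h3 := norm_perp_le hc (y - y')
    have h4 : ‖x - x'‖ ≤ 2 * ‖y - y'‖ := by nlinarith [norm_nonneg (x - x')]
    nlinarith

theorem surf_perp_image_le (hc : ‖c‖ = 1) (A : Set (Space d)) :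
    surf d (perp c '' A) ≤ surf d A := by
  have : LipschitzOnWith 1 (perp c) A := LipschitzOnWith.of_dist_le_mul fun x _ y _ => by
    rw [dist_eq_norm, ← map_sub, dist_eq_norm, NNReal.coe_one, one_mul]
    exact norm_perp_le hc _
  simpa using surf_image_le this

/-- The set is the image of its projection under a map with Lipschitz constant 1/(1 − r), and `surf`
scales at most by the (d−1)-st power of such a constant. -/
theorem surf_le_perp_image (hc : ‖c‖ = 1) (hr : r ≤ 1 / 2)
    (hA : ∀ x ∈ A, ∀ y ∈ A, |⟪c, x - y⟫| ≤ r * ‖x - y‖) :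
    ENNReal.ofReal ((1 - r) ^ (d - 1)) * surf d A ≤ surf d (perp c '' A) := by
  classical
  have hpos : 0 < 1 - r := by linarith
  have hlip : ∀ x ∈ A, ∀ y ∈ A, ‖x - y‖ ≤ (1 - r)⁻¹ * ‖perp c x - perp c y‖ := fun x hx y hy => by
    rw [← map_sub, inv_mul_eq_div, le_div_iff₀ hpos, mul_comm]
    exact norm_le_of_abs_inner_le hc (hA x hx y hy)
  have hinj : InjOn (perp c) A := by
    intro x hx y hy hxy
    have h := hlip x hx y hy
    rw [hxy, sub_self, norm_zero, mul_zero] at h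
    exact sub_eq_zero.1 (norm_le_zero_iff.1 h)
  let g : Space d → Space d := Function.invFunOn (perp c) A
  have hg : ∀ x ∈ A, g (perp c x) = x := fun x hx => hinj.leftInvOn_invFunOn hx
  have hgl : LipschitzOnWith (Real.toNNReal (1 - r)⁻¹) g (perp c '' A) := by
    refine LipschitzOnWith.of_dist_le_mul ?_
    rintro _ ⟨x, hx, rfl⟩ _ ⟨y, hy, rfl⟩
    rw [hg x hx, hg y hy, dist_eq_norm, dist_eq_norm, Real.coe_toNNReal _ (by positivity)]
    exact hlip x hx y hy
  have himg : g '' (perp c '' A) = A := by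
    rw [image_image]
    ext x
    constructor
    · rintro ⟨y, hy, rfl⟩; change g (perp c y) ∈ A; rwa [hg y hy]
    · exact fun hx => ⟨x, hx, hg x hx⟩
  have h := surf_image_le hgl
  rw [himg] at h
  calc _ ≤ ENNReal.ofReal ((1 - r) ^ (d - 1)) *
        (((Real.toNNReal (1 - r)⁻¹ : NNReal) : ENNReal) ^ (d - 1) * surf d (perp c '' A)) := by
        gcongr
    _ = surf d (perp c '' A) := by
        rw [← mul_assoc, ← ENNReal.ofReal.eq_1, ← ENNReal.ofReal_pow (by positivity),
          ← ENNReal.ofReal_mul (by positivity), ← mul_pow, mul_inv_cancel₀ hpos.ne', one_pow,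
          ENNReal.ofReal_one, one_mul]

/-- The volume swept by an almost flat set with approximate normal `c` that is moved in the
direction `e`. -/
theorem volume_sweep_approx (hc : ‖c‖ = 1) (e : Space d) {ε : ℝ} (hε : 0 < ε) :
    ∃ r₀ > 0, ∀ A : Set (Space d), (∀ x ∈ A, ∀ y ∈ A, |⟪c, x - y⟫| ≤ r₀ * ‖x - y‖) →
      ∀ J : Set ℝ,
        volume (sweep e A J) ≤ ENNReal.ofReal (|⟪c, e⟫| + ε) * surf d A * volume J ∧
        ENNReal.ofReal (|⟪c, e⟫| - ε) * surf d A * volume J ≤ volume (sweep e A J) := by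
  have h1 : ∀ᶠ δ in 𝓝[>] (0 : NNReal), ∀ (s : Set (Space d)) (f : Space d → Space d),
      ApproximatesLinearOn f (shear c e) s δ →
        volume (f '' s) ≤ (Real.toNNReal (|⟪c, e⟫| + ε) : ENNReal) * volume s := by
    refine addHaar_image_le_mul_of_det_lt volume _ ?_
    rw [det_shear hc]
    exact (ENNReal.ofReal_lt_ofReal_iff (by positivity)).2 (by linarith)
  have h2 : ∀ᶠ δ in 𝓝[>] (0 : NNReal), ∀ (s : Set (Space d)) (f : Space d → Space d),
      ApproximatesLinearOn f (shear c e) s δ →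
        ENNReal.ofReal (|⟪c, e⟫| - ε / 2) * volume s ≤ volume (f '' s) := by
    -- The determinant estimate needs a bound strictly below |det|. If the determinant vanishes, the
    -- left-hand side is zero after `ENNReal.ofReal`.
    by_cases h0 : |⟪c, e⟫| - ε / 2 < |⟪c, e⟫| ∧ 0 < |⟪c, e⟫|
    · refine mul_le_addHaar_image_of_lt_det volume _ ?_
      rw [det_shear hc]
      exact (ENNReal.ofReal_lt_ofReal_iff h0.2).2 h0.1
    · have h0' : |⟪c, e⟫| - ε / 2 ≤ 0 := by
        by_contra hcon
        exact h0 ⟨by linarith, by linarith⟩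
      simp [ENNReal.ofReal_of_nonpos h0']
  -- One half of ε was spent on the determinant; the other half absorbs the loss (1 − r)^(d−1)
  -- between A and its projection.
  have h3 : ∀ᶠ r : ℝ in 𝓝[>] 0, r ≤ 1 / 2 ∧
      |⟪c, e⟫| - ε ≤ (|⟪c, e⟫| - ε / 2) * (1 - r) ^ (d - 1) := by
    refine (Filter.Eventually.and ?_ ?_).filter_mono nhdsWithin_le_nhds
    · exact (eventually_lt_nhds (by norm_num : (0 : ℝ) < 1 / 2)).mono fun _ h => h.le
    · have : Tendsto (fun r : ℝ => (|⟪c, e⟫| - ε / 2) * (1 - r) ^ (d - 1)) (𝓝 0)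
          (𝓝 ((|⟪c, e⟫| - ε / 2) * (1 - 0) ^ (d - 1))) := Continuous.tendsto (by fun_prop) 0
      refine (this.eventually (lt_mem_nhds (a := |⟪c, e⟫| - ε) ?_)).mono fun _ h => h.le
      simp only [sub_zero, one_pow, mul_one]; linarith
  have h4 : Tendsto (fun r : ℝ => Real.toNNReal (2 * r)) (𝓝[>] 0) (𝓝[>] 0) := by
    refine tendsto_nhdsWithin_iff.2 ⟨?_, ?_⟩
    · have : Tendsto (fun r : ℝ => Real.toNNReal (2 * r)) (𝓝 0) (𝓝 (Real.toNNReal (2 * 0))) :=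
        Continuous.tendsto (by fun_prop) 0
      simpa using this.mono_left nhdsWithin_le_nhds
    · filter_upwards [self_mem_nhdsWithin] with r hr
      exact Real.toNNReal_pos.2 (by have : (0 : ℝ) < r := hr; linarith)
  obtain ⟨r, ⟨⟨⟨H1, H2⟩, H3, H4⟩, hr⟩⟩ :=
    ((((h4.eventually h1).and (h4.eventually h2)).and h3).and self_mem_nhdsWithin).exists
  have hr0 : 0 < r := hr
  refine ⟨r, hr0, fun A hA J => ?_⟩
  obtain ⟨h, himg, happ⟩ := exists_approximatesLinearOn_shear (e := e) hc hr0.le H3 hA J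
  have H1' := H1 _ h happ
  have H2' := H2 _ h happ
  rw [himg, volume_cylinder hc] at H1' H2'
  constructor
  · refine H1'.trans ?_
    rw [← mul_assoc]
    exact mul_le_mul' (mul_le_mul' le_rfl (surf_perp_image_le hc A)) le_rfl
  · refine le_trans ?_ H2'
    rw [← mul_assoc]
    refine mul_le_mul' ?_ le_rfl
    by_cases h0 : |⟪c, e⟫| - ε / 2 ≤ 0
    · rw [ENNReal.ofReal_of_nonpos (by linarith)]; simp
    · calc _ ≤ ENNReal.ofReal ((|⟪c, e⟫| - ε / 2) * (1 - r) ^ (d - 1)) * surf d A :=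
          mul_le_mul' (ENNReal.ofReal_le_ofReal H4) le_rfl
        _ = ENNReal.ofReal (|⟪c, e⟫| - ε / 2) * (ENNReal.ofReal ((1 - r) ^ (d - 1)) * surf d A) := by
            rw [ENNReal.ofReal_mul (by linarith), mul_assoc]
        _ ≤ _ := mul_le_mul' le_rfl (surf_le_perp_image hc H3 hA)

end Surf

/-! ### The area formula for projections along a direction -/

theorem le_of_forall_ofReal_mul_le_add {a b M : ENNReal} (hM : M ≠ ⊤)
    (h : ∀ ε : ℝ, 0 < ε → a ≤ b + ENNReal.ofReal ε * M) : a ≤ b := by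
  have ht : Tendsto (fun ε : ℝ => b + ENNReal.ofReal ε * M) (𝓝[>] 0)
      (𝓝 (b + ENNReal.ofReal 0 * M)) :=
    (tendsto_const_nhds.add (ENNReal.Tendsto.mul_const
      ((ENNReal.continuous_ofReal.tendsto 0).mono_left nhdsWithin_le_nhds) (Or.inr hM)))
  rw [ENNReal.ofReal_zero, zero_mul, add_zero] at ht
  refine ge_of_tendsto ht ?_
  filter_upwards [self_mem_nhdsWithin] with ε hε using h ε hε

section Area

variable {d : ℕ} {U F : Set (Space d)}

/-- Within a hypersurface the identity may be differentiated by the tangential projection, since the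
normal component of y − x is o(‖y − x‖). In this form flatness can be fed into the partition lemma
for maps that are differentiable within a set. -/
theorem hasFDerivWithinAt_id_perp_normal (hU : IsOpen U) (hF : F ⊆ faces U) {x : Space d}
    (hx : x ∈ F) : HasFDerivWithinAt id (perp (normal U x)) F x := by
  have hn := isOutwardNormal_normal (hF hx)
  refine HasFDerivWithinAt.of_isLittleO (Asymptotics.isLittleO_iff.2 fun ε hε => ?_)
  obtain ⟨δ, hδ, H⟩ := hn.abs_inner_le hU hε
  have hball : Metric.ball x δ ∈ 𝓝[F] x := mem_nhdsWithin_of_mem_nhds (Metric.ball_mem_nhds x hδ)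
  filter_upwards [self_mem_nhdsWithin, hball] with y hy hyδ
  have h := H y (faces_subset_frontier U (hF hy)) (by rwa [← dist_eq_norm])
  have e1 : id y - id x - perp (normal U x) (y - x) = ⟪normal U x, y - x⟫ • normal U x := by
    rw [perp_apply]; simp
  rw [e1, norm_smul, hn.1, mul_one, Real.norm_eq_abs, real_inner_comm]
  exact h

/-- Two countable cuts: by the Lindelöf property the normals are grouped around countably many
centres, and each group is cut where the identity is close to a fixed tangential projection. The
tolerance ρ may depend on the centre because the threshold in `volume_sweep_approx` does. -/
theorem exists_flat_partition (hU : IsOpen U) (hFm : MeasurableSet F) (hF : F ⊆ faces U)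
    (ρ : Space d → ℝ) (hρ : ∀ c, 0 < ρ c) :
    ∃ (c : ℕ × ℕ → Space d) (P : ℕ × ℕ → Set (Space d)), (∀ k, MeasurableSet (P k)) ∧
      Pairwise (Function.onFun Disjoint P) ∧ F = ⋃ k, P k ∧
      ∀ k, (P k).Nonempty → c k ∈ normal U '' F ∧ ∀ x ∈ P k, ‖normal U x - c k‖ < ρ (c k) ∧
        ∀ y ∈ P k, |⟪c k, x - y⟫| ≤ ρ (c k) * ‖x - y‖ := by
  rcases F.eq_empty_or_nonempty with rfl | hne
  · exact ⟨fun _ => 0, fun _ => ∅, by simp, fun i j _ => by simp [Function.onFun], by simp,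
      by simp⟩
  obtain ⟨t, htF, htc, ht⟩ := TopologicalSpace.countable_cover_nhdsWithin
    (f := fun c : Space d => Metric.ball c (ρ c / 2)) (s := normal U '' F) fun c _ =>
      mem_nhdsWithin_of_mem_nhds (Metric.ball_mem_nhds c (half_pos (hρ c)))
  have htne : t.Nonempty := by
    obtain ⟨x, hx⟩ := hne
    obtain ⟨c, hc, -⟩ := mem_iUnion₂.1 (ht (mem_image_of_mem _ hx))
    exact ⟨c, hc⟩
  obtain ⟨c, rfl⟩ := htc.exists_eq_range htne
  let C : ℕ → Set (Space d) := fun j => normal U ⁻¹' Metric.ball (c j) (ρ (c j) / 2)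
  have hC : ∀ j, MeasurableSet (C j) := fun j => measurable_normal U measurableSet_ball
  let s : ℕ → Set (Space d) := fun j => F ∩ disjointed C j
  have hs : ∀ j, MeasurableSet (s j) := fun j => hFm.inter (MeasurableSet.disjointed hC j)
  choose T A hTd hTm hTs hTA hAy using fun j =>
    exists_partition_approximatesLinearOn_of_hasFDerivWithinAt id (s j) (fun x => perp (normal U x))
      (fun x hx => (hasFDerivWithinAt_id_perp_normal hU hF hx.1).mono inter_subset_left)
      (fun _ => Real.toNNReal (ρ (c j) / 2)) (fun _ => (Real.toNNReal_pos.2 (half_pos (hρ _))).ne')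
  refine ⟨fun k => c k.1, fun k => s k.1 ∩ T k.1 k.2, fun k => (hs _).inter (hTm _ _), ?_, ?_, ?_⟩
  · rintro ⟨i, i'⟩ ⟨j, j'⟩ hij
    by_cases h : i = j
    · subst h
      have h' : i' ≠ j' := fun h => hij (by rw [h])
      exact ((hTd i h').mono inter_subset_right inter_subset_right)
    · exact ((disjoint_disjointed C h).mono (fun x hx => hx.1.2) (fun x hx => hx.1.2))
  · ext x
    simp only [mem_iUnion]
    constructor
    · intro hx
      have h1 : x ∈ ⋃ j, C j := by
        obtain ⟨c', ⟨j, rfl⟩, hj⟩ := mem_iUnion₂.1 (ht (mem_image_of_mem _ hx))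
        exact mem_iUnion.2 ⟨j, hj⟩
      rw [← iUnion_disjointed] at h1
      obtain ⟨j, hj⟩ := mem_iUnion.1 h1
      obtain ⟨i, hi⟩ := mem_iUnion.1 (hTs j ⟨hx, hj⟩)
      exact ⟨(j, i), ⟨hx, hj⟩, hi⟩
    · rintro ⟨k, hk⟩; exact hk.1.1
  · rintro ⟨j, i⟩ hkne
    refine ⟨htF ⟨j, rfl⟩, fun x hx => ?_⟩
    have hball : ∀ z ∈ s j, ‖normal U z - c j‖ < ρ (c j) / 2 := fun z hz => by
      have : z ∈ C j := disjointed_subset C j hz.2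
      rwa [← dist_eq_norm]
    have hpos := hρ (c j)
    refine ⟨(hball x hx.1).trans (half_lt_self hpos), fun y hy => ?_⟩
    -- The approximating map is the tangential projection at some point z of the group, not at the
    -- centre c j. Passing from the normal at z to c j costs the second half of ρ.
    obtain ⟨z, hz, hAz⟩ := hAy j ⟨x, hx.1⟩ i
    have happ := hTA j i x hx y hy
    rw [hAz, Real.coe_toNNReal _ (half_pos hpos).le] at happ
    have e1 : id x - id y - perp (normal U z) (x - y) = ⟪normal U z, x - y⟫ • normal U z := by
      rw [perp_apply]; simp
    rw [e1, norm_smul, norm_normal (hF hz.1), mul_one, Real.norm_eq_abs] at happ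
    have e2 : ⟪c j, x - y⟫ = ⟪normal U z, x - y⟫ - ⟪normal U z - c j, x - y⟫ := by
      rw [inner_sub_left (normal U z)]; ring
    have h3 : |⟪normal U z - c j, x - y⟫| ≤ ρ (c j) / 2 * ‖x - y‖ :=
      (abs_real_inner_le_norm _ _).trans (by gcongr; exact (hball z hz).le)
    change |⟪c j, x - y⟫| ≤ ρ (c j) * ‖x - y‖
    rw [e2]
    have := abs_sub ⟪normal U z, x - y⟫ ⟪normal U z - c j, x - y⟫
    linarith

theorem sweep_iUnion {ι : Type*} (e : Space d) (P : ι → Set (Space d)) (J : Set ℝ) :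
    sweep e (⋃ k, P k) J = ⋃ k, sweep e (P k) J := by
  rw [sweep, iUnion_prod_const, image_iUnion]
  rfl

/-- A partition into almost flat pieces on which the swept volume is controlled. -/
theorem exists_sweep_partition (hU : IsOpen U) (hFm : MeasurableSet F) (hF : F ⊆ faces U)
    {e : Space d} (he : ‖e‖ = 1) {ε : ℝ} (hε : 0 < ε) :
    ∃ P : ℕ × ℕ → Set (Space d), (∀ k, MeasurableSet (P k)) ∧
      Pairwise (Function.onFun Disjoint P) ∧ F = ⋃ k, P k ∧
      ∀ k, ∀ J : Set ℝ,
        volume (sweep e (P k) J) ≤ (∫⁻ x in P k,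
          (ENNReal.ofReal |⟪normal U x, e⟫| + ENNReal.ofReal (2 * ε)) ∂(surf d)) * volume J ∧
        (∫⁻ x in P k, ENNReal.ofReal |⟪normal U x, e⟫| ∂(surf d)) * volume J
          ≤ volume (sweep e (P k) J) + ENNReal.ofReal (2 * ε) * surf d (P k) * volume J := by
  classical
  choose! r hr0 hr using fun (c : Space d) (hc : ‖c‖ = 1) => volume_sweep_approx hc e hε
  -- The value 1 is a filler, since the centres used are normals and so unit vectors. The bound by ε
  -- allows |⟪c,e⟫| to be exchanged for |⟪n(x),e⟫| on the piece.
  let ρ : Space d → ℝ := fun c => if ‖c‖ = 1 then min (r c) ε else 1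
  have hρ : ∀ c, 0 < ρ c := fun c => by
    by_cases hc : ‖c‖ = 1
    · simp only [ρ, hc, if_true]; exact lt_min (hr0 c hc) hε
    · simp [ρ, hc]
  obtain ⟨c, P, hPm, hPd, hPU, hP⟩ := exists_flat_partition hU hFm hF ρ hρ
  refine ⟨P, hPm, hPd, hPU, fun k J => ?_⟩
  rcases (P k).eq_empty_or_nonempty with h0 | hne
  · simp [h0, sweep]
  obtain ⟨⟨z, hz, hzc⟩, hPk⟩ := hP k hne
  have hc : ‖c k‖ = 1 := by rw [← hzc]; exact norm_normal (hF hz)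
  have hρr : ρ (c k) ≤ r (c k) := by simp only [ρ, hc, if_true]; exact min_le_left _ _
  have hρε : ρ (c k) ≤ ε := by simp only [ρ, hc, if_true]; exact min_le_right _ _
  obtain ⟨h1, h2⟩ := hr (c k) hc (P k) (fun x hx y hy => ((hPk x hx).2 y hy).trans (by gcongr)) J
  have hclose : ∀ x ∈ P k, |⟪c k, e⟫| ≤ |⟪normal U x, e⟫| + ε ∧
      |⟪normal U x, e⟫| ≤ |⟪c k, e⟫| + ε := fun x hx => by
    have h3 : |⟪normal U x, e⟫ - ⟪c k, e⟫| ≤ ε := by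
      rw [← inner_sub_left]
      refine (abs_real_inner_le_norm _ _).trans ?_
      rw [he, mul_one]
      exact (hPk x hx).1.le.trans hρε
    have h4 := abs_sub_abs_le_abs_sub ⟪normal U x, e⟫ ⟪c k, e⟫
    have h5 := abs_sub_abs_le_abs_sub ⟪c k, e⟫ ⟪normal U x, e⟫
    rw [abs_sub_comm] at h5
    constructor <;> linarith
  constructor
  · refine h1.trans (mul_le_mul' ?_ le_rfl)
    rw [← setLIntegral_const]
    refine setLIntegral_mono' (hPm k) fun x hx => ?_
    rw [← ENNReal.ofReal_add (abs_nonneg _) (by positivity)]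
    exact ENNReal.ofReal_le_ofReal (by linarith [(hclose x hx).1])
  · calc _ ≤ (∫⁻ x in P k, (ENNReal.ofReal (|⟪c k, e⟫| - ε) + ENNReal.ofReal (2 * ε)) ∂(surf d))
          * volume J := by
          refine mul_le_mul' (setLIntegral_mono' (hPm k) fun x hx => ?_) le_rfl
          refine le_trans (ENNReal.ofReal_le_ofReal ?_) ENNReal.ofReal_add_le
          linarith [(hclose x hx).2]
      _ = ENNReal.ofReal (|⟪c k, e⟫| - ε) * surf d (P k) * volume J
          + ENNReal.ofReal (2 * ε) * surf d (P k) * volume J := by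
          rw [setLIntegral_const, add_mul, add_mul]
      _ ≤ _ := add_le_add h2 le_rfl

theorem measurable_ofReal_abs_inner_normal (U : Set (Space d)) (e : Space d) :
    Measurable fun x => ENNReal.ofReal |⟪normal U x, e⟫| :=
  (((measurable_normal U).inner_const).abs).ennreal_ofReal

/-- Countable subadditivity suffices for this direction, so no injectivity is asked for; the bound
can thus be applied to tangential parts of the boundary. The error ε·surf(F)·|J| tends to zero
because both measures are finite. -/
theorem volume_sweep_le (hU : IsOpen U) (hFm : MeasurableSet F) (hF : F ⊆ faces U)
    (hFs : surf d F < ⊤) {e : Space d} (he : ‖e‖ = 1) {J : Set ℝ} (hJ : volume J < ⊤) :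
    volume (sweep e F J) ≤ (∫⁻ x in F, ENNReal.ofReal |⟪normal U x, e⟫| ∂(surf d)) * volume J := by
  refine le_of_forall_ofReal_mul_le_add (M := surf d F * volume J)
    (ENNReal.mul_lt_top hFs hJ).ne fun ε hε => ?_
  obtain ⟨P, hPm, hPd, hPU, hP⟩ := exists_sweep_partition hU hFm hF he (half_pos hε)
  calc volume (sweep e F J) ≤ ∑' k, volume (sweep e (P k) J) := by
        rw [hPU, sweep_iUnion]; exact measure_iUnion_le _
    _ ≤ ∑' k, (∫⁻ x in P k,
          (ENNReal.ofReal |⟪normal U x, e⟫| + ENNReal.ofReal (2 * (ε / 2))) ∂(surf d)) * volume J :=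
        ENNReal.tsum_le_tsum fun k => (hP k J).1
    _ = (∫⁻ x in F, (ENNReal.ofReal |⟪normal U x, e⟫| + ENNReal.ofReal (2 * (ε / 2))) ∂(surf d))
          * volume J := by
        rw [ENNReal.tsum_mul_right, ← lintegral_iUnion hPm hPd, ← hPU]
    _ = _ := by
        rw [lintegral_add_right _ measurable_const, setLIntegral_const, add_mul, mul_assoc,
          mul_div_cancel₀ _ two_ne_zero]

theorem measurable_sweep_map (e : Space d) : Measurable fun z : Space d × ℝ => z.1 + z.2 • e := by
  fun_prop

/-- The lower bound needs the swept pieces to be disjoint and measurable. Injectivity gives the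
first directly and the second through Lusin–Souslin. -/
theorem le_volume_sweep (hU : IsOpen U) (hFm : MeasurableSet F) (hF : F ⊆ faces U)
    (hFs : surf d F < ⊤) {e : Space d} (he : ‖e‖ = 1)
    (hinj : InjOn (fun z : Space d × ℝ => z.1 + z.2 • e) (F ×ˢ univ))
    {J : Set ℝ} (hJm : MeasurableSet J) (hJ : volume J < ⊤) :
    (∫⁻ x in F, ENNReal.ofReal |⟪normal U x, e⟫| ∂(surf d)) * volume J ≤ volume (sweep e F J) := by
  refine le_of_forall_ofReal_mul_le_add (M := surf d F * volume J)
    (ENNReal.mul_lt_top hFs hJ).ne fun ε hε => ?_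
  obtain ⟨P, hPm, hPd, hPU, hP⟩ := exists_sweep_partition hU hFm hF he (half_pos hε)
  have hsub : ∀ k, P k ×ˢ J ⊆ F ×ˢ univ := fun k =>
    prod_mono (by rw [hPU]; exact subset_iUnion P k) (subset_univ J)
  calc (∫⁻ x in F, ENNReal.ofReal |⟪normal U x, e⟫| ∂(surf d)) * volume J
      = ∑' k, (∫⁻ x in P k, ENNReal.ofReal |⟪normal U x, e⟫| ∂(surf d)) * volume J := by
        rw [ENNReal.tsum_mul_right, ← lintegral_iUnion hPm hPd, ← hPU]
    _ ≤ ∑' k, (volume (sweep e (P k) J)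
          + ENNReal.ofReal (2 * (ε / 2)) * surf d (P k) * volume J) :=
        ENNReal.tsum_le_tsum fun k => (hP k J).2
    _ = volume (sweep e F J) + ENNReal.ofReal (2 * (ε / 2)) * surf d F * volume J := by
        rw [ENNReal.tsum_add, ENNReal.tsum_mul_right, ENNReal.tsum_mul_left,
          ← measure_iUnion hPd hPm, ← hPU, ← measure_iUnion, ← sweep_iUnion, ← hPU]
        · intro i j hij
          refine Set.disjoint_left.2 ?_
          rintro _ ⟨z, hz, rfl⟩ ⟨w, hw, hwz⟩
          have := hinj (hsub j hw) (hsub i hz) hwz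
          subst this
          exact Set.disjoint_left.1 (hPd hij) hz.1 hw.1
        · intro k
          exact ((hPm k).prod hJm).image_of_measurable_injOn (measurable_sweep_map e)
            (hinj.mono (hsub k))
    _ = _ := by rw [mul_div_cancel₀ _ two_ne_zero, mul_assoc]

end Area

/-! ### Integration over the hits of lines with a hypersurface -/

section Hits

variable {d : ℕ} {U F : Set (Space d)} {μ : Space d}

/-- The lines in direction μ through Z fill the cylinder over the projection of Z, which is null. -/
theorem ae_forall_notMem_of_surf_eq_zero (hμ : ‖μ‖ = 1) {Z : Set (Space d)} (hZ : surf d Z = 0) :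
    ∀ᵐ y : Space d, ∀ t : ℝ, y + t • μ ∉ Z := by
  have h0 : volume {y | perp μ y ∈ perp μ '' Z ∧ ⟪μ, y⟫ ∈ (univ : Set ℝ)} = 0 := by
    rw [volume_cylinder hμ, nonpos_iff_eq_zero.1 ((surf_perp_image_le hμ Z).trans hZ.le), zero_mul]
  refine measure_mono_null (fun y hy => ?_) h0
  simp only [mem_compl_iff, mem_ofPred_eq, not_forall, not_not] at hy
  obtain ⟨t, ht⟩ := hy
  refine ⟨⟨_, ht, ?_⟩, mem_univ _⟩
  rw [map_add, map_smul, perp_self hμ, smul_zero, add_zero]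

/-- A statement of Sard type: the tangential points have density |n·μ| = 0 in `volume_sweep_le`, so
the lines through them fill a null set, here exhausted by t ∈ [−m, m]. -/
theorem ae_forall_inner_normal_ne_zero (hU : IsOpen U) (hFm : MeasurableSet F) (hF : F ⊆ faces U)
    (hFs : surf d F < ⊤) (hμ : ‖μ‖ = 1) :
    ∀ᵐ y : Space d, ∀ t : ℝ, y + t • μ ∈ F → ⟪normal U (y + t • μ), μ⟫ ≠ 0 := by
  let Z : Set (Space d) := F ∩ {x | ⟪normal U x, μ⟫ = 0}
  have hZm : MeasurableSet Z :=
    hFm.inter (measurableSet_eq_fun ((measurable_normal U).inner_const) measurable_const)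
  have h0 : ∀ m : ℕ, volume (sweep (-μ) Z (Icc (-m : ℝ) m)) = 0 := by
    intro m
    have h := volume_sweep_le hU hZm (inter_subset_left.trans hF)
      ((measure_mono inter_subset_left).trans_lt hFs) (e := -μ) (by rwa [norm_neg])
      (J := Icc (-m : ℝ) m) (by rw [Real.volume_Icc]; exact ENNReal.ofReal_lt_top)
    have h1 : (∫⁻ x in Z, ENNReal.ofReal |⟪normal U x, -μ⟫| ∂(surf d)) = 0 := by
      rw [setLIntegral_congr_fun (g := fun _ => 0) hZm, lintegral_zero]
      intro x hx
      have : ⟪normal U x, μ⟫ = 0 := hx.2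
      simp [inner_neg_right, this]
    rw [h1, zero_mul] at h
    exact nonpos_iff_eq_zero.1 h
  have hnull := measure_iUnion_null h0
  refine measure_mono_null (fun y hy => ?_) hnull
  simp only [mem_compl_iff, mem_ofPred_eq, not_forall, not_not] at hy
  obtain ⟨t, ht, ht0⟩ := hy
  obtain ⟨m, hm⟩ := exists_nat_ge |t|
  refine mem_iUnion.2 ⟨m, ⟨(y + t • μ, t), ⟨⟨ht, ht0⟩, abs_le.1 hm⟩, ?_⟩⟩
  simp

/-- The sum of `φ` over the hits of the line `t ↦ y + t μ` with `F`. -/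
def hitSum (μ : Space d) (F : Set (Space d)) (ψ : Space d → ENNReal) (χ : ℝ → ENNReal)
    (y : Space d) : ENNReal :=
  ∫⁻ t in {t : ℝ | y + t • μ ∈ F}, ψ (y + t • μ) * χ t ∂Measure.count

/-- Injectivity says that each line meets F at most once, so (x, s) ↦ x − sμ is a measurable
embedding and `hitSum` pulled back along it is the product ψ(x) χ(s). The two sweep bounds identify
the pulled-back Lebesgue measure with |n·μ| surf ⊗ ds. -/
theorem lintegral_hitSum_of_injOn (hU : IsOpen U) (hFm : MeasurableSet F) (hF : F ⊆ faces U)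
    (hFs : surf d F < ⊤) (hμ : ‖μ‖ = 1)
    (hinj : InjOn (fun z : Space d × ℝ => z.1 + z.2 • -μ) (F ×ˢ univ))
    {ψ : Space d → ENNReal} (hψ : Measurable ψ) {χ : ℝ → ENNReal} (hχ : Measurable χ)
    (hχ0 : ∀ t ∉ Icc (0 : ℝ) 1, χ t = 0) :
    Measurable (hitSum μ F ψ χ) ∧
    ∫⁻ y, hitSum μ F ψ χ y
      = (∫⁻ x in F, ψ x * ENNReal.ofReal |⟪normal U x, μ⟫| ∂(surf d)) * ∫⁻ t, χ t := by
  have := hFm.standardBorel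
  let Φ : F × ℝ → Space d := fun z => z.1 + z.2 • -μ
  have hΦm : Measurable Φ := by fun_prop
  have hΦi : Function.Injective Φ := by
    rintro ⟨x, s⟩ ⟨y, t⟩ h
    have := hinj (x₁ := ((x : Space d), s)) (x₂ := ((y : Space d), t)) ⟨x.2, mem_univ _⟩
      ⟨y.2, mem_univ _⟩ h
    simp only [Prod.mk.injEq] at this
    exact Prod.ext (Subtype.ext this.1) this.2
  have hΦ : MeasurableEmbedding Φ := hΦm.measurableEmbedding hΦi
  let w : Space d → ENNReal := fun x => ENNReal.ofReal |⟪normal U x, μ⟫|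
  have hwm : Measurable w := measurable_ofReal_abs_inner_normal U μ
  have hw1 : ∀ x, w x ≤ 1 := fun x => by
    refine ENNReal.ofReal_le_one.2 ((abs_real_inner_le_norm _ _).trans ?_)
    rw [hμ, mul_one]; exact norm_normal_le U x
  let m : Measure F := Measure.comap Subtype.val ((surf d).withDensity w)
  have hmapply : ∀ s : Set F, MeasurableSet s → m s = ∫⁻ x in Subtype.val '' s, w x ∂(surf d) := by
    intro s hs
    rw [comap_subtype_coe_apply hFm,
      withDensity_apply _ ((MeasurableEmbedding.subtype_coe hFm).measurableSet_image.2 hs)]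
  have hmfin : IsFiniteMeasure m := ⟨by
    rw [hmapply _ MeasurableSet.univ, image_univ, Subtype.range_coe]
    calc _ ≤ ∫⁻ x in F, 1 ∂(surf d) := lintegral_mono fun x => hw1 x
      _ = surf d F := by simp
      _ < ⊤ := hFs⟩
  let ν : Measure (F × ℝ) := Measure.comap Φ volume
  -- A product measure is determined by its values on rectangles, and these are swept volumes. The
  -- restriction to [0, 1], harmless since χ vanishes elsewhere, keeps the volumes finite.
  have hprod : m.prod (volume.restrict (Icc (0 : ℝ) 1)) = ν.restrict (univ ×ˢ Icc (0 : ℝ) 1) := by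
    refine Measure.prod_eq fun s t hs ht => ?_
    have hsm : MeasurableSet (Subtype.val '' s : Set (Space d)) :=
      (MeasurableEmbedding.subtype_coe hFm).measurableSet_image.2 hs
    have hsF : Subtype.val '' s ⊆ F := by rintro _ ⟨x, -, rfl⟩; exact x.2
    have hsi : InjOn (fun z : Space d × ℝ => z.1 + z.2 • -μ) ((Subtype.val '' s) ×ˢ univ) :=
      hinj.mono (prod_mono hsF Subset.rfl)
    have hJm : MeasurableSet (t ∩ Icc (0 : ℝ) 1) := ht.inter measurableSet_Icc
    have hJ : volume (t ∩ Icc (0 : ℝ) 1) < ⊤ :=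
      (measure_mono inter_subset_right).trans_lt (by simp)
    have hsFs : surf d (Subtype.val '' s) < ⊤ := (measure_mono hsF).trans_lt hFs
    have he : ‖-μ‖ = 1 := by rwa [norm_neg]
    rw [Measure.restrict_apply (hs.prod ht), prod_inter_prod, inter_univ, hΦ.comap_apply,
      Measure.restrict_apply ht, hmapply s hs]
    have himg : Φ '' (s ×ˢ (t ∩ Icc (0 : ℝ) 1))
        = sweep (-μ) (Subtype.val '' s) (t ∩ Icc (0 : ℝ) 1) := by
      ext y
      constructor
      · rintro ⟨⟨x, t⟩, ⟨hx, ht⟩, rfl⟩; exact ⟨(x, t), ⟨⟨x, hx, rfl⟩, ht⟩, rfl⟩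
      · rintro ⟨⟨_, t⟩, ⟨⟨x, hx, rfl⟩, ht⟩, rfl⟩; exact ⟨(x, t), ⟨hx, ht⟩, rfl⟩
    have hwe : (∫⁻ x in Subtype.val '' s, ENNReal.ofReal |⟪normal U x, -μ⟫| ∂(surf d))
        = ∫⁻ x in Subtype.val '' s, w x ∂(surf d) := by simp only [inner_neg_right, abs_neg, w]
    rw [himg, ← hwe]
    exact (volume_sweep_le hU hsm (hsF.trans hF) hsFs he hJ).antisymm
      (le_volume_sweep hU hsm (hsF.trans hF) hsFs he hsi hJm hJ)
  have hgΦ : ∀ z : F × ℝ, hitSum μ F ψ χ (Φ z) = ψ z.1 * χ z.2 := by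
    rintro ⟨x, s⟩
    have hset : {t : ℝ | Φ (x, s) + t • μ ∈ F} = {s} := by
      ext t
      simp only [Φ, mem_ofPred_eq, mem_singleton_iff]
      constructor
      · intro h
        have := hinj (x₁ := (Φ (x, s) + t • μ, t)) (x₂ := ((x : Space d), s)) ⟨h, mem_univ _⟩ ⟨x.2, mem_univ _⟩
          (by simp [Φ])
        exact (Prod.ext_iff.1 this).2
      · rintro rfl; simp
    rw [hitSum, hset, lintegral_singleton, Measure.count_singleton, mul_one]
    simp [Φ]
  have hg0 : ∀ y, y ∉ range Φ → hitSum μ F ψ χ y = 0 := by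
    intro y hy
    have hset : {t : ℝ | y + t • μ ∈ F} = ∅ := by
      ext t
      simp only [mem_ofPred_eq, mem_empty_iff_false, iff_false]
      exact fun h => hy ⟨(⟨_, h⟩, t), by simp [Φ]⟩
    rw [hitSum, hset]; simp
  constructor
  · have : hitSum μ F ψ χ = Function.extend Φ (fun z => ψ z.1 * χ z.2) (fun _ => 0) := by
      ext y
      by_cases hy : y ∈ range Φ
      · obtain ⟨z, rfl⟩ := hy
        rw [hgΦ, hΦi.extend_apply]
      · rw [hg0 y hy, Function.extend_apply' _ _ _ hy]
    rw [this]
    exact hΦ.measurable_extend (by fun_prop) measurable_const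
  · calc ∫⁻ y, hitSum μ F ψ χ y = ∫⁻ y in range Φ, hitSum μ F ψ χ y :=
          (setLIntegral_eq_of_support_subset fun y hy => by
            by_contra hcon; exact hy (hg0 y hcon)).symm
      _ = ∫⁻ z, ψ z.1 * χ z.2 ∂ν := by
          rw [← hΦ.map_comap, hΦ.lintegral_map]
          exact lintegral_congr hgΦ
      _ = ∫⁻ z in univ ×ˢ Icc (0 : ℝ) 1, ψ z.1 * χ z.2 ∂ν := by
          refine (setLIntegral_eq_of_support_subset fun z hz => ?_).symm
          refine ⟨mem_univ _, ?_⟩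
          by_contra hcon
          exact hz (by simp [hχ0 _ hcon])
      _ = (∫⁻ x, ψ x ∂m) * ∫⁻ t in Icc (0 : ℝ) 1, χ t := by
          rw [← hprod, lintegral_prod_mul (f := fun x : F => ψ x) (by fun_prop) hχ.aemeasurable]
      _ = _ := by
          congr 1
          · rw [lintegral_subtype_comap hFm, restrict_withDensity hFm,
              lintegral_withDensity_eq_lintegral_mul _ hwm hψ]
            exact lintegral_congr fun x => mul_comm _ _
          · refine setLIntegral_eq_of_support_subset fun t ht => ?_
            by_contra hcon
            exact ht (hχ0 t hcon)

/-- The area formula along lines: integrals over a piece of the boundary against the weight `|μ·n|`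
are integrals over lines in the direction `μ`. -/
theorem lintegral_hitSum (hU : IsOpen U) (hFm : MeasurableSet F) (hF : F ⊆ faces U)
    (hFs : surf d F < ⊤) (hμ : ‖μ‖ = 1)
    {ψ : Space d → ENNReal} (hψ : Measurable ψ) {χ : ℝ → ENNReal} (hχ : Measurable χ)
    (hχ0 : ∀ t ∉ Icc (0 : ℝ) 1, χ t = 0) :
    AEMeasurable (hitSum μ F ψ χ) ∧
    ∫⁻ y, hitSum μ F ψ χ y
      = (∫⁻ x in F, ψ x * ENNReal.ofReal |⟪normal U x, μ⟫| ∂(surf d)) * ∫⁻ t, χ t := by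
  classical
  -- Tangential points can be discarded: almost no line meets them, and in the surface integral
  -- their weight is zero.
  let F' : Set (Space d) := F ∩ {x | ⟪normal U x, μ⟫ ≠ 0}
  have hNm : MeasurableSet {x | ⟪normal U x, μ⟫ ≠ 0} :=
    (measurableSet_eq_fun ((measurable_normal U).inner_const) measurable_const).compl
  have hF'm : MeasurableSet F' := hFm.inter hNm
  have hF'F : F' ⊆ F := inter_subset_left
  -- With this tolerance two points of a piece on the same line, at parameter distance τ, would
  -- satisfy τ|⟪c,μ⟫| ≤ τ|⟪c,μ⟫|/2. Hence each piece is met at most once and the injective case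
  -- applies.
  let ρ : Space d → ℝ := fun c => if ⟪c, μ⟫ = 0 then 1 else |⟪c, μ⟫| / 2
  have hρ : ∀ c, 0 < ρ c := fun c => by
    by_cases hc : ⟪c, μ⟫ = 0
    · simp [ρ, hc]
    · simp only [ρ, hc, if_false]; positivity
  obtain ⟨c, P, hPm, hPd, hPU, hP⟩ := exists_flat_partition hU hF'm (hF'F.trans hF) ρ hρ
  have hPF' : ∀ k, P k ⊆ F' := fun k => by rw [hPU]; exact subset_iUnion P k
  have hPi : ∀ k, InjOn (fun z : Space d × ℝ => z.1 + z.2 • -μ) (P k ×ˢ univ) := by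
    rintro k ⟨x, s⟩ ⟨hx, -⟩ ⟨y, t⟩ ⟨hy, -⟩ h
    obtain ⟨⟨z, hz, hzc⟩, hPk⟩ := hP k ⟨x, hx⟩
    have hc0 : ⟪c k, μ⟫ ≠ 0 := by rw [← hzc]; exact hz.2
    have h1 := (hPk x hx).2 y hy
    have h2 : x - y = (s - t) • μ := by
      simp only [smul_neg] at h
      have : x - y = (x + -(s • μ)) - (y + -(t • μ)) + (s - t) • μ := by module
      rw [this, h, sub_self, zero_add]
    rw [h2, real_inner_smul_right, abs_mul, norm_smul, hμ, mul_one, Real.norm_eq_abs] at h1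
    simp only [ρ, hc0, if_false] at h1
    have h3 : |s - t| = 0 := by
      have := abs_pos.2 hc0
      nlinarith [abs_nonneg (s - t)]
    have h4 : s - t = 0 := abs_eq_zero.1 h3
    rw [h4, zero_smul] at h2
    exact Prod.ext (sub_eq_zero.1 h2) (sub_eq_zero.1 h4)
  have hPk := fun k => lintegral_hitSum_of_injOn hU (hPm k) ((hPF' k).trans (hF'F.trans hF))
    ((measure_mono ((hPF' k).trans hF'F)).trans_lt hFs) hμ (hPi k) hψ hχ hχ0
  have hae : hitSum μ F ψ χ =ᵐ[volume] fun y => ∑' k, hitSum μ (P k) ψ χ y := by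
    filter_upwards [ae_forall_inner_normal_ne_zero hU hFm hF hFs hμ] with y hy
    have hset : {t : ℝ | y + t • μ ∈ F} = ⋃ k, {t : ℝ | y + t • μ ∈ P k} := by
      ext t
      simp only [mem_ofPred_eq, mem_iUnion]
      rw [← mem_iUnion, ← hPU]
      exact ⟨fun h => ⟨h, hy t h⟩, fun h => h.1⟩
    rw [hitSum, hset, lintegral_iUnion]
    · rfl
    · intro k
      exact (by fun_prop : Measurable fun t : ℝ => y + t • μ) (hPm k)
    · intro i j hij
      exact Set.disjoint_left.2 fun t hi hj => Set.disjoint_left.1 (hPd hij) hi hj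
  refine ⟨⟨_, Measurable.tsum fun k => (hPk k).1, hae⟩, ?_⟩
  rw [lintegral_congr_ae hae, lintegral_tsum fun k => (hPk k).1.aemeasurable]
  simp only [(hPk _).2]
  rw [ENNReal.tsum_mul_right, ← lintegral_iUnion hPm hPd, ← hPU]
  congr 1
  rw [← lintegral_indicator hF'm, ← lintegral_indicator hFm]
  refine lintegral_congr fun x => ?_
  by_cases hx : x ∈ F
  · by_cases hx0 : ⟪normal U x, μ⟫ = 0
    · rw [indicator_of_notMem (fun h => h.2 hx0), indicator_of_mem hx]
      simp [hx0]
    · rw [indicator_of_mem (show x ∈ F' from ⟨hx, hx0⟩), indicator_of_mem hx]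
  · rw [indicator_of_notMem (fun h => hx h.1), indicator_of_notMem hx]

end Hits

/-! ### The divergence theorem for a constant vector field -/

section Line

open Classical in
-- The indicator of V, corrected by a unit step at every entrance and every exit, is locally
-- constant and so constant. Integrated against h', each step contributes a boundary value of h, and
-- the constant contributes nothing because h has compact support. The components of V need not be
-- described.
theorem integral_deriv_eq_sum_hits {V : Set ℝ} (hV : IsOpen V) (S E : Finset ℝ)
    (hfr : ∀ t ∈ frontier V, t ∈ S ∨ t ∈ E)
    (hS : ∀ s ∈ S, s ∉ V ∧ (∀ᶠ t in 𝓝[>] s, t ∈ V) ∧ ∀ᶠ t in 𝓝[<] s, t ∉ V)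
    (hE : ∀ s ∈ E, s ∉ V ∧ (∀ᶠ t in 𝓝[>] s, t ∉ V) ∧ ∀ᶠ t in 𝓝[<] s, t ∈ V)
    {h : ℝ → ℝ} (hh : ContDiff ℝ 1 h) (hc : HasCompactSupport h) :
    ∫ t in V, deriv h t = ∑ s ∈ E, h s - ∑ s ∈ S, h s := by
  let v : ℝ → ℝ := fun t => if t ∈ V then 1 else 0
  -- Hit points do not belong to V, so the indicator jumps just after an entrance but already at an
  -- exit; this fixes the strict and the non-strict inequality.
  let k : ℝ → ℝ := fun t => v t - ∑ s ∈ S, (if s < t then (1 : ℝ) else 0)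
    + ∑ s ∈ E, (if s ≤ t then (1 : ℝ) else 0)
  have hvr : ∀ t₀, ∀ᶠ t in 𝓝[>] t₀, v t = v t₀ + if t₀ ∈ S then 1 else 0 := by
    intro t₀
    by_cases h1 : t₀ ∈ S
    · filter_upwards [(hS t₀ h1).2.1] with t ht
      simp [v, h1, ht, (hS t₀ h1).1]
    · by_cases h2 : t₀ ∈ E
      · filter_upwards [(hE t₀ h2).2.1] with t ht
        simp [v, h1, ht, (hE t₀ h2).1]
      · by_cases h3 : t₀ ∈ V
        · filter_upwards [mem_nhdsWithin_of_mem_nhds (hV.mem_nhds h3)] with t ht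
          simp [v, h1, ht, h3]
        · have h4 : t₀ ∉ closure V := fun hcl => by
            have : t₀ ∈ frontier V := by rw [hV.frontier_eq]; exact ⟨hcl, h3⟩
            exact (hfr t₀ this).elim h1 h2
          filter_upwards [mem_nhdsWithin_of_mem_nhds (isClosed_closure.isOpen_compl.mem_nhds h4)]
            with t ht
          have : t ∉ V := fun h => ht (subset_closure h)
          simp [v, h1, h3, this]
  have hvl : ∀ t₀, ∀ᶠ t in 𝓝[<] t₀, v t = v t₀ + if t₀ ∈ E then 1 else 0 := by
    intro t₀
    by_cases h1 : t₀ ∈ E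
    · filter_upwards [(hE t₀ h1).2.2] with t ht
      simp [v, h1, ht, (hE t₀ h1).1]
    · by_cases h2 : t₀ ∈ S
      · filter_upwards [(hS t₀ h2).2.2] with t ht
        simp [v, h1, ht, (hS t₀ h2).1]
      · by_cases h3 : t₀ ∈ V
        · filter_upwards [mem_nhdsWithin_of_mem_nhds (hV.mem_nhds h3)] with t ht
          simp [v, h1, ht, h3]
        · have h4 : t₀ ∉ closure V := fun hcl => by
            have : t₀ ∈ frontier V := by rw [hV.frontier_eq]; exact ⟨hcl, h3⟩
            exact (hfr t₀ this).elim h2 h1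
          filter_upwards [mem_nhdsWithin_of_mem_nhds (isClosed_closure.isOpen_compl.mem_nhds h4)]
            with t ht
          have : t ∉ V := fun h => ht (subset_closure h)
          simp [v, h1, h3, this]
  have hsr : ∀ (A : Finset ℝ) t₀, ∀ᶠ t in 𝓝[>] t₀, ∀ s ∈ A,
      ((if s < t then (1 : ℝ) else 0) = (if s < t₀ then 1 else 0) + if t₀ = s then 1 else 0) ∧
      ((if s ≤ t then (1 : ℝ) else 0) = (if s ≤ t₀ then 1 else 0)) := by
    intro A t₀
    refine (Finset.eventually_all A).2 fun s _ => ?_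
    rcases lt_trichotomy s t₀ with hs | hs | hs
    · filter_upwards [self_mem_nhdsWithin] with t (ht : t₀ < t)
      simp [hs, hs.le, hs.ne', hs.trans ht, (hs.trans ht).le]
    · subst hs
      filter_upwards [self_mem_nhdsWithin] with t (ht : s < t)
      simp [ht, ht.le]
    · filter_upwards [mem_nhdsWithin_of_mem_nhds (Iio_mem_nhds hs)] with t (ht : t < s)
      simp [hs.not_ge, hs.not_gt, hs.ne, ht.not_ge, ht.not_gt]
  have hsl : ∀ (A : Finset ℝ) t₀, ∀ᶠ t in 𝓝[<] t₀, ∀ s ∈ A,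
      ((if s < t then (1 : ℝ) else 0) = (if s < t₀ then 1 else 0)) ∧
      ((if s ≤ t then (1 : ℝ) else 0) = (if s ≤ t₀ then 1 else 0) - if t₀ = s then 1 else 0) := by
    intro A t₀
    refine (Finset.eventually_all A).2 fun s _ => ?_
    rcases lt_trichotomy s t₀ with hs | hs | hs
    · filter_upwards [mem_nhdsWithin_of_mem_nhds (Ioi_mem_nhds hs)] with t (ht : s < t)
      simp [hs, hs.le, hs.ne', ht, ht.le]
    · subst hs
      filter_upwards [self_mem_nhdsWithin] with t (ht : t < s)
      simp [ht.not_ge, ht.le]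
    · filter_upwards [self_mem_nhdsWithin] with t (ht : t < t₀)
      have := ht.trans hs
      simp [hs.not_ge, hs.not_gt, hs.ne, this.not_ge, this.not_gt]
  have hk : IsLocallyConstant k := by
    rw [IsLocallyConstant.iff_eventually_eq]
    intro t₀
    have hright : ∀ᶠ t in 𝓝[>] t₀, k t = k t₀ := by
      filter_upwards [hvr t₀, hsr S t₀, hsr E t₀] with t h1 h2 h3
      simp only [k]
      rw [h1, Finset.sum_congr rfl fun s hs => (h2 s hs).1,
        Finset.sum_congr rfl fun s hs => (h3 s hs).2, Finset.sum_add_distrib, Finset.sum_ite_eq]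
      ring
    have hleft : ∀ᶠ t in 𝓝[<] t₀, k t = k t₀ := by
      filter_upwards [hvl t₀, hsl S t₀, hsl E t₀] with t h1 h2 h3
      simp only [k]
      rw [h1, Finset.sum_congr rfl fun s hs => (h2 s hs).1,
        Finset.sum_congr rfl fun s hs => (h3 s hs).2, Finset.sum_sub_distrib, Finset.sum_ite_eq]
      ring
    rw [← nhdsNE_sup_pure, ← nhdsLT_sup_nhdsGT]
    simp only [eventually_sup]
    exact ⟨⟨hleft, hright⟩, by simp⟩
  have hconst : ∀ t, k t = k 0 := fun t => hk.apply_eq_of_preconnectedSpace t 0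
  have hint : Integrable (deriv h) :=
    (hh.continuous_deriv le_rfl).integrable_of_hasCompactSupport hc.deriv
  have hIoi : ∀ s, ∫ t in Ioi s, deriv h t = -h s := fun s => hc.integral_Ioi_deriv_eq hh s
  have hall : ∫ t, deriv h t = 0 := by
    have h1 := hc.integral_Ioi_deriv_eq hh 0
    have h2 := hc.integral_Iic_deriv_eq hh 0
    rw [← integral_add_compl (measurableSet_Iic (a := (0 : ℝ))) hint, compl_Iic, h1, h2]
    ring
  calc ∫ t in V, deriv h t = ∫ t, v t * deriv h t := by
        rw [← integral_indicator hV.measurableSet]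
        refine integral_congr_ae (Eventually.of_forall fun t => ?_)
        by_cases ht : t ∈ V <;> simp [v, ht]
    _ = ∫ t, (k 0 * deriv h t + ∑ s ∈ S, (Ioi s).indicator (deriv h) t
          - ∑ s ∈ E, (Ici s).indicator (deriv h) t) := by
        refine integral_congr_ae (Eventually.of_forall fun t => ?_)
        have h1 : ∑ s ∈ S, (Ioi s).indicator (deriv h) t
            = (∑ s ∈ S, (if s < t then (1 : ℝ) else 0)) * deriv h t := by
          rw [Finset.sum_mul]
          refine Finset.sum_congr rfl fun s _ => ?_
          by_cases hs : s < t <;> simp [hs]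
        have h2 : ∑ s ∈ E, (Ici s).indicator (deriv h) t
            = (∑ s ∈ E, (if s ≤ t then (1 : ℝ) else 0)) * deriv h t := by
          rw [Finset.sum_mul]
          refine Finset.sum_congr rfl fun s _ => ?_
          by_cases hs : s ≤ t <;> simp [hs]
        have h3 := hconst t
        simp only [k] at h3
        change v t * deriv h t = k 0 * deriv h t + _ - _
        rw [h1, h2]
        simp only [k]
        rw [← h3]
        ring
    _ = k 0 * (∫ t, deriv h t) + (∑ s ∈ S, ∫ t in Ioi s, deriv h t)
          - ∑ s ∈ E, ∫ t in Ici s, deriv h t := by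
        have i1 : ∀ s, Integrable ((Ioi s).indicator (deriv h)) := fun s =>
          hint.indicator measurableSet_Ioi
        have i2 : ∀ s, Integrable ((Ici s).indicator (deriv h)) := fun s =>
          hint.indicator measurableSet_Ici
        rw [integral_sub, integral_add, integral_const_mul, integral_finsetSum, integral_finsetSum]
        · simp only [integral_indicator measurableSet_Ioi, integral_indicator measurableSet_Ici]
        · exact fun s _ => i2 s
        · exact fun s _ => i1 s
        · exact hint.const_mul _
        · exact integrable_finsetSum _ fun s _ => i1 s
        · exact (hint.const_mul _).add (integrable_finsetSum _ fun s _ => i1 s)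
        · exact integrable_finsetSum _ fun s _ => i2 s
    _ = _ := by
        simp only [integral_Ici_eq_integral_Ioi, hIoi, hall, Finset.sum_neg_distrib]
        ring

theorem exists_cutoff : ∃ χ : ℝ → ℝ, ContDiff ℝ 1 χ ∧ (∀ t, 0 ≤ χ t) ∧ HasCompactSupport χ ∧
    (∀ t ∉ Icc (0 : ℝ) 1, χ t = 0) ∧ ∫ t, χ t = 1 := by
  let f : ContDiffBump (1 / 2 : ℝ) := ⟨1 / 4, 1 / 2, by norm_num, by norm_num⟩
  refine ⟨f.normed volume, f.contDiff_normed, f.nonneg_normed, f.hasCompactSupport_normed, ?_,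
    f.integral_normed⟩
  intro t ht
  by_contra hne
  have : t ∈ Function.support (f.normed volume) := hne
  rw [f.support_normed_eq, Real.ball_eq_Ioo] at this
  exact ht ⟨by have := this.1; norm_num [f] at this; linarith,
    by have := this.2; norm_num [f] at this; linarith⟩

end Line

/-! ### Slicing by lines in the direction μ, and the divergence theorem. -/

section GaussGreen

variable {d : ℕ} {U : Set (Space d)}

theorem measurableSet_inflow (U : Set (Space d)) (μ : Dir d) : MeasurableSet (inflow U μ) := by
  have h : MeasurableSet {x | ⟪(μ : Space d), normal U x⟫ < 0} :=
    measurableSet_lt (measurable_normal U).const_inner measurable_const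
  exact (measurableSet_faces U).inter h

theorem measurableSet_outflow (U : Set (Space d)) (μ : Dir d) : MeasurableSet (outflow U μ) := by
  have h : MeasurableSet {x | 0 ≤ ⟪(μ : Space d), normal U x⟫} :=
    measurableSet_le measurable_const (measurable_normal U).const_inner
  exact (measurableSet_faces U).inter h

theorem norm_dir (μ : Dir d) : ‖(μ : Space d)‖ = 1 := by simp

theorem eventually_line_right {p : Space d → Prop} {y w : Space d} {t₀ : ℝ}
    (h : ∀ᶠ s : ℝ in 𝓝[>] 0, p (y + t₀ • w + s • w)) : ∀ᶠ t : ℝ in 𝓝[>] t₀, p (y + t • w) := by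
  have ht : Tendsto (fun t : ℝ => t - t₀) (𝓝[>] t₀) (𝓝[>] 0) := by
    refine tendsto_nhdsWithin_iff.2 ⟨?_, ?_⟩
    · have : Tendsto (fun t : ℝ => t - t₀) (𝓝 t₀) (𝓝 (t₀ - t₀)) := Continuous.tendsto (by fun_prop) _
      simpa using this.mono_left nhdsWithin_le_nhds
    · filter_upwards [self_mem_nhdsWithin] with t ht using sub_pos.2 (show t₀ < t from ht)
  refine (ht.eventually h).mono fun t ht => ?_
  have : y + t₀ • w + (t - t₀) • w = y + t • w := by module
  rwa [this] at ht

theorem eventually_line_left {p : Space d → Prop} {y w : Space d} {t₀ : ℝ}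
    (h : ∀ᶠ s : ℝ in 𝓝[>] 0, p (y + t₀ • w + s • -w)) : ∀ᶠ t : ℝ in 𝓝[<] t₀, p (y + t • w) := by
  have ht : Tendsto (fun t : ℝ => t₀ - t) (𝓝[<] t₀) (𝓝[>] 0) := by
    refine tendsto_nhdsWithin_iff.2 ⟨?_, ?_⟩
    · have : Tendsto (fun t : ℝ => t₀ - t) (𝓝 t₀) (𝓝 (t₀ - t₀)) := Continuous.tendsto (by fun_prop) _
      simpa using this.mono_left nhdsWithin_le_nhds
    · filter_upwards [self_mem_nhdsWithin] with t ht using sub_pos.2 (show t < t₀ from ht)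
  refine (ht.eventually h).mono fun t ht => ?_
  have : y + t₀ • w + (t₀ - t) • -w = y + t • w := by module
  rwa [this] at ht

variable {μ : Dir d} {y : Space d}

theorem line_inflow (hU : IsOpen U) {t₀ : ℝ} (h : y + t₀ • (μ : Space d) ∈ inflow U μ) :
    y + t₀ • (μ : Space d) ∉ U ∧ (∀ᶠ t : ℝ in 𝓝[>] t₀, y + t • (μ : Space d) ∈ U) ∧
      ∀ᶠ t : ℝ in 𝓝[<] t₀, y + t • (μ : Space d) ∉ closure U := by
  have hn := isOutwardNormal_normal h.1
  refine ⟨?_, eventually_line_right (hn.eventually_mem h.2),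
    eventually_line_left (p := fun x => x ∉ closure U) (hn.eventually_notMem_closure ?_)⟩
  · have := h.1.1
    rw [hU.frontier_eq] at this
    exact this.2
  · rw [inner_neg_left]; exact neg_pos.2 h.2

theorem line_outflow (hU : IsOpen U) {t₀ : ℝ} (h : y + t₀ • (μ : Space d) ∈ outflow U μ)
    (h0 : ⟪normal U (y + t₀ • (μ : Space d)), (μ : Space d)⟫ ≠ 0) :
    y + t₀ • (μ : Space d) ∉ U ∧ (∀ᶠ t : ℝ in 𝓝[>] t₀, y + t • (μ : Space d) ∉ closure U) ∧
      ∀ᶠ t : ℝ in 𝓝[<] t₀, y + t • (μ : Space d) ∈ U := by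
  have hn := isOutwardNormal_normal h.1
  have hpos : 0 < ⟪(μ : Space d), normal U (y + t₀ • (μ : Space d))⟫ := by
    rw [real_inner_comm] at h0
    exact lt_of_le_of_ne h.2 (Ne.symm h0)
  refine ⟨?_, eventually_line_right (p := fun x => x ∉ closure U) (hn.eventually_notMem_closure hpos),
    eventually_line_left (hn.eventually_mem ?_)⟩
  · have := h.1.1
    rw [hU.frontier_eq] at this
    exact this.2
  · rw [inner_neg_left]; exact neg_neg_of_pos hpos

/-- Lines in almost every position hit the boundary of a regular bounded open set finitely often and
transversally; along such lines the fundamental theorem of calculus holds with one term for every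
hit. -/
theorem hitSum_balance (hU : IsOpen U) (hUb : Bornology.IsBounded U)
    (h1 : ∀ t : ℝ, y + t • (μ : Space d) ∉ frontier U \ faces U)
    (h2 : ∀ t : ℝ, y + t • (μ : Space d) ∈ faces U →
      ⟪normal U (y + t • (μ : Space d)), (μ : Space d)⟫ ≠ 0)
    {ψ : Space d → ℝ} (hψ : ContDiff ℝ 1 ψ) (hψ0 : ∀ x, 0 ≤ ψ x) {χ : ℝ → ℝ} (hχ : ContDiff ℝ 1 χ)
    (hχ0 : ∀ t, 0 ≤ χ t) (hχc : HasCompactSupport χ) :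
    hitSum μ (inflow U μ) (fun x => ENNReal.ofReal (ψ x)) (fun t => ENNReal.ofReal (χ t)) y ≠ ⊤ ∧
    hitSum μ (outflow U μ) (fun x => ENNReal.ofReal (ψ x)) (fun t => ENNReal.ofReal (χ t)) y ≠ ⊤ ∧
    ∫ t in {t : ℝ | y + t • (μ : Space d) ∈ U}, deriv (fun t => χ t * ψ (y + t • (μ : Space d))) t
      = (hitSum μ (outflow U μ) (fun x => ENNReal.ofReal (ψ x))
          (fun t => ENNReal.ofReal (χ t)) y).toReal
        - (hitSum μ (inflow U μ) (fun x => ENNReal.ofReal (ψ x))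
          (fun t => ENNReal.ofReal (χ t)) y).toReal := by
  classical
  have hlc : Continuous fun t : ℝ => y + t • (μ : Space d) := by fun_prop
  let H : Set ℝ := {t : ℝ | y + t • (μ : Space d) ∈ frontier U}
  have hsplit : ∀ t ∈ H, y + t • (μ : Space d) ∈ inflow U μ ∨ y + t • (μ : Space d) ∈ outflow U μ := by
    intro t ht
    have hf : y + t • (μ : Space d) ∈ faces U := by
      by_contra hcon
      exact h1 t ⟨ht, hcon⟩
    rcases lt_or_ge ⟪(μ : Space d), normal U (y + t • (μ : Space d))⟫ 0 with h | h
    · exact Or.inl ⟨hf, h⟩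
    · exact Or.inr ⟨hf, h⟩
  have hHc : IsCompact H := by
    refine Metric.isCompact_of_isClosed_isBounded (isClosed_frontier.preimage hlc) ?_
    obtain ⟨R, hR⟩ := (hUb.closure.subset frontier_subset_closure).exists_norm_le
    refine (Metric.isBounded_closedBall (x := (0 : ℝ)) (r := R + ‖y‖)).subset fun t ht => ?_
    rw [mem_closedBall_zero_iff]
    have h3 := hR _ ht
    have h4 : ‖t • (μ : Space d)‖ ≤ ‖y + t • (μ : Space d)‖ + ‖y‖ := by
      have := norm_sub_le (y + t • (μ : Space d)) y
      rwa [add_sub_cancel_left] at this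
    rw [norm_smul, norm_dir, mul_one] at h4
    linarith
  -- A transversal hit is isolated: on one side the line is in U, on the other outside its closure.
  -- Compactness then leaves finitely many hits.
  have hiso : ∀ t₀ ∈ H, {t | t ∈ H → t = t₀} ∈ 𝓝 t₀ := by
    intro t₀ ht₀
    have hout : ∀ t, y + t • (μ : Space d) ∉ closure U → t ∉ H := fun t h ht =>
      h (frontier_subset_closure ht)
    have hin : ∀ t, y + t • (μ : Space d) ∈ U → t ∉ H := fun t h ht => by
      have : y + t • (μ : Space d) ∈ frontier U := ht
      rw [hU.frontier_eq] at this
      exact this.2 h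
    have hr : ∀ᶠ t in 𝓝[>] t₀, t ∉ H := by
      rcases hsplit t₀ ht₀ with h | h
      · exact (line_inflow hU h).2.1.mono hin
      · exact (line_outflow hU h (h2 t₀ h.1)).2.1.mono hout
    have hl : ∀ᶠ t in 𝓝[<] t₀, t ∉ H := by
      rcases hsplit t₀ ht₀ with h | h
      · exact (line_inflow hU h).2.2.mono hout
      · exact (line_outflow hU h (h2 t₀ h.1)).2.2.mono hin
    change ∀ᶠ t in 𝓝 t₀, t ∈ H → t = t₀
    rw [← nhdsNE_sup_pure, ← nhdsLT_sup_nhdsGT]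
    simp only [eventually_sup]
    exact ⟨⟨hl.mono fun t h h' => absurd h' h, hr.mono fun t h h' => absurd h' h⟩, by simp⟩
  have hHfin : H.Finite := by
    obtain ⟨T, -, hT⟩ := hHc.elim_nhds_subcover (fun t₀ => {t | t ∈ H → t = t₀}) hiso
    refine T.finite_toSet.subset fun t ht => ?_
    obtain ⟨t₀, ht₀, h⟩ := mem_iUnion₂.1 (hT ht)
    have : t = t₀ := h ht
    rwa [this]
  have hfinS : {t : ℝ | y + t • (μ : Space d) ∈ inflow U μ}.Finite :=
    hHfin.subset fun t ht => ht.1.1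
  have hfinE : {t : ℝ | y + t • (μ : Space d) ∈ outflow U μ}.Finite :=
    hHfin.subset fun t ht => ht.1.1
  have hsum : ∀ {A : Set (Space d)} (hA : {t : ℝ | y + t • (μ : Space d) ∈ A}.Finite),
      hitSum μ A (fun x => ENNReal.ofReal (ψ x)) (fun t => ENNReal.ofReal (χ t)) y
        = ENNReal.ofReal (∑ t ∈ hA.toFinset, χ t * ψ (y + t • (μ : Space d))) := by
    intro A hA
    rw [hitSum]
    conv_lhs => rw [← hA.coe_toFinset]
    rw [lintegral_finset, ENNReal.ofReal_sum_of_nonneg fun t _ => mul_nonneg (hχ0 t) (hψ0 _)]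
    refine Finset.sum_congr rfl fun t _ => ?_
    rw [Measure.count_singleton, mul_one, mul_comm, ENNReal.ofReal_mul (hχ0 t)]
  have hnn : ∀ A : Finset ℝ, 0 ≤ ∑ t ∈ A, χ t * ψ (y + t • (μ : Space d)) := fun A =>
    Finset.sum_nonneg fun t _ => mul_nonneg (hχ0 t) (hψ0 _)
  rw [hsum hfinS, hsum hfinE]
  refine ⟨ENNReal.ofReal_ne_top, ENNReal.ofReal_ne_top, ?_⟩
  rw [ENNReal.toReal_ofReal (hnn _), ENNReal.toReal_ofReal (hnn _)]
  refine integral_deriv_eq_sum_hits (hU.preimage hlc) _ _ (fun t ht => ?_) (fun s hs => ?_)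
    (fun s hs => ?_) ?_ hχc.mul_right
  · rw [Finite.mem_toFinset, Finite.mem_toFinset]
    have : t ∈ H := by
      have := hlc.frontier_preimage_subset U ht
      exact this
    exact hsplit t this
  · rw [Finite.mem_toFinset] at hs
    have h := line_inflow hU hs
    exact ⟨h.1, h.2.1, h.2.2.mono fun t ht htU => ht (subset_closure htU)⟩
  · rw [Finite.mem_toFinset] at hs
    have h := line_outflow hU hs (h2 s hs.1)
    exact ⟨h.1, h.2.1.mono fun t ht htU => ht (subset_closure htU), h.2.2⟩
  · exact hχ.mul (hψ.comp (by fun_prop))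

theorem integrableOn_of_continuous_of_isBounded {ψ : Space d → ℝ} (hψ : Continuous ψ)
    (hUb : Bornology.IsBounded U) : IntegrableOn ψ U :=
  (hψ.continuousOn.integrableOn_compact (Metric.isCompact_of_isClosed_isBounded isClosed_closure
    hUb.closure)).mono_set subset_closure

/-- By Fubini and the shift y ↦ y + tμ the double integral becomes ∫χ' · ∫_U ψ + ∫χ · ∫_U ∂_μψ,
where the first factor is 0 and ∫χ = 1. -/
theorem integral_line_deriv (hU : IsOpen U) (hUb : Bornology.IsBounded U) (μ : Dir d)
    {ψ : Space d → ℝ} (hψ : ContDiff ℝ 1 ψ) {χ : ℝ → ℝ} (hχ : ContDiff ℝ 1 χ)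
    (hχc : HasCompactSupport χ) (hχ1 : ∫ t, χ t = 1) :
    ∫ y, ∫ t in {t : ℝ | y + t • (μ : Space d) ∈ U},
      deriv (fun t => χ t * ψ (y + t • (μ : Space d))) t = ∫ x in U, fderiv ℝ ψ x μ := by
  let D : Space d → ℝ := fun x => fderiv ℝ ψ x μ
  have hD : Continuous D := (hψ.continuous_fderiv one_ne_zero).clm_apply continuous_const
  let G : ℝ × Space d → ℝ := fun z => deriv χ z.1 * U.indicator ψ z.2 + χ z.1 * U.indicator D z.2
  have iχ : Integrable χ := hχ.continuous.integrable_of_hasCompactSupport hχc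
  have iχ' : Integrable (deriv χ) :=
    (hχ.continuous_deriv le_rfl).integrable_of_hasCompactSupport hχc.deriv
  have iψ : Integrable (U.indicator ψ) :=
    (integrableOn_of_continuous_of_isBounded hψ.continuous hUb).integrable_indicator hU.measurableSet
  have iD : Integrable (U.indicator D) :=
    (integrableOn_of_continuous_of_isBounded hD hUb).integrable_indicator hU.measurableSet
  have hG : Integrable G (volume.prod volume) := (iχ'.mul_prod iψ).add (iχ.mul_prod iD)
  have hGi : ∫ z, G z ∂(volume.prod volume) = ∫ x in U, D x := by
    have h0 : ∫ t, deriv χ t = 0 := by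
      have h1 := hχc.integral_Ioi_deriv_eq hχ 0
      have h2 := hχc.integral_Iic_deriv_eq hχ 0
      rw [← integral_add_compl (measurableSet_Iic (a := (0 : ℝ))) iχ', compl_Iic, h1, h2]
      ring
    have h3 := integral_add (iχ'.mul_prod iψ) (iχ.mul_prod iD)
    rw [integral_prod_mul, integral_prod_mul, h0, hχ1, zero_mul, zero_add, one_mul,
      integral_indicator hU.measurableSet] at h3
    exact h3
  let T : ℝ × Space d → ℝ × Space d := fun z => (z.1, z.2 + z.1 • (μ : Space d))
  have hT : MeasurePreserving T (volume.prod volume) (volume.prod volume) := by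
    refine MeasurePreserving.skew_product (g := fun t y => y + t • (μ : Space d))
      (MeasurePreserving.id volume) ?_ ?_
    · exact (by fun_prop : Measurable fun z : ℝ × Space d => z.2 + z.1 • (μ : Space d))
    · exact Eventually.of_forall fun t => (measurePreserving_add_right volume _).map_eq
  have hGT : Integrable (G ∘ T) (volume.prod volume) := hT.integrable_comp_of_integrable hG
  have hGTi : ∫ z, G (T z) ∂(volume.prod volume) = ∫ x in U, D x := by
    rw [← hGi]
    conv_rhs => rw [← hT.map_eq]
    rw [integral_map hT.measurable.aemeasurable]
    rw [hT.map_eq]; exact hG.aestronglyMeasurable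
  rw [← hGTi, integral_prod_symm (fun z => G (T z)) hGT]
  refine integral_congr_ae (Eventually.of_forall fun y => ?_)
  have hlm : MeasurableSet {t : ℝ | y + t • (μ : Space d) ∈ U} :=
    (hU.preimage (by fun_prop : Continuous fun t : ℝ => y + t • (μ : Space d))).measurableSet
  change ∫ t in {t : ℝ | y + t • (μ : Space d) ∈ U},
      deriv (fun t => χ t * ψ (y + t • (μ : Space d))) t = ∫ t, G (T (t, y))
  rw [← integral_indicator hlm]
  refine integral_congr_ae (Eventually.of_forall fun t => ?_)
  have hder : deriv (fun t => χ t * ψ (y + t • (μ : Space d))) t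
      = deriv χ t * ψ (y + t • (μ : Space d)) + χ t * D (y + t • (μ : Space d)) := by
    have h1 : HasDerivAt χ (deriv χ t) t := (hχ.differentiable one_ne_zero t).hasDerivAt
    have h2 : HasDerivAt (fun t : ℝ => y + t • (μ : Space d)) (μ : Space d) t := by
      simpa using ((hasDerivAt_id t).smul_const (μ : Space d)).const_add y
    have h3 : HasDerivAt (fun t : ℝ => ψ (y + t • (μ : Space d))) (D (y + t • (μ : Space d))) t :=
      (hψ.differentiable one_ne_zero _).hasFDerivAt.comp_hasDerivAt t h2
    exact (h1.mul h3).deriv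
  by_cases ht : y + t • (μ : Space d) ∈ U
  · rw [indicator_of_mem (show t ∈ {t : ℝ | y + t • (μ : Space d) ∈ U} from ht), hder]
    simp only [G, T, indicator_of_mem ht]
  · rw [indicator_of_notMem (show t ∉ {t : ℝ | y + t • (μ : Space d) ∈ U} from ht)]
    simp only [G, T, indicator_of_notMem ht, mul_zero, add_zero]

/-- The divergence theorem for the vector field `ψ μ` on a bounded open set with boundary of finite
area that has an outward normal almost everywhere. -/
theorem integral_fderiv_eq_surf (hU : IsOpen U) (hUb : Bornology.IsBounded U)
    (hfin : surf d (frontier U) < ⊤) (hreg : surf d (frontier U \ faces U) = 0) (μ : Dir d)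
    {ψ : Space d → ℝ} (hψ : ContDiff ℝ 1 ψ) (hψ0 : ∀ x, 0 ≤ ψ x) :
    ∫ x in U, fderiv ℝ ψ x μ
      = ∫ x in outflow U μ, |⟪(μ : Space d), normal U x⟫| * ψ x ∂(surf d)
        - ∫ x in inflow U μ, |⟪(μ : Space d), normal U x⟫| * ψ x ∂(surf d) := by
  -- Integration over all y ∈ ℝ^d meets every line once for each base point on it; the profile χ of
  -- unit mass normalises this multiplicity to one.
  obtain ⟨χ, hχ, hχ0, hχc, hχs, hχ1⟩ := exists_cutoff
  have hμ := norm_dir μ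
  have hfaces : surf d (faces U) < ⊤ := (measure_mono (faces_subset_frontier U)).trans_lt hfin
  have hχl : ∫⁻ t, ENNReal.ofReal (χ t) = 1 := by
    rw [← ofReal_integral_eq_lintegral_ofReal
      (hχ.continuous.integrable_of_hasCompactSupport hχc) (Eventually.of_forall hχ0), hχ1,
      ENNReal.ofReal_one]
  obtain ⟨R, hR⟩ : ∃ R, ∀ x ∈ frontier U, ‖ψ x‖ ≤ R :=
    (Metric.isCompact_of_isClosed_isBounded isClosed_frontier
      (hUb.closure.subset frontier_subset_closure)).exists_bound_of_continuousOn
      hψ.continuous.continuousOn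
  have key : ∀ A : Set (Space d), MeasurableSet A → A ⊆ faces U →
      AEMeasurable (hitSum μ A (fun x => ENNReal.ofReal (ψ x)) (fun t => ENNReal.ofReal (χ t))) ∧
      ∫⁻ y, hitSum μ A (fun x => ENNReal.ofReal (ψ x)) (fun t => ENNReal.ofReal (χ t)) y ≠ ⊤ ∧
      (∫⁻ y, hitSum μ A (fun x => ENNReal.ofReal (ψ x)) (fun t => ENNReal.ofReal (χ t)) y).toReal
        = ∫ x in A, |⟪(μ : Space d), normal U x⟫| * ψ x ∂(surf d) := by
    intro A hAm hA
    have hAs : surf d A < ⊤ := (measure_mono hA).trans_lt hfaces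
    have h := lintegral_hitSum hU hAm hA hAs hμ (ψ := fun x => ENNReal.ofReal (ψ x))
      hψ.continuous.measurable.ennreal_ofReal (χ := fun t => ENNReal.ofReal (χ t))
      hχ.continuous.measurable.ennreal_ofReal (fun t ht => by simp [hχs t ht])
    have hwm : Measurable fun x => |⟪(μ : Space d), normal U x⟫| * ψ x :=
      ((measurable_normal U).const_inner.abs).mul hψ.continuous.measurable
    have hint : IntegrableOn (fun x => |⟪(μ : Space d), normal U x⟫| * ψ x) A (surf d) := by
      refine Measure.integrableOn_of_bounded hAs.ne hwm.aestronglyMeasurable (M := R) ?_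
      filter_upwards [ae_restrict_mem hAm] with x hx
      rw [norm_mul, Real.norm_eq_abs, abs_abs]
      have h1 : |⟪(μ : Space d), normal U x⟫| ≤ 1 := by
        refine (abs_real_inner_le_norm _ _).trans ?_
        rw [hμ, one_mul]; exact norm_normal_le U x
      calc _ ≤ 1 * ‖ψ x‖ := by gcongr
        _ ≤ R := by rw [one_mul]; exact hR x (faces_subset_frontier U (hA hx))
    have hval : ∫⁻ x in A, ENNReal.ofReal (ψ x) * ENNReal.ofReal |⟪normal U x, (μ : Space d)⟫| ∂(surf d)
        = ENNReal.ofReal (∫ x in A, |⟪(μ : Space d), normal U x⟫| * ψ x ∂(surf d)) := by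
      rw [ofReal_integral_eq_lintegral_ofReal hint
        (Eventually.of_forall fun x => mul_nonneg (abs_nonneg _) (hψ0 x))]
      refine lintegral_congr fun x => ?_
      rw [mul_comm, real_inner_comm, ← ENNReal.ofReal_mul (abs_nonneg _)]
    rw [h.2, hχl, mul_one, hval]
    refine ⟨h.1, ENNReal.ofReal_ne_top, ENNReal.toReal_ofReal ?_⟩
    exact integral_nonneg fun x => mul_nonneg (abs_nonneg _) (hψ0 x)
  obtain ⟨i1, i2, i3⟩ := key _ (measurableSet_inflow U μ) fun x hx => hx.1
  obtain ⟨o1, o2, o3⟩ := key _ (measurableSet_outflow U μ) fun x hx => hx.1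
  have hae := (ae_forall_notMem_of_surf_eq_zero hμ hreg).and
    (ae_forall_inner_normal_ne_zero hU (measurableSet_faces U) Subset.rfl hfaces hμ)
  have hbal := hae.mono fun y hy => hitSum_balance hU hUb hy.1 hy.2 hψ hψ0 hχ hχ0 hχc
  rw [← integral_line_deriv hU hUb μ hψ hχ hχc hχ1, integral_congr_ae (hbal.mono fun y hy => hy.2.2),
    integral_sub (integrable_toReal_of_lintegral_ne_top o1 o2)
      (integrable_toReal_of_lintegral_ne_top i1 i2),
    integral_toReal o1 (hbal.mono fun y hy => hy.2.1.lt_top),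
    integral_toReal i1 (hbal.mono fun y hy => hy.1.lt_top), i3, o3]

end GaussGreen

/-! ### Almost every point of a Lipschitz boundary has a normal -/

section Lipschitz

variable {d : ℕ} {U : Set (Space d)}

/-- The normalised gradient of a local defining function is the outward normal; the first-order
expansion with error ε‖N‖‖z − y‖ decides the sign of φ outside the thin cone around the tangent
plane. -/
theorem isOutwardNormal_of_hasFDerivAt {φ : Space d → ℝ} {L : Space d →L[ℝ] ℝ} {y : Space d}
    (hφ : HasFDerivAt φ L y) (hL : L ≠ 0) (h0 : φ y = 0) (hU : ∀ᶠ z in 𝓝 y, z ∈ U ↔ φ z < 0) :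
    ∃ n, IsOutwardNormal U y n := by
  obtain ⟨N, rfl⟩ := (InnerProductSpace.toDual ℝ (Space d)).surjective L
  have hN : 0 < ‖N‖ := by
    rw [norm_pos_iff]
    rintro rfl
    exact hL (map_zero _)
  refine ⟨‖N‖⁻¹ • N, by rw [norm_smul, norm_inv, norm_norm, inv_mul_cancel₀ hN.ne'],
    fun ε hε => ?_⟩
  have hlo := Asymptotics.isLittleO_iff.1 hφ.isLittleO (c := ε * ‖N‖) (by positivity)
  obtain ⟨δ, hδ, H⟩ := Metric.eventually_nhds_iff.1 (hlo.and hU)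
  refine ⟨δ, hδ, fun z hz => ?_⟩
  obtain ⟨h1, h2⟩ := H (by rwa [dist_eq_norm])
  rw [h0, sub_zero, InnerProductSpace.toDual_apply_apply, Real.norm_eq_abs, abs_le] at h1
  rw [real_inner_smul_right, real_inner_comm, h2]
  constructor
  · intro h
    have : ⟪N, z - y⟫ < -(ε * ‖N‖ * ‖z - y‖) := by
      have := mul_lt_mul_of_pos_left h hN
      rw [mul_inv_cancel_left₀ hN.ne'] at this
      linarith
    linarith [h1.2]
  · intro h
    have : ε * ‖N‖ * ‖z - y‖ < ⟪N, z - y⟫ := by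
      have := mul_lt_mul_of_pos_left h hN
      rw [mul_inv_cancel_left₀ hN.ne'] at this
      linarith
    linarith [h1.1]

/-- By Rademacher the graph function fails to be differentiable only on a null set of the
hyperplane, and the Lipschitz graph map carries it to a set of zero area. Elsewhere ⟪ν,z⟫ − g(perp ν
z) is a defining function whose derivative along ν is 1. -/
theorem surf_graph_diff_faces_eq_zero (hU : IsOpen U) {ν x : Space d} (hν : ‖ν‖ = 1) {K : NNReal}
    {g : Space d → ℝ} (hg : LipschitzWith K g) {ρ : ℝ}
    (h : ∀ y ∈ Metric.ball x ρ, (y ∈ U ↔ ⟪ν, y⟫ < g (perp ν y))) :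
    surf d ((frontier U ∩ Metric.ball x ρ) \ faces U) = 0 := by
  let W := (ℝ ∙ ν)ᗮ
  let pr : Space d →L[ℝ] W := W.orthogonalProjectionOnto
  have hpr : ∀ z, (pr z : Space d) = perp ν z := fun z => by
    rw [perp_eq_starProjection hν]
    exact Submodule.coe_orthogonalProjectionOnto_apply _ _
  -- Rademacher has to be applied on the hyperplane itself: a null set of ℝ^d could contain the
  -- whole hyperplane.
  let g' : W → ℝ := fun w => g w
  have hg' : LipschitzWith K g' := fun a b => hg a b
  let N : Set W := {w | ¬ DifferentiableAt ℝ g' w}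
  have hN : volume N = 0 := hg'.ae_differentiableAt
  have hN' : surf d (Subtype.val '' N) = 0 := by
    rw [surf, isometry_subtype_coe.euclideanHausdorffMeasure_image, ← finrank_orthogonal_unit hν,
      InnerProductSpace.euclideanHausdorffMeasure_eq_volume]
    exact hN
  let G : Space d → Space d := fun z => z + g z • ν
  have hG : LipschitzWith (1 + K) G := by
    refine LipschitzWith.id.add (LipschitzWith.of_dist_le_mul fun a b => ?_)
    rw [dist_eq_norm, ← sub_smul, norm_smul, hν, mul_one, ← dist_eq_norm]
    exact hg.dist_le_mul a b
  have hGN : surf d (G '' (Subtype.val '' N)) = 0 := by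
    have := surf_image_le (hG.lipschitzOnWith (s := Subtype.val '' N))
    rw [hN', mul_zero] at this
    exact nonpos_iff_eq_zero.1 this
  refine measure_mono_null (fun y hy => ?_) hGN
  obtain ⟨⟨hyU, hyb⟩, hyf⟩ := hy
  have hcg : Continuous fun z => g (perp ν z) := hg.continuous.comp (perp ν).continuous
  rw [hU.frontier_eq] at hyU
  have hy0 : ⟪ν, y⟫ = g (perp ν y) := by
    refine le_antisymm ?_ (not_lt.1 fun hlt => hyU.2 ((h y hyb).2 hlt))
    by_contra! hlt
    have ho : IsOpen (Metric.ball x ρ ∩ {z | g (perp ν z) < ⟪ν, z⟫}) :=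
      Metric.isOpen_ball.inter (isOpen_lt hcg (by fun_prop))
    obtain ⟨z, ⟨hz, hz'⟩, hzU⟩ := mem_closure_iff.1 hyU.1 _ ho ⟨hyb, hlt⟩
    exact absurd ((h z hz).1 hzU) (not_lt.2 (le_of_lt hz'))
  refine ⟨perp ν y, ⟨pr y, fun hdiff => hyf (mem_faces_iff.2 ?_), hpr y⟩, ?_⟩
  · have h1 : HasFDerivAt (fun z => ⟪ν, z⟫ - g' (pr z))
        (innerSL ℝ ν - (fderiv ℝ g' (pr y)).comp pr) y :=
      ((innerSL ℝ ν).hasFDerivAt).sub (hdiff.hasFDerivAt.comp y pr.hasFDerivAt)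
    refine isOutwardNormal_of_hasFDerivAt h1 (fun h0 => ?_) ?_ ?_
    · have h2 : pr ν = 0 := Subtype.ext (by rw [hpr, perp_self hν]; rfl)
      have h3 := congrArg (fun L : Space d →L[ℝ] ℝ => L ν) h0
      simp [h2, hν] at h3
    · simp only [g', hpr, hy0, sub_self]
    · filter_upwards [Metric.isOpen_ball.mem_nhds hyb] with z hz
      rw [h z hz, sub_neg]
      simp only [g', hpr]
  · simp only [G]
    rw [← hy0, perp_apply, sub_add_cancel]

theorem surf_lipschitz_diff_faces_eq_zero (hU : IsOpen U) :
    surf d ({x | x ∈ frontier U ∧ IsLipschitzBoundaryPoint U x} \ faces U) = 0 := by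
  refine measure_null_of_locally_null _ fun x hx => ?_
  obtain ⟨⟨-, ν, K, g, ρ, hν, hg, hρ, h⟩, -⟩ := hx
  refine ⟨_, ?_, surf_graph_diff_faces_eq_zero hU hν hg h⟩
  filter_upwards [self_mem_nhdsWithin, mem_nhdsWithin_of_mem_nhds (Metric.ball_mem_nhds x hρ)]
    with y hy hyb
  exact ⟨⟨hy.1.1, hyb⟩, hy.2⟩

end Lipschitz

theorem IsLipschitzDomain.surf_frontier_diff_faces {d : ℕ} {U : Set (Space d)}
    (hU : IsLipschitzDomain U) : surf d (frontier U \ faces U) = 0 := by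
  refine measure_mono_null (fun x hx => ?_) (surf_lipschitz_diff_faces_eq_zero hU.isOpen)
  exact ⟨⟨hx.1, hU.lipschitz x hx.1⟩, hx.2⟩

/-! ### Geometry of spatial meshes -/

namespace SpatialMesh

variable {d : ℕ} {Ω : Set (Space d)} (M : SpatialMesh Ω)

theorem surf_frontier_diff_faces (i : Fin M.card) :
    surf d (frontier (M.elem i) \ faces (M.elem i)) = 0 := by
  refine measure_mono_null (fun x hx => ?_)
    (measure_union_null (surf_lipschitz_diff_faces_eq_zero (M.isOpen i)) (M.regular i))
  by_cases h : IsLipschitzBoundaryPoint (M.elem i) x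
  · exact Or.inl ⟨⟨hx.1, h⟩, hx.2⟩
  · exact Or.inr ⟨hx.1, h⟩

theorem isBounded (hΩ : Bornology.IsBounded Ω) (i : Fin M.card) :
    Bornology.IsBounded (M.elem i) := hΩ.subset (M.subset i)

theorem ae_mem_faces (hΩ : IsLipschitzDomain Ω) :
    ∀ᵐ x ∂(surf d), (∀ i, x ∈ frontier (M.elem i) → x ∈ faces (M.elem i)) ∧
      (x ∈ frontier Ω → x ∈ faces Ω) := by
  refine Eventually.and (eventually_countable_forall.2 fun i => ?_) ?_
  · refine measure_mono_null (fun x hx => ?_) (M.surf_frontier_diff_faces i)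
    simpa [Classical.not_imp] using hx
  · refine measure_mono_null (fun x hx => ?_) hΩ.surf_frontier_diff_faces
    simpa [Classical.not_imp] using hx

/-- An element containing x would, being open, contain points of the element i that accumulate at x.
-/
theorem mem_frontier_of_mem_closure {i k : Fin M.card} {x : Space d}
    (hi : x ∈ frontier (M.elem i)) (hk : x ∈ closure (M.elem k)) : x ∈ frontier (M.elem k) := by
  rw [(M.isOpen k).frontier_eq]
  refine ⟨hk, fun hx => ?_⟩
  by_cases hik : i = k
  · subst hik
    rw [(M.isOpen i).frontier_eq] at hi
    exact hi.2 hx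
  · obtain ⟨z, hzk, hzi⟩ := mem_closure_iff.1 (frontier_subset_closure hi) _ (M.isOpen k) hx
    exact Set.disjoint_left.1 (M.disjoint i k hik) hzi hzk

theorem normal_eq_of_mem_frontier {i : Fin M.card} {x : Space d} (hi : x ∈ faces (M.elem i))
    (hΩ : x ∈ faces Ω) : normal (M.elem i) x = normal Ω x :=
  (isOutwardNormal_normal hi).eq_of_subset (isOutwardNormal_normal hΩ) (M.subset i)

/-- A boundary point of an element in the interior of the domain at which all normals exist belongs
to exactly one more element, and the normals are opposite. -/
theorem exists_neighbour (hΩ : IsOpen Ω) {x : Space d}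
    (hx : ∀ i, x ∈ frontier (M.elem i) → x ∈ faces (M.elem i)) {i : Fin M.card}
    (hi : x ∈ faces (M.elem i)) (hxΩ : x ∉ frontier Ω) :
    ∃ j, j ≠ i ∧ x ∈ faces (M.elem j) ∧ normal (M.elem j) x = -normal (M.elem i) x ∧
      ∀ k, x ∈ closure (M.elem k) → k = i ∨ k = j := by
  have hf : ∀ k, x ∈ closure (M.elem k) → x ∈ faces (M.elem k) := fun k hk =>
    hx k (M.mem_frontier_of_mem_closure hi.1 hk)
  have hn : ∀ k, k ≠ i → x ∈ closure (M.elem k) → normal (M.elem k) x = -normal (M.elem i) x :=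
    fun k hk hkx => (isOutwardNormal_normal hi).eq_neg_of_disjoint
      (isOutwardNormal_normal (hf k hkx)) (M.disjoint i k hk.symm)
  have hxmem : x ∈ Ω := by
    by_contra hcon
    apply hxΩ
    rw [hΩ.frontier_eq]
    exact ⟨closure_mono (M.subset i) (frontier_subset_closure hi.1), hcon⟩
  -- A small step along the outward normal leaves the closure of element i but stays in Ω, which the
  -- finitely many closures cover; so some other closure contains x.
  obtain ⟨j, hji, hjx⟩ : ∃ j, j ≠ i ∧ x ∈ closure (M.elem j) := by
    by_contra! hcon
    let n := normal (M.elem i) x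
    have hni : 0 < ⟪n, n⟫ := by
      rw [real_inner_self_eq_norm_sq, norm_normal hi]; norm_num
    have ht : Tendsto (fun s : ℝ => x + s • n) (𝓝[>] 0) (𝓝 x) := by
      have : Tendsto (fun s : ℝ => x + s • n) (𝓝 0) (𝓝 (x + (0 : ℝ) • n)) :=
        Continuous.tendsto (by fun_prop) 0
      rw [zero_smul, add_zero] at this
      exact this.mono_left nhdsWithin_le_nhds
    have h1 := (isOutwardNormal_normal hi).eventually_notMem_closure hni
    have h2 := ht.eventually (hΩ.mem_nhds hxmem)
    have h3 : ∀ᶠ s : ℝ in 𝓝[>] 0, ∀ j, j ≠ i → x + s • n ∉ closure (M.elem j) := by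
      refine eventually_all.2 fun j => ?_
      by_cases hj : j = i
      · simp [hj]
      · exact (ht.eventually (isClosed_closure.isOpen_compl.mem_nhds (hcon j hj))).mono
          fun s hs _ => hs
    obtain ⟨s, ⟨hs1, hs2⟩, hs3⟩ := ((h1.and h2).and h3).exists
    have : x + s • n ∈ closure Ω := subset_closure hs2
    rw [M.cover] at this
    obtain ⟨k, hk⟩ := mem_iUnion.1 this
    by_cases hki : k = i
    · exact hs1 (hki ▸ hk)
    · exact hs3 k hki hk
  refine ⟨j, hji, hf j hjx, hn j hji hjx, fun k hk => ?_⟩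
  -- Two distinct neighbours j and k would both have the normal −n, yet being disjoint they need
  -- opposite normals; this forces n = 0.
  by_contra! hcon
  have h1 := hn k hcon.1 hk
  have h2 := (isOutwardNormal_normal (hf j hjx)).eq_neg_of_disjoint
    (isOutwardNormal_normal (hf k hk)) (M.disjoint j k hcon.2.symm)
  rw [h1, hn j hji hjx, neg_neg] at h2
  have h3 : normal (M.elem i) x = 0 := by
    have h4 : (2 : ℝ) • normal (M.elem i) x = 0 := by
      rw [two_smul]
      nth_rewrite 1 [← h2]
      exact neg_add_cancel _
    exact (smul_eq_zero.1 h4).resolve_left two_ne_zero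
  have := norm_normal hi
  rw [h3, norm_zero] at this
  exact zero_ne_one this

open Classical in
/-- Conservation at a boundary point: what leaves the elements across interior faces enters their
neighbours. -/
theorem sum_outflow_eq_sum_inflow (hΩ : IsOpen Ω) {x : Space d}
    (hx : ∀ i, x ∈ frontier (M.elem i) → x ∈ faces (M.elem i)) (μ : Dir d) (a : Fin M.card → ℝ) :
    ∑ i, (outflow (M.elem i) μ \ frontier Ω).indicator
        (fun x => |⟪(μ : Space d), normal (M.elem i) x⟫| * a i) x
      = ∑ i, (inflow (M.elem i) μ \ frontier Ω).indicator
        (fun x => |⟪(μ : Space d), normal (M.elem i) x⟫| *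
          ∑ k, if k ≠ i ∧ x ∈ closure (M.elem k) then a k else 0) x := by
  by_cases hxΩ : x ∈ frontier Ω
  · rw [Finset.sum_eq_zero, Finset.sum_eq_zero]
    · exact fun i _ => indicator_of_notMem (fun h => h.2 hxΩ) _
    · exact fun i _ => indicator_of_notMem (fun h => h.2 hxΩ) _
  by_cases hex : ∃ i, x ∈ faces (M.elem i)
  swap
  · push Not at hex
    rw [Finset.sum_eq_zero, Finset.sum_eq_zero]
    · exact fun i _ => indicator_of_notMem (fun h => hex i h.1.1) _
    · exact fun i _ => indicator_of_notMem (fun h => hex i h.1.1) _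
  obtain ⟨i, hi⟩ := hex
  obtain ⟨j, hji, hj, hnj, hij⟩ := M.exists_neighbour hΩ hx hi hxΩ
  have hother : ∀ k, k ≠ i ∧ k ≠ j → x ∉ faces (M.elem k) := fun k hk hkx =>
    (hij k (frontier_subset_closure hkx.1)).elim hk.1 hk.2
  have hexti : (∑ k, if k ≠ i ∧ x ∈ closure (M.elem k) then a k else 0) = a j := by
    rw [Finset.sum_eq_single j]
    · rw [if_pos ⟨hji, frontier_subset_closure hj.1⟩]
    · intro k _ hk
      rw [if_neg]
      exact fun h => (hij k h.2).elim h.1 hk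
    · simp
  have hextj : (∑ k, if k ≠ j ∧ x ∈ closure (M.elem k) then a k else 0) = a i := by
    rw [Finset.sum_eq_single i]
    · rw [if_pos ⟨hji.symm, frontier_subset_closure hi.1⟩]
    · intro k _ hk
      rw [if_neg]
      exact fun h => (hij k h.2).elim hk h.1
    · simp
  rw [Fintype.sum_eq_add i j hji.symm fun k hk => indicator_of_notMem
      (fun h => hother k hk h.1.1) _,
    Fintype.sum_eq_add i j hji.symm fun k hk => indicator_of_notMem
      (fun h => hother k hk h.1.1) _]
  set c := ⟪(μ : Space d), normal (M.elem i) x⟫ with hc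
  have hcj : ⟪(μ : Space d), normal (M.elem j) x⟫ = -c := by rw [hnj, inner_neg_right]
  have m1 : x ∈ outflow (M.elem i) μ \ frontier Ω ↔ 0 ≤ c := ⟨fun h => h.1.2, fun h => ⟨⟨hi, h⟩, hxΩ⟩⟩
  have m2 : x ∈ outflow (M.elem j) μ \ frontier Ω ↔ c ≤ 0 :=
    ⟨fun h => by have := h.1.2; rw [hcj] at this; linarith,
      fun h => ⟨⟨hj, by rw [hcj]; linarith⟩, hxΩ⟩⟩
  have m3 : x ∈ inflow (M.elem i) μ \ frontier Ω ↔ c < 0 := ⟨fun h => h.1.2, fun h => ⟨⟨hi, h⟩, hxΩ⟩⟩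
  have m4 : x ∈ inflow (M.elem j) μ \ frontier Ω ↔ 0 < c :=
    ⟨fun h => by have := h.1.2; rw [hcj] at this; linarith,
      fun h => ⟨⟨hj, by rw [hcj]; linarith⟩, hxΩ⟩⟩
  simp only [indicator_apply, m1, m2, m3, m4, hexti, hextj, hcj, ← hc, abs_neg]
  -- For c = 0 the point counts as outflow for both elements, but then the weight |c| vanishes.
  rcases lt_trichotomy c 0 with h | h | h
  · simp [h, h.le, h.not_ge, h.not_gt]
  · simp [h]
  · simp [h, h.le, h.not_ge, h.not_gt]

theorem volume_frontier (hd : 1 ≤ d) (i : Fin M.card) : volume (frontier (M.elem i)) = 0 :=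
  volume_eq_zero_of_surf_lt_top hd (M.finite_area i)

theorem ae_mem_elem (hd : 1 ≤ d) : ∀ᵐ x : Space d, x ∈ Ω → ∃ i, x ∈ M.elem i := by
  refine measure_mono_null (fun x hx => ?_) (measure_iUnion_null fun i => M.volume_frontier hd i)
  simp only [mem_compl_iff, mem_ofPred_eq, Classical.not_imp, not_exists] at hx
  have : x ∈ closure Ω := subset_closure hx.1
  rw [M.cover] at this
  obtain ⟨i, hi⟩ := mem_iUnion.1 this
  refine mem_iUnion.2 ⟨i, ?_⟩
  rw [(M.isOpen i).frontier_eq]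
  exact ⟨hi, hx.2 i⟩

end SpatialMesh

/-! ### Finite element functions -/

section Piecewise

/-- Shared by the angular and the energy space. The value 0 off the pieces makes measurability and
boundedness hold everywhere rather than almost everywhere. -/
theorem piecewise_regular {X : Type*} [TopologicalSpace X] [MeasurableSpace X] [BorelSpace X]
    {n : ℕ} {O : Fin n → Set X} (hO : ∀ j, IsOpen (O j)) {f : X → ℝ}
    (hc : ∀ j, ContinuousOn f (O j)) (hb : ∀ j, ∃ C, ∀ a ∈ O j, |f a| ≤ C)
    (h0 : ∀ a, (∀ j, a ∉ O j) → f a = 0) :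
    Measurable f ∧ (∃ C, ∀ a, |f a| ≤ C) ∧ ContinuousOn f (⋃ j, O j) := by
  classical
  have hcont : ContinuousOn f (⋃ j, O j) := ContinuousOn.iUnion_of_isOpen hc hO
  refine ⟨?_, ?_, hcont⟩
  · have := hcont.measurable_piecewise (g := fun _ => 0) continuousOn_const
      (isOpen_iUnion hO).measurableSet
    convert this using 1
    ext a
    by_cases ha : a ∈ ⋃ j, O j
    · simp only [piecewise_eq_of_mem _ _ _ ha]
    · simp only [piecewise_eq_of_notMem _ _ _ ha]
      exact h0 a fun j hj => ha (mem_iUnion.2 ⟨j, hj⟩)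
  · choose C hC using hb
    refine ⟨∑ j, |C j|, fun a => ?_⟩
    by_cases ha : ∃ j, a ∈ O j
    · obtain ⟨j, hj⟩ := ha
      exact ((hC j a hj).trans (le_abs_self _)).trans
        (Finset.single_le_sum (f := fun j => |C j|) (fun _ _ => abs_nonneg _) (Finset.mem_univ j))
    · push Not at ha
      rw [h0 a ha, abs_zero]
      exact Finset.sum_nonneg fun _ _ => abs_nonneg _

end Piecewise

/-! ### Curved angular elements and the inverse of the radial projection. -/

namespace CubeCell

variable {d : ℕ} (c : CubeCell d)

/-- The inverse of the radial projection on the half-sphere above a facet of the cube. -/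
def flat (μ : Dir d) : Space d := (c.sign / (μ : Space d) c.face) • (μ : Space d)

variable {c}

theorem sign_ne_zero : c.sign ≠ 0 := by rcases c.sign_eq with h | h <;> rw [h] <;> norm_num

/-- On the facet the coordinate `face` equals `sign`, so scaling μ until that coordinate is right
recovers y. -/
theorem flat_eq {y : Space d} (hy : y ∈ c.inner) {μ : Dir d} (hμ : (μ : Space d) = ‖y‖⁻¹ • y) :
    c.flat μ = y := by
  have hyf : y c.face = c.sign := hy.1
  have hy0 : ‖y‖ ≠ 0 := by
    rw [norm_ne_zero_iff]
    rintro rfl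
    exact sign_ne_zero (c := c) (by rw [← hyf]; rfl)
  have h1 : (μ : Space d) c.face = ‖y‖⁻¹ * c.sign := by
    rw [hμ, PiLp.smul_apply, smul_eq_mul, hyf]
  have hs := sign_ne_zero (c := c)
  rw [flat, h1, hμ, smul_smul]
  have : c.sign / (‖y‖⁻¹ * c.sign) * ‖y‖⁻¹ = 1 := by field_simp
  rw [this, one_smul]

/-- A description by strict inequalities between functions continuous on an open half-sphere, from
which openness of the curved elements follows. -/
theorem mem_curved_iff {μ : Dir d} : μ ∈ c.curved ↔ 0 < c.sign * (μ : Space d) c.face ∧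
    ∀ k, k ≠ c.face → c.lo k < c.flat μ k ∧ c.flat μ k < c.hi k := by
  constructor
  · rintro ⟨y, hy, hμ⟩
    rw [flat_eq hy hμ]
    refine ⟨?_, hy.2⟩
    have hyf : y c.face = c.sign := hy.1
    have hy0 : 0 < ‖y‖ := by
      rw [norm_pos_iff]
      rintro rfl
      exact sign_ne_zero (c := c) (by rw [← hyf]; rfl)
    rw [hμ, PiLp.smul_apply, smul_eq_mul, hyf]
    have := sign_ne_zero (c := c)
    have : 0 < c.sign * c.sign := mul_self_pos.2 this
    rw [mul_left_comm]
    positivity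
  · rintro ⟨h1, h2⟩
    have hf : (μ : Space d) c.face ≠ 0 := by rintro h; simp [h] at h1
    have hpos : 0 < c.sign / (μ : Space d) c.face := by
      have : c.sign / (μ : Space d) c.face
          = c.sign * (μ : Space d) c.face / ((μ : Space d) c.face) ^ 2 := by field_simp
      rw [this]; positivity
    refine ⟨c.flat μ, ⟨?_, h2⟩, ?_⟩
    · rw [flat, PiLp.smul_apply, smul_eq_mul, div_mul_cancel₀ _ hf]
    · rw [flat, norm_smul, norm_dir, mul_one, Real.norm_of_nonneg hpos.le, smul_smul,
        inv_mul_cancel₀ hpos.ne', one_smul]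

theorem continuous_coord (k : Fin d) : Continuous fun μ : Dir d => (μ : Space d) k :=
  (EuclideanSpace.proj k).continuous.comp continuous_subtype_val

theorem isOpen_half : IsOpen {μ : Dir d | 0 < c.sign * (μ : Space d) c.face} :=
  isOpen_lt continuous_const (continuous_const.mul (continuous_coord _))

theorem continuousOn_flat_coord (k : Fin d) :
    ContinuousOn (fun μ => c.flat μ k) {μ : Dir d | 0 < c.sign * (μ : Space d) c.face} := by
  have : ∀ μ : Dir d, c.flat μ k = c.sign / (μ : Space d) c.face * (μ : Space d) k := fun μ => by
    rw [flat, PiLp.smul_apply, smul_eq_mul]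
  simp only [this]
  refine ContinuousOn.mul (ContinuousOn.div continuousOn_const
    (continuous_coord _).continuousOn fun μ hμ h => ?_) (continuous_coord _).continuousOn
  have : 0 < c.sign * (μ : Space d) c.face := hμ
  simp [h] at this

theorem isOpen_curved : IsOpen c.curved := by
  have : c.curved = ⋂ k : Fin d, ({μ : Dir d | 0 < c.sign * (μ : Space d) c.face} ∩
      (fun μ => c.flat μ k) ⁻¹' {t | k ≠ c.face → t ∈ Ioo (c.lo k) (c.hi k)}) := by
    ext μ
    rw [mem_curved_iff]
    simp only [mem_iInter, mem_inter_iff, mem_ofPred_eq, mem_preimage, mem_Ioo]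
    exact ⟨fun h k => ⟨h.1, h.2 k⟩, fun h => ⟨(h c.face).1, fun k hk => (h k).2 hk⟩⟩
  rw [this]
  refine isOpen_iInter_of_finite fun k =>
    (continuousOn_flat_coord k).isOpen_inter_preimage isOpen_half ?_
  by_cases hk : k = c.face
  · simp [hk]
  · simpa [hk] using! isOpen_Ioo

theorem abs_flat_le {μ : Dir d} (hμ : μ ∈ c.curved) (k : Fin d) : |c.flat μ k| ≤ 1 := by
  obtain ⟨y, hy, hμy⟩ := hμ
  rw [flat_eq hy hμy]
  by_cases hk : k = c.face
  · have : y k = c.sign := by rw [hk]; exact hy.1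
    rw [this]
    rcases c.sign_eq with h | h <;> rw [h] <;> norm_num
  · have := hy.2 k hk
    exact abs_le.2 ⟨(c.lo_ge k hk).trans this.1.le, this.2.le.trans (c.hi_le k hk)⟩

theorem mem_inner_flat {μ : Dir d} (hμ : μ ∈ c.curved) :
    c.flat μ ∈ c.inner ∧ (μ : Space d) = ‖c.flat μ‖⁻¹ • c.flat μ := by
  obtain ⟨y, hy, hμy⟩ := hμ
  rw [flat_eq hy hμy]
  exact ⟨hy, hμy⟩

end CubeCell

/-! ### Regularity and finite dimension of the three factor spaces. -/

section Spaces

variable {d : ℕ}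

theorem angularSpace_regular {A : AngularMesh d} {q : ℕ} {ψ : Dir d → ℝ}
    (hψ : ψ ∈ angularSpace A q) :
    Measurable ψ ∧ (∃ C, ∀ μ, |ψ μ| ≤ C) ∧ ContinuousOn ψ (⋃ j, (A.cell j).curved) := by
  obtain ⟨hP, h0⟩ := hψ
  have key : ∀ j, ∃ P : MvPolynomial (Fin d) ℝ, ∀ μ ∈ (A.cell j).curved,
      ψ μ = MvPolynomial.eval (fun k => (A.cell j).flat μ k) P := fun j => by
    obtain ⟨P, -, h⟩ := hP j
    exact ⟨P, fun μ hμ => h _ (CubeCell.mem_inner_flat hμ).1 μ (CubeCell.mem_inner_flat hμ).2⟩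
  refine piecewise_regular (fun j => CubeCell.isOpen_curved) (fun j => ?_) (fun j => ?_) h0
  · obtain ⟨P, h⟩ := key j
    refine ContinuousOn.congr ?_ h
    refine (MvPolynomial.continuous_eval P).comp_continuousOn (continuousOn_pi.2 fun k => ?_)
    exact (CubeCell.continuousOn_flat_coord k).mono fun μ hμ => (CubeCell.mem_curved_iff.1 hμ).1
  · obtain ⟨P, h⟩ := key j
    obtain ⟨C, hC⟩ := (isCompact_Icc (a := fun _ : Fin d => (-1 : ℝ)) (b := fun _ => 1)).exists_bound_of_continuousOn
      (MvPolynomial.continuous_eval P).continuousOn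
    refine ⟨C, fun μ hμ => ?_⟩
    rw [h μ hμ]
    refine hC _ ⟨fun k => ?_, fun k => ?_⟩
    · exact (abs_le.1 (CubeCell.abs_flat_le hμ k)).1
    · exact (abs_le.1 (CubeCell.abs_flat_le hμ k)).2

theorem energySpace_regular {Emin Emax : ℝ} {G : EnergyMesh Emin Emax} {r : ℕ} {χ : ℝ → ℝ}
    (hχ : χ ∈ energySpace G r) :
    Measurable χ ∧ (∃ C, ∀ E, |χ E| ≤ C) ∧ ContinuousOn χ (⋃ g, G.group g) := by
  obtain ⟨hP, h0⟩ := hχ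
  refine piecewise_regular (fun g => isOpen_Ioo) (fun g => ?_) (fun g => ?_) h0
  · obtain ⟨P, -, h⟩ := hP g
    exact P.continuous.continuousOn.congr h
  · obtain ⟨P, -, h⟩ := hP g
    obtain ⟨C, hC⟩ := (isCompact_Icc (a := G.node g.succ)
      (b := G.node g.castSucc)).exists_bound_of_continuousOn P.continuous.continuousOn
    refine ⟨C, fun E hE => ?_⟩
    rw [h E hE]
    exact hC E (Ioo_subset_Icc_self hE)

theorem spatialSpace_analytic {Ω : Set (Space d)} {M : SpatialMesh Ω} {p : ℕ}
    {φ : Fin M.card → Space d → ℝ} (hφ : φ ∈ spatialSpace M p) (i : Fin M.card) :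
    AnalyticOnNhd ℝ (φ i) univ := by
  obtain ⟨P, -, h⟩ := hφ i
  have : φ i = fun x => MvPolynomial.eval (fun k => x k) P := funext h
  rw [this]
  have h2 := AnalyticOnNhd.eval_continuousLinearMap' (𝕜 := ℝ) (E := Space d) (B := ℝ)
    (fun k : Fin d => (EuclideanSpace.proj k : Space d →L[ℝ] ℝ)) P
  simpa only [PiLp.proj_apply] using h2

/-- The polynomials with degree at most `N` in each variable. -/
def polyBox (d N : ℕ) : Submodule ℝ (MvPolynomial (Fin d) ℝ) :=
  Submodule.span ℝ ((fun m => MvPolynomial.monomial m (1 : ℝ)) ''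
    (Iic (Finsupp.equivFunOnFinite.symm fun _ => N) : Set (Fin d →₀ ℕ)))

theorem polyBox_fg (d N : ℕ) : (polyBox d N).FG :=
  Submodule.fg_span ((Set.finite_Iic _).image _)

theorem mem_polyBox {N : ℕ} {P : MvPolynomial (Fin d) ℝ} (hP : ∀ k, P.degreeOf k ≤ N) :
    P ∈ polyBox d N := by
  rw [P.as_sum]
  refine Submodule.sum_mem _ fun m hm => ?_
  have : MvPolynomial.monomial m (P.coeff m) = P.coeff m • MvPolynomial.monomial m (1 : ℝ) := by
    rw [MvPolynomial.smul_monomial, smul_eq_mul, mul_one]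
  rw [this]
  refine Submodule.smul_mem _ _ (Submodule.subset_span ⟨m, ?_, rfl⟩)
  intro k
  exact (MvPolynomial.monomial_le_degreeOf k hm).trans (hP k)

/-- An upper bound is all that finite dimension of the span requires, so total degree at most p may
be relaxed to degree at most p in each variable. -/
theorem spatialSpace_subset_fg {Ω : Set (Space d)} (M : SpatialMesh Ω) (p : ℕ) :
    ∃ A : Submodule ℝ (Fin M.card → Space d → ℝ), A.FG ∧ spatialSpace M p ⊆ A := by
  let L : (Fin M.card → MvPolynomial (Fin d) ℝ) →ₗ[ℝ] (Fin M.card → Space d → ℝ) :=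
    { toFun := fun P i x => MvPolynomial.eval (fun k => x k) (P i)
      map_add' := fun P Q => by ext; simp
      map_smul' := fun c P => by ext; simp }
  refine ⟨(Submodule.pi univ fun _ => polyBox d p).map L,
    (Submodule.fg_pi fun _ => polyBox_fg d p).map L, fun v hv => ?_⟩
  choose P hP hv' using hv
  refine ⟨P, fun i _ => mem_polyBox fun k => (MvPolynomial.degreeOf_le_totalDegree _ _).trans (hP i),
    ?_⟩
  ext i x
  exact (hv' i x).symm

open Classical in
theorem angularSpace_subset_fg (A : AngularMesh d) (q : ℕ) :
    ∃ B : Submodule ℝ (Dir d → ℝ), B.FG ∧ angularSpace A q ⊆ B := by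
  let L : (Fin A.card → MvPolynomial (Fin d) ℝ) →ₗ[ℝ] (Dir d → ℝ) :=
    -- Any cell containing μ may be chosen, since a function of the angular space agrees with its
    -- polynomial on every such cell.
    { toFun := fun P μ => if h : ∃ j, μ ∈ (A.cell j).curved then
        MvPolynomial.eval (fun k => (A.cell h.choose).flat μ k) (P h.choose) else 0
      map_add' := fun P Q => by
        ext μ
        by_cases h : ∃ j, μ ∈ (A.cell j).curved <;> simp [h]
      map_smul' := fun c P => by
        ext μ
        by_cases h : ∃ j, μ ∈ (A.cell j).curved <;> simp [h] }
  refine ⟨(Submodule.pi univ fun _ => polyBox d q).map L,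
    (Submodule.fg_pi fun _ => polyBox_fg d q).map L, fun v hv => ?_⟩
  obtain ⟨hv, hv0⟩ := hv
  choose P hP hv' using hv
  refine ⟨P, fun i _ => mem_polyBox (hP i), ?_⟩
  ext μ
  by_cases h : ∃ j, μ ∈ (A.cell j).curved
  · have h1 := CubeCell.mem_inner_flat h.choose_spec
    rw [hv' h.choose _ h1.1 μ h1.2]
    exact dif_pos h
  · rw [hv0 μ (not_exists.1 h)]
    exact dif_neg h

open Classical in
theorem energySpace_subset_fg {Emin Emax : ℝ} (G : EnergyMesh Emin Emax) (r : ℕ) :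
    ∃ B : Submodule ℝ (ℝ → ℝ), B.FG ∧ energySpace G r ⊆ B := by
  let L : (Fin G.card → Polynomial ℝ) →ₗ[ℝ] (ℝ → ℝ) :=
    { toFun := fun P E => if h : ∃ g, E ∈ G.group g then (P h.choose).eval E else 0
      map_add' := fun P Q => by
        ext μ
        by_cases h : ∃ j, μ ∈ G.group j <;> simp [h]
      map_smul' := fun c P => by
        ext μ
        by_cases h : ∃ j, μ ∈ G.group j <;> simp [h] }
  have hfg : (Polynomial.degreeLE ℝ (r : WithBot ℕ)).FG :=
    ⟨_, Polynomial.degreeLE_eq_span_X_pow.symm⟩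
  refine ⟨(Submodule.pi univ fun _ => Polynomial.degreeLE ℝ r).map L,
    (Submodule.fg_pi fun _ => hfg).map L, fun v hv => ?_⟩
  obtain ⟨hv, hv0⟩ := hv
  choose P hP hv' using hv
  refine ⟨P, fun i _ => Polynomial.mem_degreeLE.2 (Polynomial.natDegree_le_iff_degree_le.1 (hP i)), ?_⟩
  ext E
  by_cases h : ∃ g, E ∈ G.group g
  · rw [hv' h.choose E h.choose_spec]
    exact dif_pos h
  · rw [hv0 E (not_exists.1 h)]
    exact dif_neg h

end Spaces

/-! ### The tensor-product space and the regularity of its members. -/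

namespace Discretisation

variable {d : ℕ} {D : TransportData d} (T : Discretisation D)

/-- The products φψχ lie in the image of finitely generated modules under two successive bilinear
multiplication maps. -/
instance finiteDimensional_feSpace : FiniteDimensional ℝ T.feSpace := by
  obtain ⟨A, hA, hA'⟩ := spatialSpace_subset_fg T.space T.p
  obtain ⟨B, hB, hB'⟩ := angularSpace_subset_fg T.angle T.q
  obtain ⟨C, hC, hC'⟩ := energySpace_subset_fg T.energy T.r
  let f : (Dir d → ℝ) →ₗ[ℝ] (ℝ → ℝ) →ₗ[ℝ] (Dir d → ℝ → ℝ) :=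
    LinearMap.mk₂ ℝ (fun ψ χ μ E => ψ μ * χ E) (fun _ _ _ => by ext; simp [add_mul])
      (fun _ _ _ => by ext; simp [mul_assoc]) (fun _ _ _ => by ext; simp [mul_add])
      (fun _ _ _ => by ext; simp [mul_left_comm])
  let g : (Fin T.space.card → Space d → ℝ) →ₗ[ℝ] (Dir d → ℝ → ℝ) →ₗ[ℝ] T.Broken :=
    LinearMap.mk₂ ℝ (fun φ η i x μ E => φ i x * η μ E) (fun _ _ _ => by ext; simp [add_mul])
      (fun _ _ _ => by ext; simp [mul_assoc]) (fun _ _ _ => by ext; simp [mul_add])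
      (fun _ _ _ => by ext; simp [mul_left_comm])
  have hfg := Submodule.FG.map₂ g hA (Submodule.FG.map₂ f hB hC)
  have : FiniteDimensional ℝ (Submodule.map₂ g A (Submodule.map₂ f B C)) :=
    Module.Finite.iff_fg.2 hfg
  refine Submodule.finiteDimensional_of_le (S₂ := Submodule.map₂ g A (Submodule.map₂ f B C)) ?_
  refine Submodule.span_le.2 ?_
  rintro _ ⟨φ, hφ, ψ, hψ, χ, hχ, rfl⟩
  have h := Submodule.apply_mem_map₂ g (hA' hφ)
    (Submodule.apply_mem_map₂ f (hB' hψ) (hC' hχ))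
  have he : (fun i x μ E => φ i x * ψ μ * χ E : T.Broken) = g φ (f ψ χ) := by
    ext i x μ E
    exact mul_assoc _ _ _
  rw [he]
  exact h

/-- The qualitative properties of finite element functions that the analysis uses. -/
structure IsRegular (v : T.Broken) : Prop where
  measurable : ∀ i, Measurable fun z : (ℝ × Dir d) × Space d => v i z.2 z.1.2 z.1.1
  measurable_deriv : ∀ i, Measurable fun z : (ℝ × Dir d) × Space d =>
    fderiv ℝ (fun y => v i y z.1.2 z.1.1) z.2 (z.1.2 : Space d)
  bounded : ∀ i R, ∃ C, ∀ x ∈ Metric.closedBall (0 : Space d) R, ∀ μ E, |v i x μ E| ≤ C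
  bounded_deriv : ∀ i R, ∃ C, ∀ x ∈ Metric.closedBall (0 : Space d) R, ∀ (μ : Dir d) E,
    |fderiv ℝ (fun y => v i y μ E) x (μ : Space d)| ≤ C
  analytic : ∀ i μ E, AnalyticOnNhd ℝ (fun x => v i x μ E) univ
  continuousOn : ∀ i x, ContinuousOn (fun z : ℝ × Dir d => v i x z.2 z.1)
    ((⋃ g, T.energy.group g) ×ˢ (⋃ j, (T.angle.cell j).curved))
  eq_zero : ∀ i x μ E,
    (E, μ) ∉ (⋃ g, T.energy.group g) ×ˢ (⋃ j, (T.angle.cell j).curved) → v i x μ E = 0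

variable {T}

theorem IsRegular.contDiff {v : T.Broken} (hv : T.IsRegular v) (i : Fin T.space.card) (μ : Dir d)
    (E : ℝ) : ContDiff ℝ 1 fun x => v i x μ E :=
  contDiffOn_univ.1 ((hv.analytic i μ E).contDiffOn uniqueDiffOn_univ)

theorem IsRegular.differentiableAt {v : T.Broken} (hv : T.IsRegular v) (i : Fin T.space.card)
    (μ : Dir d) (E : ℝ) (x : Space d) : DifferentiableAt ℝ (fun x => v i x μ E) x :=
  (hv.analytic i μ E x (mem_univ x)).differentiableAt

theorem IsRegular.zero : T.IsRegular 0 where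
  measurable i := measurable_const
  measurable_deriv i := by
    have : ∀ z : (ℝ × Dir d) × Space d, fderiv ℝ (fun y => (0 : T.Broken) i y z.1.2 z.1.1) z.2 = 0 :=
      fun z => fderiv_const_apply (0 : ℝ)
    simp only [this]
    exact measurable_const
  bounded i R := ⟨0, fun x _ μ E => by simp⟩
  bounded_deriv i R := ⟨0, fun x _ μ E => by
    have : fderiv ℝ (fun y => (0 : T.Broken) i y μ E) x = 0 := fderiv_const_apply (0 : ℝ)
    rw [this]; simp⟩
  analytic i μ E := analyticOnNhd_const
  continuousOn i x := continuousOn_const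
  eq_zero i x μ E _ := rfl

theorem IsRegular.fderiv_add {v w : T.Broken} (hv : T.IsRegular v) (hw : T.IsRegular w)
    (i : Fin T.space.card) (μ : Dir d) (E : ℝ) (x : Space d) :
    fderiv ℝ (fun y => (v + w) i y μ E) x
      = fderiv ℝ (fun y => v i y μ E) x + fderiv ℝ (fun y => w i y μ E) x :=
  _root_.fderiv_fun_add (hv.differentiableAt i μ E x) (hw.differentiableAt i μ E x)

theorem IsRegular.fderiv_smul {v : T.Broken} (hv : T.IsRegular v) (c : ℝ)
    (i : Fin T.space.card) (μ : Dir d) (E : ℝ) (x : Space d) :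
    fderiv ℝ (fun y => (c • v) i y μ E) x = c • fderiv ℝ (fun y => v i y μ E) x :=
  _root_.fderiv_fun_const_smul (hv.differentiableAt i μ E x) c

theorem IsRegular.add {v w : T.Broken} (hv : T.IsRegular v) (hw : T.IsRegular w) :
    T.IsRegular (v + w) where
  measurable i := (hv.measurable i).add (hw.measurable i)
  measurable_deriv i := by
    simp only [hv.fderiv_add hw]
    exact (hv.measurable_deriv i).add (hw.measurable_deriv i)
  bounded i R := by
    obtain ⟨C, hC⟩ := hv.bounded i R
    obtain ⟨C', hC'⟩ := hw.bounded i R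
    exact ⟨C + C', fun x hx μ E => (abs_add_le _ _).trans (add_le_add (hC x hx μ E) (hC' x hx μ E))⟩
  bounded_deriv i R := by
    obtain ⟨C, hC⟩ := hv.bounded_deriv i R
    obtain ⟨C', hC'⟩ := hw.bounded_deriv i R
    refine ⟨C + C', fun x hx μ E => ?_⟩
    rw [hv.fderiv_add hw]
    exact (abs_add_le _ _).trans (add_le_add (hC x hx μ E) (hC' x hx μ E))
  analytic i μ E := (hv.analytic i μ E).add (hw.analytic i μ E)
  continuousOn i x := (hv.continuousOn i x).add (hw.continuousOn i x)
  eq_zero i x μ E h := by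
    change v i x μ E + w i x μ E = 0
    rw [hv.eq_zero i x μ E h, hw.eq_zero i x μ E h, add_zero]

theorem IsRegular.smul {v : T.Broken} (hv : T.IsRegular v) (c : ℝ) : T.IsRegular (c • v) where
  measurable i := (hv.measurable i).const_smul c
  measurable_deriv i := by
    simp only [hv.fderiv_smul]
    exact (hv.measurable_deriv i).const_smul c
  bounded i R := by
    obtain ⟨C, hC⟩ := hv.bounded i R
    refine ⟨|c| * C, fun x hx μ E => ?_⟩
    change |c * v i x μ E| ≤ _
    rw [abs_mul]
    exact mul_le_mul_of_nonneg_left (hC x hx μ E) (abs_nonneg c)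
  bounded_deriv i R := by
    obtain ⟨C, hC⟩ := hv.bounded_deriv i R
    refine ⟨|c| * C, fun x hx μ E => ?_⟩
    rw [hv.fderiv_smul]
    change |c * fderiv ℝ (fun y => v i y μ E) x (μ : Space d)| ≤ _
    rw [abs_mul]
    exact mul_le_mul_of_nonneg_left (hC x hx μ E) (abs_nonneg c)
  analytic i μ E := (hv.analytic i μ E).const_smul (c := c)
  continuousOn i x := (hv.continuousOn i x).const_smul c
  eq_zero i x μ E h := by
    change c * v i x μ E = 0
    rw [hv.eq_zero i x μ E h, mul_zero]

/-- All properties are stable under linear combinations, so they are checked on products φψχ, where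
only φ carries the dependence on x. -/
theorem isRegular_of_mem {v : T.Broken} (hv : v ∈ T.feSpace) : T.IsRegular v := by
  induction hv using Submodule.span_induction with
  | zero => exact IsRegular.zero
  | add v w _ _ hv hw => exact hv.add hw
  | smul c v _ hv => exact hv.smul c
  | mem v hv =>
    obtain ⟨φ, hφ, ψ, hψ, χ, hχ, rfl⟩ := hv
    have hφa := spatialSpace_analytic hφ
    have hφc : ∀ i, ContDiff ℝ 1 (φ i) := fun i => contDiffOn_univ.1 ((hφa i).contDiffOn uniqueDiffOn_univ)
    obtain ⟨hψm, ⟨Cψ, hψb⟩, hψc⟩ := angularSpace_regular hψ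
    obtain ⟨hχm, ⟨Cχ, hχb⟩, hχc⟩ := energySpace_regular hχ
    have hCψ : ∀ μ : Dir d, 0 ≤ Cψ := fun μ => (abs_nonneg _).trans (hψb μ)
    have hder : ∀ i x μ E, fderiv ℝ (fun y => φ i y * ψ μ * χ E) x = (ψ μ * χ E) • fderiv ℝ (φ i) x := by
      intro i x μ E
      have : (fun y => φ i y * ψ μ * χ E) = fun y => (ψ μ * χ E) • φ i y := by
        ext y; rw [smul_eq_mul]; ring
      rw [this]
      exact fderiv_fun_const_smul ((hφc i).differentiable one_ne_zero x) _
    have hdc : ∀ i, Continuous fun z : Space d × Dir d => fderiv ℝ (φ i) z.1 (z.2 : Space d) :=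
      fun i => (((hφc i).continuous_fderiv one_ne_zero).comp continuous_fst).clm_apply
        (continuous_subtype_val.comp continuous_snd)
    refine ⟨fun i => ?_, fun i => ?_, fun i R => ?_, fun i R => ?_, fun i μ E => ?_, fun i x => ?_,
      fun i x μ E h => ?_⟩
    · have := (hφc i).continuous.measurable
      fun_prop
    · simp only [hder]
      have h1 : Measurable fun z : (ℝ × Dir d) × Space d => ψ z.1.2 * χ z.1.1 := by fun_prop
      exact h1.mul ((hdc i).measurable.comp
        (by fun_prop : Measurable fun z : (ℝ × Dir d) × Space d => (z.2, z.1.2)))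
    · obtain ⟨C, hC⟩ := (isCompact_closedBall (0 : Space d) R).exists_bound_of_continuousOn
        (hφc i).continuous.continuousOn
      refine ⟨C * Cψ * Cχ, fun x hx μ E => ?_⟩
      have := hC x hx
      have := hψb μ
      have := hχb E
      have := hCψ μ
      have := (norm_nonneg _).trans (hC x hx)
      rw [abs_mul, abs_mul]
      gcongr
      exact hC x hx
    · obtain ⟨C, hC⟩ := ((isCompact_closedBall (0 : Space d) R).prod
        (isCompact_univ (X := Dir d))).exists_bound_of_continuousOn (hdc i).continuousOn
      refine ⟨Cψ * Cχ * C, fun x hx μ E => ?_⟩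
      rw [hder]
      change |ψ μ * χ E * fderiv ℝ (φ i) x (μ : Space d)| ≤ _
      have := hC (x, μ) ⟨hx, mem_univ _⟩
      have := hψb μ
      have := hχb E
      have := hCψ μ
      have := (abs_nonneg _).trans (hχb E)
      rw [abs_mul, abs_mul]
      gcongr
      assumption
    · exact ((hφa i).mul analyticOnNhd_const).mul analyticOnNhd_const
    · exact (continuousOn_const.mul (hψc.comp continuousOn_snd fun z hz => hz.2)).mul
        (hχc.comp continuousOn_fst fun z hz => hz.1)
    · by_cases hE : E ∈ ⋃ g, T.energy.group g
      · have hμ : ∀ j, μ ∉ (T.angle.cell j).curved := fun j hj => h ⟨hE, mem_iUnion.2 ⟨j, hj⟩⟩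
        change φ i x * ψ μ * χ E = 0
        rw [hψ.2 μ hμ, mul_zero, zero_mul]
      · have hE' : ∀ g, E ∉ T.energy.group g := fun g hg => hE (mem_iUnion.2 ⟨g, hg⟩)
        change φ i x * ψ μ * χ E = 0
        rw [hχ.2 E hE', mul_zero]

end Discretisation

/-! ### Integral forms -/

section WeightedForms

variable {Z V : Type*} [MeasurableSpace Z] [AddCommGroup V] [Module ℝ V] {m : Measure Z}

theorem integrable_mul_mul {c f g : Z → ℝ} (hc : Integrable c m) (hf : MemLp f ⊤ m)
    (hg : MemLp g ⊤ m) : Integrable (fun z => c z * f z * g z) m :=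
  (hc.mul_of_top_left hf).mul_of_top_left hg

/-- The bilinear form `∫ c · L w · R v` with an integrable weight `c` and bounded `L w`, `R v`. -/
def weightedForm {c : Z → ℝ} (hc : Integrable c m) {L R : V →ₗ[ℝ] (Z → ℝ)}
    (hL : ∀ v, MemLp (L v) ⊤ m) (hR : ∀ v, MemLp (R v) ⊤ m) : V →ₗ[ℝ] V →ₗ[ℝ] ℝ :=
  LinearMap.mk₂ ℝ (fun w v => ∫ z, c z * L w z * R v z ∂m)
    (fun w w' v => by
      rw [← integral_add (integrable_mul_mul hc (hL w) (hR v))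
        (integrable_mul_mul hc (hL w') (hR v))]
      congr 1; ext z; simp only [map_add, Pi.add_apply]; ring)
    (fun a w v => by
      rw [smul_eq_mul, ← integral_const_mul]
      congr 1; ext z; simp only [map_smul, Pi.smul_apply, smul_eq_mul]; ring)
    (fun w v v' => by
      rw [← integral_add (integrable_mul_mul hc (hL w) (hR v))
        (integrable_mul_mul hc (hL w) (hR v'))]
      congr 1; ext z; simp only [map_add, Pi.add_apply]; ring)
    (fun a w v => by
      rw [smul_eq_mul, ← integral_const_mul]
      congr 1; ext z; simp only [map_smul, Pi.smul_apply, smul_eq_mul]; ring)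

theorem weightedForm_apply {c : Z → ℝ} (hc : Integrable c m) {L R : V →ₗ[ℝ] (Z → ℝ)}
    (hL : ∀ v, MemLp (L v) ⊤ m) (hR : ∀ v, MemLp (R v) ⊤ m) (w v : V) :
    weightedForm hc hL hR w v = ∫ z, c z * L w z * R v z ∂m := rfl

/-- The functional `∫ c · R v` with an integrable weight `c` and bounded `R v`. -/
def weightedFunctional {c : Z → ℝ} (hc : Integrable c m) {R : V →ₗ[ℝ] (Z → ℝ)}
    (hR : ∀ v, MemLp (R v) ⊤ m) : V →ₗ[ℝ] ℝ where
  toFun v := ∫ z, c z * R v z ∂m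
  map_add' v v' := by
    have h := integral_add (hc.mul_of_top_left (hR v)) (hc.mul_of_top_left (hR v'))
    simp only [Pi.mul_apply] at h
    simp only [map_add, Pi.add_apply, mul_add, h]
  map_smul' a v := by
    rw [RingHom.id_apply, smul_eq_mul, ← integral_const_mul]
    congr 1; ext z; simp only [map_smul, Pi.smul_apply, smul_eq_mul]; ring

end WeightedForms

instance isFiniteMeasure_dirMeasure (d : ℕ) : IsFiniteMeasure (dirMeasure d) := by
  unfold dirMeasure; infer_instance

/-! ### The measure on energies and directions, and integrability of the cross-sections. -/

namespace TransportData

variable {d : ℕ} (D : TransportData d)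

/-- The product measure on the space of energies and directions. -/
def angEnergy : Measure (ℝ × Dir d) := (volume.restrict D.energies).prod (dirMeasure d)

instance isFiniteMeasure_energies : IsFiniteMeasure (volume.restrict D.energies) := by
  unfold energies; infer_instance

instance isFiniteMeasure_angEnergy : IsFiniteMeasure D.angEnergy := by
  unfold angEnergy; infer_instance

instance isFiniteMeasure_domain : IsFiniteMeasure (volume.restrict D.Ω) :=
  ⟨by simpa using D.domain.isBounded.measure_lt_top⟩

theorem integral_angEnergy {F : ℝ × Dir d → ℝ} (hF : Integrable F D.angEnergy) :
    ∫ E in D.energies, ∫ μ, F (E, μ) ∂(dirMeasure d) = ∫ z, F z ∂D.angEnergy :=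
  (integral_prod _ hF).symm

theorem ae_mem_energies : ∀ᵐ z ∂D.angEnergy, z.1 ∈ D.energies :=
  Measure.quasiMeasurePreserving_fst.ae (ae_restrict_mem measurableSet_Icc)

theorem integrable_reorder {ρ : Measure (Space d)} [SFinite ρ] {F : Space d × Dir d × ℝ → ℝ}
    (hF : Integrable F (ρ.prod ((dirMeasure d).prod (volume.restrict (Icc D.Emin D.Emax))))) :
    Integrable (fun z : (ℝ × Dir d) × Space d => F (z.2, z.1.2, z.1.1)) (D.angEnergy.prod ρ) := by
  have h1 : MeasurePreserving (Prod.swap : (ℝ × Dir d) × Space d → _) (D.angEnergy.prod ρ)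
      (ρ.prod D.angEnergy) := Measure.measurePreserving_swap
  have h2 : MeasurePreserving (Prod.swap : ℝ × Dir d → _) D.angEnergy
      ((dirMeasure d).prod (volume.restrict (Icc D.Emin D.Emax))) := Measure.measurePreserving_swap
  exact (((MeasurePreserving.id ρ).prod h2).comp h1).integrable_comp_of_integrable hF

/-- The total cross-section `α + β`. -/
def total (z : (ℝ × Dir d) × Space d) : ℝ := D.α z.2 z.1.1 + D.β z.2 z.1.2 z.1.1

theorem integrable_of_integrable_indep {ρ : Measure (Space d)} [SFinite ρ]
    {F : Space d × ℝ → ℝ} (hF : Integrable F (ρ.prod (volume.restrict D.energies))) :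
    Integrable (fun z : (ℝ × Dir d) × Space d => F (z.2, z.1.1)) (D.angEnergy.prod ρ) := by
  have h1 : MeasurePreserving (Prod.swap : (ℝ × Dir d) × Space d → _) (D.angEnergy.prod ρ)
      (ρ.prod D.angEnergy) := Measure.measurePreserving_swap
  have h2 := (measurePreserving_prodAssoc ρ (volume.restrict D.energies) (dirMeasure d)).symm
  have h3 := (h2.comp h1).integrable_comp_of_integrable
    (hF.mul_prod (integrable_const (1 : ℝ)))
  refine h3.congr (Eventually.of_forall fun z => ?_)
  exact mul_one _

theorem integrable_β : Integrable (fun z : (ℝ × Dir d) × Space d => D.β z.2 z.1.2 z.1.1)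
    (D.angEnergy.prod (volume.restrict D.Ω)) := by
  -- Integrability of β is assumed for a fixed direction; since β does not depend on the direction,
  -- one μ₀ serves for all, provided there is one.
  rcases isEmpty_or_nonempty (Dir d) with h | ⟨⟨μ₀⟩⟩
  · rw [Measure.eq_zero_of_isEmpty (D.angEnergy.prod _)]
    exact integrable_zero_measure
  · have h1 := D.integrable_of_integrable_indep (D.β_integrable μ₀)
    refine h1.congr (Eventually.of_forall fun z => ?_)
    exact scatterOut_eq _ _ _ _ _ _ _

theorem integrable_total : Integrable D.total (D.angEnergy.prod (volume.restrict D.Ω)) :=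
  (D.integrable_of_integrable_indep D.α_integrable).add D.integrable_β

theorem inner_mem (μ ν : Dir d) : ⟪(μ : Space d), (ν : Space d)⟫ ∈ Icc (-1 : ℝ) 1 := by
  have := abs_real_inner_le_norm (μ : Space d) ν
  rw [norm_dir, norm_dir, one_mul] at this
  exact abs_le.1 this

theorem β_nonneg {x : Space d} (hx : x ∈ D.Ω) (μ : Dir d) {E : ℝ} (hE : E ∈ D.energies) :
    0 ≤ D.β x μ E :=
  setIntegral_nonneg measurableSet_Icc fun _ hE' => integral_nonneg fun _ =>
    D.θ_nonneg x hx _ (inner_mem _ _) _ hE _ hE'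

theorem γ_nonneg {x : Space d} (hx : x ∈ D.Ω) (μ : Dir d) {E : ℝ} (hE : E ∈ D.energies) :
    0 ≤ D.γ x μ E :=
  setIntegral_nonneg measurableSet_Icc fun _ hE' => integral_nonneg fun _ =>
    D.θ_nonneg x hx _ (inner_mem _ _) _ hE' _ hE

/-- The lower bound on α + (β − γ)/2 gives γ ≤ 2α + β. The crude factor 2 only shows that the set
defining `qγ` is bounded above; the real supremum of an unbounded set would be the default value 0.
-/
theorem γ_le {x : Space d} (hx : x ∈ D.Ω) (μ : Dir d) {E : ℝ} (hE : E ∈ D.energies) :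
    D.γ x μ E ≤ 2 * (D.α x E + D.β x μ E) := by
  obtain ⟨α₀, hα₀, h⟩ := D.alphaBar_lower
  have h1 := h x hx μ E hE
  have h2 := D.β_nonneg hx μ hE
  change α₀ ≤ D.α x E + 1 / 2 * (D.β x μ E - D.γ x μ E) at h1
  linarith

/-- The same bound reads α + β ≥ α₀ + (β + γ)/2. -/
theorem total_pos {x : Space d} (hx : x ∈ D.Ω) (μ : Dir d) {E : ℝ} (hE : E ∈ D.energies) :
    0 < D.α x E + D.β x μ E := by
  obtain ⟨α₀, hα₀, h⟩ := D.alphaBar_lower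
  have h1 := h x hx μ E hE
  have h2 := D.β_nonneg hx μ hE
  have h3 := D.γ_nonneg hx μ hE
  change α₀ ≤ D.α x E + 1 / 2 * (D.β x μ E - D.γ x μ E) at h1
  linarith

end TransportData

instance SpatialMesh.isFiniteMeasure_frontier {d : ℕ} {Ω : Set (Space d)} (M : SpatialMesh Ω)
    (i : Fin M.card) : IsFiniteMeasure ((surf d).restrict (frontier (M.elem i))) :=
  ⟨by simpa using M.finite_area i⟩

theorem SpatialMesh.frontier_subset {d : ℕ} {Ω : Set (Space d)} (hΩ : IsOpen Ω) (M : SpatialMesh Ω) :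
    frontier Ω ⊆ ⋃ i, frontier (M.elem i) := by
  intro x hx
  have : x ∈ closure Ω := frontier_subset_closure hx
  rw [M.cover] at this
  obtain ⟨i, hi⟩ := mem_iUnion.1 this
  refine mem_iUnion.2 ⟨i, ?_⟩
  rw [(M.isOpen i).frontier_eq]
  rw [hΩ.frontier_eq] at hx
  exact ⟨hi, fun h => hx.2 (M.subset i h)⟩

namespace Discretisation

variable {d : ℕ} {D : TransportData d} (T : Discretisation D)

instance isFiniteMeasure_elem (i : Fin T.space.card) :
    IsFiniteMeasure (volume.restrict (T.space.elem i)) :=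
  ⟨by simpa using (T.space.isBounded D.domain.isBounded i).measure_lt_top⟩

theorem isFiniteMeasure_frontier_domain {D : TransportData d} (M : SpatialMesh D.Ω) :
    IsFiniteMeasure ((surf d).restrict (frontier D.Ω)) := by
  refine ⟨?_⟩
  rw [Measure.restrict_apply_univ]
  refine (measure_mono (M.frontier_subset D.domain.isOpen)).trans_lt ?_
  exact (measure_iUnion_fintype_le _ _).trans_lt
    (ENNReal.sum_lt_top.2 fun i _ => M.finite_area i)

theorem frontier_elem_subset (i : Fin T.space.card) :
    frontier (T.space.elem i) ⊆ closure D.Ω :=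
  frontier_subset_closure.trans (closure_mono (T.space.subset i))

theorem elem_subset_closure (i : Fin T.space.card) : T.space.elem i ⊆ closure D.Ω :=
  (T.space.subset i).trans subset_closure

theorem exists_closure_subset_closedBall (D : TransportData d) :
    ∃ R, closure D.Ω ⊆ Metric.closedBall (0 : Space d) R := by
  obtain ⟨R, hR⟩ := D.domain.isBounded.closure.subset_closedBall (0 : Space d)
  exact ⟨R, hR⟩

variable {T}

theorem ae_snd_mem (ρ : Measure (Space d)) {s : Set (Space d)} [SFinite (ρ.restrict s)]
    (hs : MeasurableSet s) : ∀ᵐ z ∂(D.angEnergy.prod (ρ.restrict s)), z.2 ∈ s :=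
  Measure.quasiMeasurePreserving_snd.ae (ae_restrict_mem hs)

theorem IsRegular.memLp {v : T.Broken} (hv : T.IsRegular v) (i : Fin T.space.card)
    {ρ : Measure (Space d)} {s : Set (Space d)} [SFinite (ρ.restrict s)] (hs : MeasurableSet s)
    (hsΩ : s ⊆ closure D.Ω) :
    MemLp (fun z : (ℝ × Dir d) × Space d => v i z.2 z.1.2 z.1.1) ⊤
      (D.angEnergy.prod (ρ.restrict s)) := by
  obtain ⟨R, hR⟩ := exists_closure_subset_closedBall D
  obtain ⟨C, hC⟩ := hv.bounded i R
  refine memLp_top_of_bound (hv.measurable i).aestronglyMeasurable C ?_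
  filter_upwards [ae_snd_mem ρ hs] with z hz
  exact hC _ (hR (hsΩ hz)) _ _

theorem IsRegular.memLp_deriv {v : T.Broken} (hv : T.IsRegular v) (i : Fin T.space.card)
    {ρ : Measure (Space d)} {s : Set (Space d)} [SFinite (ρ.restrict s)] (hs : MeasurableSet s)
    (hsΩ : s ⊆ closure D.Ω) :
    MemLp (fun z : (ℝ × Dir d) × Space d =>
      fderiv ℝ (fun y => v i y z.1.2 z.1.1) z.2 (z.1.2 : Space d)) ⊤
      (D.angEnergy.prod (ρ.restrict s)) := by
  obtain ⟨R, hR⟩ := exists_closure_subset_closedBall D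
  obtain ⟨C, hC⟩ := hv.bounded_deriv i R
  refine memLp_top_of_bound (hv.measurable_deriv i).aestronglyMeasurable C ?_
  filter_upwards [ae_snd_mem ρ hs] with z hz
  exact hC _ (hR (hsΩ hz)) _ _

open Classical in
theorem memLp_ite {m : Measure ((ℝ × Dir d) × Space d)} {g : (ℝ × Dir d) × Space d → ℝ}
    (hg : MemLp g ⊤ m) {s : Set (Space d)} (hs : MeasurableSet s) (p : Prop) :
    MemLp (fun z => if p ∧ z.2 ∈ s then g z else 0) ⊤ m := by
  by_cases hp : p
  · simp only [hp, true_and]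
    exact hg.indicator (measurable_snd hs)
  · simp only [hp, false_and, if_false]
    exact MemLp.zero'

theorem IsRegular.memLp_ext {v : T.Broken} (hv : T.IsRegular v) (i : Fin T.space.card)
    {ρ : Measure (Space d)} {s : Set (Space d)} [SFinite (ρ.restrict s)] (hs : MeasurableSet s)
    (hsΩ : s ⊆ closure D.Ω) :
    MemLp (fun z : (ℝ × Dir d) × Space d => T.ext v i z.2 z.1.2 z.1.1) ⊤
      (D.angEnergy.prod (ρ.restrict s)) :=
  memLp_finsetSum _ fun k _ => by
    convert memLp_ite (hv.memLp (ρ := ρ) k hs hsΩ)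
      (measurableSet_closure (s := T.space.elem k)) (k ≠ i)

theorem IsRegular.memLp_glue {v : T.Broken} (hv : T.IsRegular v)
    {ρ : Measure (Space d)} {s : Set (Space d)} [SFinite (ρ.restrict s)] (hs : MeasurableSet s)
    (hsΩ : s ⊆ closure D.Ω) :
    MemLp (fun z : (ℝ × Dir d) × Space d => T.glue v z.2 z.1.2 z.1.1) ⊤
      (D.angEnergy.prod (ρ.restrict s)) := by
  refine memLp_finsetSum _ fun k _ => ?_
  exact (hv.memLp (ρ := ρ) k hs hsΩ).indicator (measurable_snd (T.space.isOpen k).measurableSet)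

variable (T)

/-- The values on element `i`. -/
def traceMap (i : Fin T.space.card) : T.feSpace →ₗ[ℝ] ((ℝ × Dir d) × Space d → ℝ) where
  toFun v z := (v : T.Broken) i z.2 z.1.2 z.1.1
  map_add' _ _ := rfl
  map_smul' _ _ := rfl

/-- The streaming derivative on element `i`. -/
def derivMap (i : Fin T.space.card) : T.feSpace →ₗ[ℝ] ((ℝ × Dir d) × Space d → ℝ) where
  toFun v z := fderiv ℝ (fun y => (v : T.Broken) i y z.1.2 z.1.1) z.2 (z.1.2 : Space d)
  map_add' v w := funext fun z => by
    rw [Submodule.coe_add, (isRegular_of_mem v.2).fderiv_add (isRegular_of_mem w.2)]; rfl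
  map_smul' c v := funext fun z => by
    rw [Submodule.coe_smul, (isRegular_of_mem v.2).fderiv_smul]; rfl

/-- The exterior trace. -/
def extMap (i : Fin T.space.card) : T.feSpace →ₗ[ℝ] ((ℝ × Dir d) × Space d → ℝ) where
  toFun v z := T.ext v i z.2 z.1.2 z.1.1
  map_add' v w := funext fun z => by
    simp only [ext, Pi.add_apply, ← Finset.sum_add_distrib]
    refine Finset.sum_congr rfl fun k _ => ?_
    split_ifs
    · rfl
    · simp
  map_smul' c v := funext fun z => by
    simp only [ext, Pi.smul_apply, Finset.smul_sum]
    refine Finset.sum_congr rfl fun k _ => ?_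
    split_ifs
    · rfl
    · simp

/-- The function represented by a broken function. -/
def glueMap : T.feSpace →ₗ[ℝ] ((ℝ × Dir d) × Space d → ℝ) where
  toFun v z := T.glue v z.2 z.1.2 z.1.1
  map_add' v w := funext fun z => by
    simp only [glue, Pi.add_apply, ← Finset.sum_add_distrib]
    refine Finset.sum_congr rfl fun k _ => ?_
    split_ifs
    · rfl
    · simp
  map_smul' c v := funext fun z => by
    simp only [glue, Pi.smul_apply, Finset.smul_sum]
    refine Finset.sum_congr rfl fun k _ => ?_
    split_ifs
    · rfl
    · simp

/-- The measure of (energy, direction, position) on an element. -/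
abbrev bulk (i : Fin T.space.card) : Measure ((ℝ × Dir d) × Space d) :=
  D.angEnergy.prod (volume.restrict (T.space.elem i))

/-- The measure of (energy, direction, position) on the boundary of an element. -/
abbrev skel (i : Fin T.space.card) : Measure ((ℝ × Dir d) × Space d) :=
  D.angEnergy.prod ((surf d).restrict (frontier (T.space.elem i)))

theorem bulk_le (i : Fin T.space.card) : T.bulk i ≤ D.angEnergy.prod (volume.restrict D.Ω) := by
  have h : ∀ s : Set (Space d), D.angEnergy.prod (volume.restrict s)
      = (D.angEnergy.prod volume).restrict (univ ×ˢ s) := fun s => by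
    rw [← Measure.prod_restrict, Measure.restrict_univ]
  rw [bulk, h, h]
  exact Measure.restrict_mono (prod_mono le_rfl (T.space.subset i)) le_rfl

theorem integrable_total (i : Fin T.space.card) : Integrable D.total (T.bulk i) :=
  D.integrable_total.mono_measure (T.bulk_le i)

variable {T} in
theorem IsRegular.memLp_bulk {v : T.Broken} (hv : T.IsRegular v) (i : Fin T.space.card) :
    MemLp (fun z : (ℝ × Dir d) × Space d => v i z.2 z.1.2 z.1.1) ⊤ (T.bulk i) :=
  hv.memLp i (T.space.isOpen i).measurableSet (T.elem_subset_closure i)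

variable {T} in
theorem IsRegular.memLp_skel {v : T.Broken} (hv : T.IsRegular v) (i : Fin T.space.card) :
    MemLp (fun z : (ℝ × Dir d) × Space d => v i z.2 z.1.2 z.1.1) ⊤ (T.skel i) :=
  hv.memLp i isClosed_frontier.measurableSet (T.frontier_elem_subset i)

variable {T} in
theorem IsRegular.memLp_ext_skel {v : T.Broken} (hv : T.IsRegular v) (i : Fin T.space.card) :
    MemLp (fun z : (ℝ × Dir d) × Space d => T.ext v i z.2 z.1.2 z.1.1) ⊤ (T.skel i) :=
  hv.memLp_ext i isClosed_frontier.measurableSet (T.frontier_elem_subset i)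

theorem weight_nonneg (i : Fin T.space.card) (x : Space d) (μ : Dir d) : 0 ≤ T.weight i x μ :=
  abs_nonneg _

theorem weight_le_one (i : Fin T.space.card) (x : Space d) (μ : Dir d) : T.weight i x μ ≤ 1 := by
  refine (abs_real_inner_le_norm _ _).trans ?_
  rw [norm_dir, one_mul]
  exact norm_normal_le _ _

/-- The weight `|μ·n|` on the part `s μ` of the boundary of element `i`. -/
def weightOn (i : Fin T.space.card) (s : Dir d → Set (Space d)) (z : (ℝ × Dir d) × Space d) : ℝ :=
  (s z.1.2).indicator (fun x => T.weight i x z.1.2) z.2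

theorem measurable_inner_normal (i : Fin T.space.card) :
    Measurable fun z : (ℝ × Dir d) × Space d =>
      ⟪(z.1.2 : Space d), normal (T.space.elem i) z.2⟫ := by
  have h1 := (measurable_normal (T.space.elem i)).comp
    (measurable_snd : Measurable (Prod.snd : (ℝ × Dir d) × Space d → Space d))
  have h2 : Measurable fun z : (ℝ × Dir d) × Space d => (z.1.2 : Space d) :=
    measurable_subtype_coe.comp (measurable_snd.comp measurable_fst)
  exact h2.inner h1

theorem measurable_weightOn (i : Fin T.space.card) {s : Dir d → Set (Space d)}
    (hs : MeasurableSet {z : (ℝ × Dir d) × Space d | z.2 ∈ s z.1.2}) :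
    Measurable (T.weightOn i s) := by
  classical
  have : T.weightOn i s = {z : (ℝ × Dir d) × Space d | z.2 ∈ s z.1.2}.indicator
      (fun z => T.weight i z.2 z.1.2) := by
    ext z
    simp only [weightOn, indicator_apply]
    rfl
  rw [this]
  exact Measurable.indicator (T.measurable_inner_normal i).norm hs

theorem abs_weightOn_le (i : Fin T.space.card) (s : Dir d → Set (Space d))
    (z : (ℝ × Dir d) × Space d) : |T.weightOn i s z| ≤ 1 := by
  classical
  rw [weightOn, indicator_apply]
  split_ifs
  · rw [abs_of_nonneg (T.weight_nonneg _ _ _)]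
    exact T.weight_le_one _ _ _
  · simp

theorem integrable_weightOn (i : Fin T.space.card) {s : Dir d → Set (Space d)}
    (hs : MeasurableSet {z : (ℝ × Dir d) × Space d | z.2 ∈ s z.1.2}) :
    Integrable (T.weightOn i s) (T.skel i) :=
  Integrable.of_bound (T.measurable_weightOn i hs).aestronglyMeasurable 1
    (Eventually.of_forall (T.abs_weightOn_le i s))

/-- The inflow and outflow sets move with μ. Putting their indicators into the weight fixes the
domain of integration, so that Fubini can be used on one product space. -/
theorem setIntegral_weight (i : Fin T.space.card) {s : Dir d → Set (Space d)} {μ : Dir d} (E : ℝ)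
    (hsm : MeasurableSet (s μ)) (hs : s μ ⊆ frontier (T.space.elem i)) (F : Space d → ℝ) :
    ∫ x in s μ, T.weight i x μ * F x ∂(surf d)
      = ∫ x in frontier (T.space.elem i), T.weightOn i s ((E, μ), x) * F x ∂(surf d) := by
  classical
  have : ∀ x, T.weightOn i s ((E, μ), x) * F x
      = (s μ).indicator (fun x => T.weight i x μ * F x) x := fun x => by
    simp only [weightOn, indicator_apply]
    split_ifs <;> simp
  simp only [this]
  rw [setIntegral_indicator hsm, inter_eq_self_of_subset_right hs]

theorem outflow_subset (i : Fin T.space.card) (μ : Dir d) :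
    outflow (T.space.elem i) μ ⊆ frontier (T.space.elem i) := fun _ h => h.1.1

theorem inflow_subset (i : Fin T.space.card) (μ : Dir d) :
    inflow (T.space.elem i) μ ⊆ frontier (T.space.elem i) := fun _ h => h.1.1

theorem measurableSet_outflow_graph (i : Fin T.space.card) :
    MeasurableSet {z : (ℝ × Dir d) × Space d | z.2 ∈ outflow (T.space.elem i) z.1.2} := by
  have h1 : MeasurableSet {z : (ℝ × Dir d) × Space d |
      0 ≤ ⟪(z.1.2 : Space d), normal (T.space.elem i) z.2⟫} :=
    measurableSet_le measurable_const (T.measurable_inner_normal i)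
  exact (measurable_snd (measurableSet_faces _)).inter h1

theorem measurableSet_inflow_graph (i : Fin T.space.card) :
    MeasurableSet {z : (ℝ × Dir d) × Space d | z.2 ∈ inflow (T.space.elem i) z.1.2} := by
  have h1 : MeasurableSet {z : (ℝ × Dir d) × Space d |
      ⟪(z.1.2 : Space d), normal (T.space.elem i) z.2⟫ < 0} :=
    measurableSet_lt (T.measurable_inner_normal i) measurable_const
  exact (measurable_snd (measurableSet_faces _)).inter h1

theorem measurableSet_inflow_diff_graph (i : Fin T.space.card) :
    MeasurableSet {z : (ℝ × Dir d) × Space d |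
      z.2 ∈ inflow (T.space.elem i) z.1.2 \ frontier D.Ω} :=
  (T.measurableSet_inflow_graph i).diff (measurable_snd isClosed_frontier.measurableSet)

theorem measurableSet_inflow_inter_graph (i : Fin T.space.card) :
    MeasurableSet {z : (ℝ × Dir d) × Space d |
      z.2 ∈ inflow (T.space.elem i) z.1.2 ∩ frontier D.Ω} :=
  (T.measurableSet_inflow_graph i).inter (measurable_snd isClosed_frontier.measurableSet)

theorem measurableSet_faces_inter_graph (i : Fin T.space.card) :
    MeasurableSet {z : (ℝ × Dir d) × Space d |
      z.2 ∈ faces (T.space.elem i) ∩ frontier D.Ω} :=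
  measurable_snd ((measurableSet_faces _).inter isClosed_frontier.measurableSet)

end Discretisation

namespace Discretisation

variable {d : ℕ} {D : TransportData d} (T : Discretisation D)

theorem memLp_trace_bulk (i : Fin T.space.card) (v : T.feSpace) :
    MemLp (T.traceMap i v) ⊤ (T.bulk i) := (isRegular_of_mem v.2).memLp_bulk i

theorem memLp_trace_skel (i : Fin T.space.card) (v : T.feSpace) :
    MemLp (T.traceMap i v) ⊤ (T.skel i) := (isRegular_of_mem v.2).memLp_skel i

theorem memLp_extMap (i : Fin T.space.card) (v : T.feSpace) :
    MemLp (T.extMap i v) ⊤ (T.skel i) := (isRegular_of_mem v.2).memLp_ext_skel i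

theorem memLp_derivMap (i : Fin T.space.card) (v : T.feSpace) :
    MemLp (T.derivMap i v) ⊤ (T.bulk i) :=
  (isRegular_of_mem v.2).memLp_deriv i (T.space.isOpen i).measurableSet (T.elem_subset_closure i)

theorem memLp_glueMap (v : T.feSpace) :
    MemLp (T.glueMap v) ⊤ (D.angEnergy.prod (volume.restrict D.Ω)) :=
  (isRegular_of_mem v.2).memLp_glue D.domain.isOpen.measurableSet subset_closure

theorem integrable_one_bulk (i : Fin T.space.card) :
    Integrable (fun _ => (1 : ℝ)) (T.bulk i) := integrable_const 1

/-- The transport bilinear form on the finite element space. -/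
def transportForm : T.feSpace →ₗ[ℝ] T.feSpace →ₗ[ℝ] ℝ :=
  ∑ i, (weightedForm (T.integrable_total i) (T.memLp_trace_bulk i) (T.memLp_trace_bulk i)
    - weightedForm (T.integrable_one_bulk i) (T.memLp_trace_bulk i) (T.memLp_derivMap i)
    + weightedForm (T.integrable_weightOn i (T.measurableSet_outflow_graph i))
        (T.memLp_trace_skel i) (T.memLp_trace_skel i)
    - weightedForm (T.integrable_weightOn i (s := fun μ => inflow (T.space.elem i) μ \ frontier D.Ω)
        (T.measurableSet_inflow_diff_graph i))
        (T.memLp_extMap i) (T.memLp_trace_skel i))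

/-- Iterated integrals are additive only where the inner integrands are integrable. Here every term
is an integrable weight times two bounded factors, so Fubini applies to each and the nested integral
is a genuine bilinear form. -/
theorem formA_eq (w v : T.feSpace) : T.formA w v = T.transportForm w v := by
  have h1 := fun i => integrable_mul_mul (T.integrable_total i) (T.memLp_trace_bulk i w)
    (T.memLp_trace_bulk i v)
  have h2 := fun i => integrable_mul_mul (T.integrable_one_bulk i) (T.memLp_trace_bulk i w)
    (T.memLp_derivMap i v)
  have h3 := fun i => integrable_mul_mul
    (T.integrable_weightOn i (T.measurableSet_outflow_graph i))
    (T.memLp_trace_skel i w) (T.memLp_trace_skel i v)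
  have h4 := fun i => integrable_mul_mul
    (T.integrable_weightOn i (s := fun μ => inflow (T.space.elem i) μ \ frontier D.Ω)
        (T.measurableSet_inflow_diff_graph i))
    (T.memLp_extMap i w) (T.memLp_trace_skel i v)
  have h12 := fun i => (h1 i).sub' (h2 i)
  have hs := fun i => ((h12 i).integral_prod_left.add (h3 i).integral_prod_left).sub
    (h4 i).integral_prod_left
  have hS := integrable_finsetSum Finset.univ fun i _ => hs i
  have e1 := D.integral_angEnergy hS
  rw [integral_finsetSum _ fun i _ => hs i] at e1
  have e2 : ∀ i, ∫ a, _ ∂D.angEnergy = _ := fun i =>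
    integral_sub ((h12 i).integral_prod_left.add (h3 i).integral_prod_left)
    (h4 i).integral_prod_left
  have e3 : ∀ i, ∫ a, _ ∂D.angEnergy = _ := fun i =>
    integral_add (h12 i).integral_prod_left (h3 i).integral_prod_left
  simp only [Pi.add_apply, Pi.sub_apply] at e1 e2 e3
  simp only [e2, e3, ← integral_prod _ (h12 _), ← integral_prod _ (h3 _), ← integral_prod _ (h4 _)] at e1
  have e4 : ∀ i, ∫ z, _ ∂(T.bulk i) = _ := fun i => integral_sub (h1 i) (h2 i)
  simp only [e4] at e1
  rw [transportForm]
  simp only [LinearMap.sum_apply, LinearMap.add_apply, LinearMap.sub_apply, weightedForm_apply]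
  rw [← e1, formA]
  congr 1
  ext E
  congr 1
  ext μ
  refine Finset.sum_congr rfl fun i _ => ?_
  simp only [mul_assoc]
  rw [T.setIntegral_weight i E (measurableSet_outflow _ _) (T.outflow_subset i μ),
    T.setIntegral_weight i (s := fun μ => inflow (T.space.elem i) μ \ frontier D.Ω) E
      ((measurableSet_inflow _ _).diff isClosed_frontier.measurableSet)
      (sdiff_subset.trans (T.inflow_subset i μ))]
  congr 2
  congr 1
  ext x
  change -(_ * _) + (D.α x E + D.β x μ E) * _ = D.total ((E, μ), x) * _ - 1 * _
  simp only [TransportData.total, traceMap, derivMap, LinearMap.coe_mk, AddHom.coe_mk]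
  ring

/-! ### Coercivity -/

variable {T}

open Classical in
theorem glue_of_mem (v : T.Broken) {i : Fin T.space.card} {x : Space d} (hx : x ∈ T.space.elem i)
    (μ : Dir d) (E : ℝ) : T.glue v x μ E = v i x μ E := by
  rw [glue, Finset.sum_eq_single i, if_pos hx]
  · intro k _ hk
    rw [if_neg fun h => Set.disjoint_left.1 (T.space.disjoint k i hk) h hx]
  · simp

open Classical in
theorem sum_neighbours {i j : Fin T.space.card} {x : Space d} (hj : j ≠ i)
    (hx : x ∈ closure (T.space.elem j))
    (h : ∀ k, x ∈ closure (T.space.elem k) → k = i ∨ k = j) (a : Fin T.space.card → ℝ) :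
    (∑ k, if k ≠ i ∧ x ∈ closure (T.space.elem k) then a k else 0) = a j := by
  rw [Finset.sum_eq_single j, if_pos ⟨hj, hx⟩]
  · intro k _ hk
    rw [if_neg fun hc => (h k hc.2).elim hc.1 hk]
  · simp

variable (T)

/-- The divergence theorem for v²μ on one element. The sign condition of `integral_fderiv_eq_surf`
costs nothing because the function is a square. -/
theorem integral_sq_deriv (v : T.feSpace) (i : Fin T.space.card) (E : ℝ) (μ : Dir d) :
    2 * ∫ x in T.space.elem i, T.traceMap i v ((E, μ), x) * T.derivMap i v ((E, μ), x)
      = ∫ x in frontier (T.space.elem i),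
          T.weightOn i (outflow (T.space.elem i)) ((E, μ), x) * T.traceMap i v ((E, μ), x) ^ 2
            ∂(surf d)
        - ∫ x in frontier (T.space.elem i),
          T.weightOn i (inflow (T.space.elem i)) ((E, μ), x) * T.traceMap i v ((E, μ), x) ^ 2
            ∂(surf d) := by
  have hv := isRegular_of_mem v.2
  have hψ : ContDiff ℝ 1 fun x => (v : T.Broken) i x μ E ^ 2 := (hv.contDiff i μ E).pow 2
  have h := integral_fderiv_eq_surf (T.space.isOpen i) (T.space.isBounded D.domain.isBounded i)
    (T.space.finite_area i) (T.space.surf_frontier_diff_faces i) μ hψ fun x => sq_nonneg _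
  rw [← T.setIntegral_weight i E (measurableSet_outflow _ _) (T.outflow_subset i μ),
    ← T.setIntegral_weight i E (measurableSet_inflow _ _) (T.inflow_subset i μ)]
  refine Eq.trans ?_ h
  rw [← integral_const_mul]
  congr 1
  ext x
  have hd := ((hv.differentiableAt i μ E x).hasFDerivAt.pow 2).fderiv
  have : fderiv ℝ (fun x => (v : T.Broken) i x μ E ^ 2) x
    = (2 * (v : T.Broken) i x μ E) • fderiv ℝ (fun x => (v : T.Broken) i x μ E) x := by
    rw [hd]; simp
  rw [this]
  simp only [traceMap, derivMap, LinearMap.coe_mk, AddHom.coe_mk, FunLike.coe_smul, Pi.smul_apply, smul_eq_mul]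
  ring

end Discretisation

namespace Discretisation

variable {d : ℕ} {D : TransportData d} (T : Discretisation D)

/-- The volume part of `|||v|||_a^2` for fixed energy and direction. -/
def bulkEnergy (v : T.Broken) (a : ℝ × Dir d) : ℝ :=
  ∫ x in D.Ω, (D.α x a.1 + D.β x a.2 a.1) * T.glue v x a.2 a.1 ^ 2

/-- The jump part of `|||v|||_a^2` for fixed energy and direction. -/
def jumpEnergy (v : T.Broken) (a : ℝ × Dir d) : ℝ :=
  ∑ i, ((∫ x in inflow (T.space.elem i) a.2 \ frontier D.Ω,
      T.weight i x a.2 * (v i x a.2 a.1 - T.ext v i x a.2 a.1) ^ 2 ∂(surf d))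
    + (∫ x in faces (T.space.elem i) ∩ frontier D.Ω, T.weight i x a.2 * v i x a.2 a.1 ^ 2 ∂(surf d)))

theorem jumpEnergy_eq (v : T.feSpace) (E : ℝ) (μ : Dir d) :
    T.jumpEnergy v (E, μ) = ∑ i, ((∫ x in frontier (T.space.elem i),
        T.weightOn i (fun μ => inflow (T.space.elem i) μ \ frontier D.Ω) ((E, μ), x)
          * (T.traceMap i v ((E, μ), x) - T.extMap i v ((E, μ), x)) ^ 2 ∂(surf d))
      + (∫ x in frontier (T.space.elem i),
        T.weightOn i (fun _ => faces (T.space.elem i) ∩ frontier D.Ω) ((E, μ), x)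
          * T.traceMap i v ((E, μ), x) ^ 2 ∂(surf d))) := by
  refine Finset.sum_congr rfl fun i _ => ?_
  rw [← T.setIntegral_weight i (s := fun μ => inflow (T.space.elem i) μ \ frontier D.Ω) E
      ((measurableSet_inflow _ _).diff isClosed_frontier.measurableSet)
      (sdiff_subset.trans (T.inflow_subset i μ)),
    ← T.setIntegral_weight i (s := fun _ => faces (T.space.elem i) ∩ frontier D.Ω) E
      ((measurableSet_faces _).inter isClosed_frontier.measurableSet)
      (inter_subset_left.trans (faces_subset_frontier _))]
  rfl

theorem integrable_jump (v : T.feSpace) (i : Fin T.space.card) :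
    Integrable (fun z => T.weightOn i (fun μ => inflow (T.space.elem i) μ \ frontier D.Ω) z
      * (T.traceMap i v z - T.extMap i v z) ^ 2) (T.skel i) := by
  have h := (T.memLp_trace_skel i v).sub (T.memLp_extMap i v)
  simpa only [sq, mul_assoc, Pi.sub_apply] using integrable_mul_mul (T.integrable_weightOn i
    (s := fun μ => inflow (T.space.elem i) μ \ frontier D.Ω)
    (T.measurableSet_inflow_diff_graph i)) h h

theorem integrable_weight_sq (v : T.feSpace) (i : Fin T.space.card) {s : Dir d → Set (Space d)}
    (hs : MeasurableSet {z : (ℝ × Dir d) × Space d | z.2 ∈ s z.1.2}) :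
    Integrable (fun z => T.weightOn i s z * T.traceMap i v z ^ 2) (T.skel i) := by
  simpa only [sq, mul_assoc] using integrable_mul_mul (T.integrable_weightOn i hs)
    (T.memLp_trace_skel i v) (T.memLp_trace_skel i v)

theorem integrable_jumpEnergy (v : T.feSpace) : Integrable (T.jumpEnergy v) D.angEnergy := by
  have h : T.jumpEnergy v = fun a => ∑ i, _ := funext fun a => T.jumpEnergy_eq v a.1 a.2
  rw [h]
  exact integrable_finsetSum _ fun i _ => (T.integrable_jump v i).integral_prod_left.add
    (T.integrable_weight_sq v i (s := fun _ => faces (T.space.elem i) ∩ frontier D.Ω)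
      (T.measurableSet_faces_inter_graph i)).integral_prod_left

theorem integrable_total_glue_sq (v : T.feSpace) :
    Integrable (fun z => D.total z * T.glueMap v z ^ 2)
      (D.angEnergy.prod (volume.restrict D.Ω)) := by
  simpa only [sq, mul_assoc] using integrable_mul_mul D.integrable_total (T.memLp_glueMap v)
    (T.memLp_glueMap v)

theorem integrable_bulkEnergy (v : T.feSpace) : Integrable (T.bulkEnergy v) D.angEnergy :=
  (T.integrable_total_glue_sq v).integral_prod_left

theorem bulkEnergy_nonneg (v : T.Broken) {E : ℝ} (hE : E ∈ D.energies) (μ : Dir d) :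
    0 ≤ T.bulkEnergy v (E, μ) :=
  setIntegral_nonneg D.domain.isOpen.measurableSet fun _ hx =>
    mul_nonneg (D.total_pos hx μ hE).le (sq_nonneg _)

theorem jumpEnergy_nonneg (v : T.Broken) (a : ℝ × Dir d) : 0 ≤ T.jumpEnergy v a :=
  Finset.sum_nonneg fun _ _ => add_nonneg
    (integral_nonneg fun _ => mul_nonneg (T.weight_nonneg _ _ _) (sq_nonneg _))
    (integral_nonneg fun _ => mul_nonneg (T.weight_nonneg _ _ _) (sq_nonneg _))

theorem integral_bulkEnergy_nonneg (v : T.Broken) : 0 ≤ ∫ a, T.bulkEnergy v a ∂D.angEnergy :=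
  integral_nonneg_of_ae (D.ae_mem_energies.mono fun _ ha => T.bulkEnergy_nonneg v ha _)

theorem integral_jumpEnergy_nonneg (v : T.Broken) : 0 ≤ ∫ a, T.jumpEnergy v a ∂D.angEnergy :=
  integral_nonneg fun _ => T.jumpEnergy_nonneg v _

theorem normA_sq (v : T.feSpace) : T.normA v ^ 2
    = ∫ a, T.bulkEnergy v a ∂D.angEnergy + 1 / 2 * ∫ a, T.jumpEnergy v a ∂D.angEnergy := by
  have h : T.normA v = √((∫ a, T.bulkEnergy v a ∂D.angEnergy)
      + 1 / 2 * ∫ a, T.jumpEnergy v a ∂D.angEnergy) := by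
    rw [← D.integral_angEnergy (T.integrable_bulkEnergy v),
      ← D.integral_angEnergy (T.integrable_jumpEnergy v)]
    rfl
  rw [h, Real.sq_sqrt]
  have := T.integral_bulkEnergy_nonneg v
  have := T.integral_jumpEnergy_nonneg v
  positivity

theorem normA_nonneg (v : T.Broken) : 0 ≤ T.normA v := Real.sqrt_nonneg _

/-- The upwind fluxes of the square of a function through interior interfaces cancel. -/
theorem sum_flux_eq_zero (v : T.feSpace) (E : ℝ) (μ : Dir d)
    (h1 : ∀ i, Integrable (fun x =>
      T.weightOn i (fun μ => outflow (T.space.elem i) μ \ frontier D.Ω) ((E, μ), x)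
        * T.traceMap i v ((E, μ), x) ^ 2
      - T.weightOn i (fun μ => inflow (T.space.elem i) μ \ frontier D.Ω) ((E, μ), x)
        * T.extMap i v ((E, μ), x) ^ 2) ((surf d).restrict (frontier (T.space.elem i)))) :
    ∑ i, ∫ x in frontier (T.space.elem i),
      (T.weightOn i (fun μ => outflow (T.space.elem i) μ \ frontier D.Ω) ((E, μ), x)
        * T.traceMap i v ((E, μ), x) ^ 2
      - T.weightOn i (fun μ => inflow (T.space.elem i) μ \ frontier D.Ω) ((E, μ), x)
        * T.extMap i v ((E, μ), x) ^ 2) ∂(surf d) = 0 := by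
  classical
  set G := fun (i : Fin T.space.card) (x : Space d) =>
    T.weightOn i (fun μ => outflow (T.space.elem i) μ \ frontier D.Ω) ((E, μ), x)
        * T.traceMap i v ((E, μ), x) ^ 2
      - T.weightOn i (fun μ => inflow (T.space.elem i) μ \ frontier D.Ω) ((E, μ), x)
        * T.extMap i v ((E, μ), x) ^ 2 with hG
  have h0 : ∀ i x, x ∉ frontier (T.space.elem i) → G i x = 0 := fun i x hx => by
    simp only [hG, weightOn]
    rw [indicator_of_notMem fun h => hx (T.outflow_subset i μ h.1),
      indicator_of_notMem fun h => hx (T.inflow_subset i μ h.1)]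
    ring
  -- Extended by zero, all integrands live on the one measure `surf d`, and the sum over elements
  -- can be taken pointwise under the integral.
  have h2 : ∀ i, Integrable (G i) (surf d) := fun i =>
    (integrableOn_iff_integrable_of_support_subset
      (Function.support_subset_iff'.2 (h0 i))).1 (h1 i)
  have h3 : ∀ i, ∫ x in frontier (T.space.elem i), G i x ∂(surf d) = ∫ x, G i x ∂(surf d) :=
    fun i => setIntegral_eq_integral_of_forall_compl_eq_zero (h0 i)
  change ∑ i, ∫ x in frontier (T.space.elem i), G i x ∂(surf d) = 0
  simp only [h3]
  rw [← integral_finsetSum _ fun i _ => h2 i]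
  refine integral_eq_zero_of_ae ?_
  filter_upwards [T.space.ae_mem_faces D.domain] with x hx
  have key := T.space.sum_outflow_eq_sum_inflow D.domain.isOpen hx.1 μ
    fun k => T.traceMap k v ((E, μ), x) ^ 2
  change ∑ i, G i x = 0
  simp only [hG]
  rw [Finset.sum_sub_distrib, sub_eq_zero]
  convert key using 2 with i _ i _
  · simp only [weightOn, indicator_apply]
    split_ifs
    · rfl
    · simp
  · simp only [weightOn, indicator_apply]
    split_ifs with h
    -- The square of the exterior trace equals the sum of the squared neighbouring traces only
    -- because that sum has a single term.
    · obtain ⟨j, hji, hj, -, hu⟩ := T.space.exists_neighbour D.domain.isOpen hx.1 h.1.1 h.2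
      have hjc := frontier_subset_closure hj.1
      have e : T.extMap i v ((E, μ), x) = T.traceMap j v ((E, μ), x) :=
        sum_neighbours hji hjc hu fun k => T.traceMap k v ((E, μ), x)
      rw [e, ← sum_neighbours hji hjc hu fun k => T.traceMap k v ((E, μ), x) ^ 2]
      rfl
    · simp

/-- The elements exhaust Ω up to their frontiers, which have zero volume because their area is
finite. -/
theorem bulkEnergy_eq (hd : 1 ≤ d) (v : T.feSpace) (E : ℝ) (μ : Dir d)
    (h : ∀ i, Integrable (fun x => D.total ((E, μ), x) * T.traceMap i v ((E, μ), x) ^ 2)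
      (volume.restrict (T.space.elem i))) :
    T.bulkEnergy v (E, μ) = ∑ i, ∫ x in T.space.elem i,
      D.total ((E, μ), x) * T.traceMap i v ((E, μ), x) ^ 2 := by
  have hc : ∀ i, ∀ x ∈ T.space.elem i, D.total ((E, μ), x) * T.glueMap v ((E, μ), x) ^ 2
      = D.total ((E, μ), x) * T.traceMap i v ((E, μ), x) ^ 2 := fun i x hx => by
    have : T.glueMap v ((E, μ), x) = T.traceMap i v ((E, μ), x) := glue_of_mem _ hx μ E
    rw [this]
  have hΩ : (D.Ω : Set (Space d)) =ᵐ[volume] ⋃ i, T.space.elem i := by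
    filter_upwards [T.space.ae_mem_elem hd] with x hx
    exact propext ⟨fun h => mem_iUnion.2 (hx h), fun h => iUnion_subset T.space.subset h⟩
  change ∫ x in D.Ω, D.total ((E, μ), x) * T.glueMap v ((E, μ), x) ^ 2 = _
  rw [setIntegral_congr_set hΩ, integral_iUnion_fintype
    (fun i => (T.space.isOpen i).measurableSet) (fun i j hij => T.space.disjoint i j hij)]
  · exact Finset.sum_congr rfl fun i _ =>
      setIntegral_congr_fun (T.space.isOpen i).measurableSet (hc i)
  · exact fun i => (integrableOn_congr_fun (hc i) (T.space.isOpen i).measurableSet).2 (h i)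

/-- Coercivity of the transport form. -/
theorem transportForm_self (hd : 1 ≤ d) (v : T.feSpace) :
    T.transportForm v v = T.normA v ^ 2 := by
  have hin := T.measurableSet_inflow_graph
  have hout := T.measurableSet_outflow_graph
  have hind := T.measurableSet_inflow_diff_graph
  have houtd : ∀ i, MeasurableSet {z : (ℝ × Dir d) × Space d |
      z.2 ∈ outflow (T.space.elem i) z.1.2 \ frontier D.Ω} := fun i =>
    (hout i).diff (measurable_snd isClosed_frontier.measurableSet)
  have hfac := T.measurableSet_faces_inter_graph
  have I1 := fun i => integrable_mul_mul (T.integrable_total i) (T.memLp_trace_bulk i v)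
    (T.memLp_trace_bulk i v)
  have I2 := fun i => integrable_mul_mul (T.integrable_one_bulk i) (T.memLp_trace_bulk i v)
    (T.memLp_derivMap i v)
  have I3 := fun i => integrable_mul_mul (T.integrable_weightOn i (hout i))
    (T.memLp_trace_skel i v) (T.memLp_trace_skel i v)
  have I4 := fun i => integrable_mul_mul (T.integrable_weightOn i
    (s := fun μ => inflow (T.space.elem i) μ \ frontier D.Ω) (hind i))
    (T.memLp_extMap i v) (T.memLp_trace_skel i v)
  have J1 := fun i => T.integrable_weight_sq v i (hout i)
  have J2 := fun i => T.integrable_weight_sq v i (hin i)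
  have J3 := fun i => T.integrable_weight_sq v i
    (s := fun μ => outflow (T.space.elem i) μ \ frontier D.Ω) (houtd i)
  have J4 : ∀ i, Integrable (fun z =>
      T.weightOn i (fun μ => inflow (T.space.elem i) μ \ frontier D.Ω) z
      * T.extMap i v z ^ 2) (T.skel i) := fun i => by
    simpa only [sq, mul_assoc] using integrable_mul_mul (T.integrable_weightOn i
      (s := fun μ => inflow (T.space.elem i) μ \ frontier D.Ω) (hind i))
      (T.memLp_extMap i v) (T.memLp_extMap i v)
  have J5 := fun i => T.integrable_jump v i
  have J6 := fun i => T.integrable_weight_sq v i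
    (s := fun _ => faces (T.space.elem i) ∩ frontier D.Ω) (hfac i)
  rw [T.normA_sq, ← integral_const_mul,
    ← integral_add (T.integrable_bulkEnergy v) ((T.integrable_jumpEnergy v).const_mul _)]
  rw [transportForm]
  simp only [LinearMap.sum_apply, LinearMap.add_apply, LinearMap.sub_apply, weightedForm_apply]
  -- Fubini gathers the four product integrals into one integral over (E, μ); the identity is then
  -- proved for almost every fixed energy and direction.
  rw [Finset.sum_congr rfl fun i _ => by
    rw [integral_prod _ (I1 i), integral_prod _ (I2 i), integral_prod _ (I3 i),
      integral_prod _ (I4 i),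
      ← integral_sub (I1 i).integral_prod_left (I2 i).integral_prod_left,
      ← integral_add ((I1 i).integral_prod_left.sub' (I2 i).integral_prod_left)
        (I3 i).integral_prod_left,
      ← integral_sub (((I1 i).integral_prod_left.sub' (I2 i).integral_prod_left).fun_add
        (I3 i).integral_prod_left) (I4 i).integral_prod_left]]
  rw [← integral_finsetSum _ fun i _ => (((I1 i).integral_prod_left.sub'
    (I2 i).integral_prod_left).fun_add (I3 i).integral_prod_left).sub' (I4 i).integral_prod_left]
  refine integral_congr_ae ?_
  filter_upwards [eventually_countable_forall.2 fun i => (I1 i).prod_right_ae,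
    eventually_countable_forall.2 fun i => (I2 i).prod_right_ae,
    eventually_countable_forall.2 fun i => (I3 i).prod_right_ae,
    eventually_countable_forall.2 fun i => (I4 i).prod_right_ae,
    eventually_countable_forall.2 fun i => (J1 i).prod_right_ae,
    eventually_countable_forall.2 fun i => (J2 i).prod_right_ae,
    eventually_countable_forall.2 fun i => (J3 i).prod_right_ae,
    eventually_countable_forall.2 fun i => (J4 i).prod_right_ae,
    eventually_countable_forall.2 fun i => (J5 i).prod_right_ae,
    eventually_countable_forall.2 fun i => (J6 i).prod_right_ae]
    with ⟨E, μ⟩ i1 i2 i3 i4 j1 j2 j3 j4 j5 j6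
  have hflux := T.sum_flux_eq_zero v E μ fun i => (j3 i).sub' (j4 i)
  rw [T.bulkEnergy_eq hd v E μ fun i => by simpa only [sq, mul_assoc] using i1 i,
    T.jumpEnergy_eq]
  -- Half of the vanishing total flux is added, after which the identity holds element by element.
  rw [← add_zero (_ + _), ← mul_zero (1 / 2 : ℝ), ← hflux, Finset.mul_sum, Finset.mul_sum,
    ← Finset.sum_add_distrib, ← Finset.sum_add_distrib]
  refine Finset.sum_congr rfl fun i _ => ?_
  have hder := T.integral_sq_deriv v i E μ
  have e1 : ∫ x in T.space.elem i, D.total ((E, μ), x) * T.traceMap i v ((E, μ), x)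
      * T.traceMap i v ((E, μ), x) = ∫ x in T.space.elem i, D.total ((E, μ), x)
      * T.traceMap i v ((E, μ), x) ^ 2 := by simp only [sq, mul_assoc]
  have e2 : ∫ x in T.space.elem i, 1 * T.traceMap i v ((E, μ), x)
      * T.derivMap i v ((E, μ), x) = ∫ x in T.space.elem i,
      T.traceMap i v ((E, μ), x) * T.derivMap i v ((E, μ), x) := by simp only [one_mul]
  rw [e1, e2]
  -- The upwind algebra −v⁻v⁺ = ½(v⁺ − v⁻)² − ½(v⁺)² − ½(v⁻)², with the weight on the whole boundary
  -- split into interior inflow, interior outflow and the part on ∂Ω.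
  have key : ∫ x in frontier (T.space.elem i), _ ∂(surf d) = _ := integral_congr_ae
    (μ := (surf d).restrict (frontier (T.space.elem i)))
    (f := fun x => T.weightOn i (outflow (T.space.elem i)) ((E, μ), x)
        * T.traceMap i v ((E, μ), x) * T.traceMap i v ((E, μ), x)
      - T.weightOn i (fun μ => inflow (T.space.elem i) μ \ frontier D.Ω) ((E, μ), x)
        * T.extMap i v ((E, μ), x) * T.traceMap i v ((E, μ), x)
      - 1 / 2 * (T.weightOn i (outflow (T.space.elem i)) ((E, μ), x)
          * T.traceMap i v ((E, μ), x) ^ 2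
        - T.weightOn i (inflow (T.space.elem i)) ((E, μ), x)
          * T.traceMap i v ((E, μ), x) ^ 2))
    (g := fun x => 1 / 2 * (T.weightOn i (fun μ => inflow (T.space.elem i) μ \ frontier D.Ω)
          ((E, μ), x) * (T.traceMap i v ((E, μ), x) - T.extMap i v ((E, μ), x)) ^ 2
        + T.weightOn i (fun _ => faces (T.space.elem i) ∩ frontier D.Ω) ((E, μ), x)
          * T.traceMap i v ((E, μ), x) ^ 2)
      + 1 / 2 * (T.weightOn i (fun μ => outflow (T.space.elem i) μ \ frontier D.Ω) ((E, μ), x)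
          * T.traceMap i v ((E, μ), x) ^ 2
        - T.weightOn i (fun μ => inflow (T.space.elem i) μ \ frontier D.Ω) ((E, μ), x)
          * T.extMap i v ((E, μ), x) ^ 2))
    (Eventually.of_forall fun x => by
      classical
      have hw : T.weightOn i (inflow (T.space.elem i)) ((E, μ), x)
          + T.weightOn i (outflow (T.space.elem i)) ((E, μ), x)
        = T.weightOn i (fun μ => inflow (T.space.elem i) μ \ frontier D.Ω) ((E, μ), x)
          + T.weightOn i (fun μ => outflow (T.space.elem i) μ \ frontier D.Ω) ((E, μ), x)
          + T.weightOn i (fun _ => faces (T.space.elem i) ∩ frontier D.Ω) ((E, μ), x) := by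
        by_cases hf : x ∈ faces (T.space.elem i)
        · rcases lt_or_ge ⟪(μ : Space d), normal (T.space.elem i) x⟫ 0 with h | h
          · by_cases hx : x ∈ frontier D.Ω <;>
              simp [weightOn, inflow, outflow, hf, h, not_le.2 h, hx]
          · by_cases hx : x ∈ frontier D.Ω <;>
              simp [weightOn, inflow, outflow, hf, h, not_lt.2 h, hx]
        · simp [weightOn, inflow, outflow, hf]
      linear_combination (1 / 2 * T.traceMap i v ((E, μ), x) ^ 2) * hw)
  rw [integral_sub ((i3 i).sub' (i4 i)) (((j1 i).sub' (j2 i)).const_mul _),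
    integral_sub (i3 i) (i4 i), integral_const_mul, integral_sub (j1 i) (j2 i),
    integral_add (((j5 i).fun_add (j6 i)).const_mul _) (((j3 i).sub' (j4 i)).const_mul _),
    integral_const_mul, integral_const_mul, integral_add (j5 i) (j6 i)] at key
  linear_combination key - 1 / 2 * hder

end Discretisation

namespace Discretisation

variable {d : ℕ} {D : TransportData d} (T : Discretisation D)

/-! ### The right-hand side -/

theorem integrable_source (i : Fin T.space.card) :
    Integrable (fun z : (ℝ × Dir d) × Space d => D.f z.2 z.1.2 z.1.1) (T.bulk i) :=
  (D.integrable_reorder D.f_integrable).mono_measure (T.bulk_le i)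

/-- Integrability of `gD` is assumed with the normal of Ω, while the load uses the normal of the
element. They agree at almost every common boundary point, where the element has the normal of the
larger set Ω. -/
theorem integrable_inflow (i : Fin T.space.card) :
    Integrable (fun z : (ℝ × Dir d) × Space d =>
      T.weightOn i (fun μ => inflow (T.space.elem i) μ ∩ frontier D.Ω) z * D.gD z.2 z.1.2 z.1.1)
      (T.skel i) := by
  classical
  have := isFiniteMeasure_frontier_domain T.space
  have h1 := D.integrable_reorder D.gD_integrable
  simp only at h1
  set G := fun z : (ℝ × Dir d) × Space d =>
    max 0 (-⟪(z.1.2 : Space d), normal D.Ω z.2⟫) * D.gD z.2 z.1.2 z.1.1 with hG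
  have hS := T.measurableSet_inflow_inter_graph i
  have h2 : IntegrableOn G {z | z.2 ∈ inflow (T.space.elem i) z.1.2 ∩ frontier D.Ω}
      (T.skel i) := by
    refine IntegrableOn.mono_set (t := univ ×ˢ frontier D.Ω) ?_ fun z hz => ⟨mem_univ _, hz.2⟩
    rw [IntegrableOn, skel, ← Measure.prod_restrict, Measure.restrict_univ,
      Measure.restrict_restrict isClosed_frontier.measurableSet]
    refine h1.mono_measure ?_
    have h : ∀ s : Set (Space d), D.angEnergy.prod ((surf d).restrict (s ∩ frontier D.Ω))
        ≤ D.angEnergy.prod ((surf d).restrict (frontier D.Ω)) := fun s => by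
      rw [← Measure.restrict_restrict_of_subset (s := s ∩ frontier D.Ω) (t := frontier D.Ω)
        inter_subset_right, ← Measure.restrict_univ (μ := D.angEnergy), Measure.prod_restrict,
        Measure.restrict_univ]
      exact Measure.restrict_le_self
    rw [inter_comm]
    exact h _
  refine (h2.integrable_indicator hS).congr ?_
  have h3 : ∀ᵐ z ∂(T.skel i), _ := Measure.quasiMeasurePreserving_snd.ae
    (ae_restrict_of_ae (T.space.ae_mem_faces D.domain))
  filter_upwards [h3] with z hz
  simp only [indicator_apply, weightOn, mem_ofPred_eq]
  split_ifs with h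
  · have hn := T.space.normal_eq_of_mem_frontier h.1.1 (hz.2 h.2)
    simp only [hG, weight, ← hn]
    rw [abs_of_neg h.1.2, max_eq_right (by linarith [h.1.2])]
  · rw [zero_mul]

/-- The right-hand side functional on the finite element space. -/
def loadForm : T.feSpace →ₗ[ℝ] ℝ :=
  ∑ i, (weightedFunctional (T.integrable_source i) (T.memLp_trace_bulk i)
    + weightedFunctional (T.integrable_inflow i) (T.memLp_trace_skel i))

theorem load_eq (v : T.feSpace) : T.load v = T.loadForm v := by
  have h1 := fun i => (T.integrable_source i).mul_of_top_left (T.memLp_trace_bulk i v)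
  have h2 := fun i => (T.integrable_inflow i).mul_of_top_left (T.memLp_trace_skel i v)
  have hs := fun i => (h1 i).integral_prod_left.fun_add (h2 i).integral_prod_left
  have e1 := D.integral_angEnergy (integrable_finsetSum Finset.univ fun i _ => hs i)
  rw [integral_finsetSum _ fun i _ => hs i] at e1
  have e2 : ∀ i, ∫ a, _ ∂D.angEnergy = _ := fun i =>
    integral_add (h1 i).integral_prod_left (h2 i).integral_prod_left
  simp only [e2, ← integral_prod _ (h1 _), ← integral_prod _ (h2 _)] at e1
  rw [loadForm]
  simp only [LinearMap.sum_apply, LinearMap.add_apply]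
  refine Eq.trans ?_ e1
  rw [load]
  congr 1
  ext E
  congr 1
  ext μ
  refine Finset.sum_congr rfl fun i _ => ?_
  simp only [mul_assoc]
  rw [T.setIntegral_weight i (s := fun μ => inflow (T.space.elem i) μ ∩ frontier D.Ω) E
      ((measurableSet_inflow _ _).inter isClosed_frontier.measurableSet)
      (inter_subset_left.trans (T.inflow_subset i μ))]
  simp only [Pi.mul_apply, mul_assoc]
  rfl

/-! ### Definiteness -/

theorem group_subset (g : Fin T.energy.card) : T.energy.group g ⊆ D.energies := fun E hE => by
  have h1 := T.energy.anti.antitone (Fin.le_last g.succ)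
  have h2 := T.energy.anti.antitone (Fin.zero_le g.castSucc)
  rw [T.energy.last] at h1
  rw [T.energy.first] at h2
  exact ⟨h1.trans hE.1.le, hE.2.le.trans h2⟩

/-- Positivity of α + β makes v vanish almost everywhere. For almost every (E, μ) each piece is then
zero on an open element, hence on all of ℝ^d by analyticity. For fixed x, continuity in (E, μ) on
the open cells removes the exceptional set, and off the cells v is zero by normalisation. -/
theorem eq_zero_of_normA_eq_zero {v : T.feSpace} (hv : T.normA v = 0) : v = 0 := by
  have hr := isRegular_of_mem v.2
  have h1 := T.normA_sq v
  rw [hv] at h1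
  have h2 : ∫ a, T.bulkEnergy v a ∂D.angEnergy = 0 := by
    have := T.integral_bulkEnergy_nonneg v
    have := T.integral_jumpEnergy_nonneg v
    nlinarith
  have hm : ∀ᵐ z ∂(D.angEnergy.prod (volume.restrict D.Ω)), z.1.1 ∈ D.energies ∧ z.2 ∈ D.Ω :=
    (Measure.quasiMeasurePreserving_fst.ae D.ae_mem_energies).and
      (ae_snd_mem volume D.domain.isOpen.measurableSet)
  have h3 : ∫ z, D.total z * T.glueMap v z ^ 2 ∂(D.angEnergy.prod (volume.restrict D.Ω)) = 0 := by
    rw [integral_prod _ (T.integrable_total_glue_sq v)]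
    exact h2
  rw [integral_eq_zero_iff_of_nonneg_ae ?_ (T.integrable_total_glue_sq v)] at h3
  swap
  · filter_upwards [hm] with z hz
    exact mul_nonneg (D.total_pos hz.2 z.1.2 hz.1).le (sq_nonneg _)
  have h4 : ∀ᵐ z ∂(D.angEnergy.prod (volume.restrict D.Ω)), T.glueMap v z = 0 := by
    filter_upwards [hm, h3] with z hz h0
    exact pow_eq_zero_iff two_ne_zero |>.1
      ((mul_eq_zero.1 h0).resolve_left (D.total_pos hz.2 z.1.2 hz.1).ne')
  have h5 : ∀ i, ∀ᵐ a ∂D.angEnergy, ∀ x, (v : T.Broken) i x a.2 a.1 = 0 := fun i => by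
    have h6 : ∀ᵐ z ∂(T.bulk i), T.glueMap v z = 0 := (Measure.absolutelyContinuous_of_le (T.bulk_le i)).ae_le h4
    filter_upwards [Measure.ae_ae_of_ae_prod h6] with a ha
    have h7 : (fun x => (v : T.Broken) i x a.2 a.1) =ᵐ[volume.restrict (T.space.elem i)]
        fun _ => 0 := by
      filter_upwards [ha, ae_restrict_mem (T.space.isOpen i).measurableSet] with x hx hxi
      rw [← hx]
      exact (glue_of_mem _ hxi _ _).symm
    have h8 := Measure.eqOn_open_of_ae_eq h7 (T.space.isOpen i)
      (hr.contDiff i a.2 a.1).continuous.continuousOn continuousOn_const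
    obtain ⟨x₀, hx₀⟩ := T.space.nonempty i
    have h9 := (hr.analytic i a.2 a.1).eq_of_eventuallyEq
      (analyticOnNhd_const (v := (0 : ℝ))) (z₀ := x₀)
      (by filter_upwards [(T.space.isOpen i).mem_nhds hx₀] with x hx using h8 hx)
    exact fun x => congrFun h9 x
  have hpos : Measure.IsOpenPosMeasure (dirMeasure d) := by unfold dirMeasure; infer_instance
  set U : Set (ℝ × Dir d) := (⋃ g, T.energy.group g) ×ˢ (⋃ j, (T.angle.cell j).curved) with hU
  have hUo : IsOpen U := (isOpen_iUnion fun g => isOpen_Ioo).prod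
    (isOpen_iUnion fun j => CubeCell.isOpen_curved)
  have hle : ((volume : Measure ℝ).prod (dirMeasure d)).restrict U ≤ D.angEnergy := by
    have : D.angEnergy = ((volume : Measure ℝ).prod (dirMeasure d)).restrict
        (D.energies ×ˢ univ) := by
      rw [← Measure.prod_restrict, Measure.restrict_univ]; rfl
    rw [this]
    exact Measure.restrict_mono (prod_mono (iUnion_subset T.group_subset) (subset_univ _)) le_rfl
  ext i x μ E
  change (v : T.Broken) i x μ E = 0
  by_cases hEμ : (E, μ) ∈ U
  · have h6 : (fun a : ℝ × Dir d => (v : T.Broken) i x a.2 a.1)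
        =ᵐ[((volume : Measure ℝ).prod (dirMeasure d)).restrict U] fun _ => 0 := by
      filter_upwards [(Measure.absolutelyContinuous_of_le hle).ae_le (h5 i)] with a ha using ha x
    exact Measure.eqOn_open_of_ae_eq h6 hUo (hr.continuousOn i x) continuousOn_const hEμ
  · exact hr.eq_zero i x μ E hEμ

end Discretisation

/-! ### The scattering form -/

namespace TransportData

variable {d : ℕ} (D : TransportData d)

/-- The measure of (energy, direction, position). -/
abbrev phase : Measure ((ℝ × Dir d) × Space d) := D.angEnergy.prod (volume.restrict D.Ω)

/-- The kernel for scattering at position `z.1.2` from the state `z.1.1` to the state `z.2`. -/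
def kernel (z : ((ℝ × Dir d) × Space d) × (ℝ × Dir d)) : ℝ :=
  D.θ z.1.2 ⟪(z.1.1.2 : Space d), (z.2.2 : Space d)⟫ z.1.1.1 z.2.1

/-- Exchange of the states before and after scattering. -/
def exchange {d : ℕ} (z : ((ℝ × Dir d) × Space d) × (ℝ × Dir d)) :
    ((ℝ × Dir d) × Space d) × (ℝ × Dir d) := ((z.2, z.1.2), z.1.1)

/-- Exchanging the two states turns γ into a slice integral of the same shape as β, so that one
estimate serves both halves of the Cauchy–Schwarz inequality. -/
theorem measurePreserving_exchange :
    MeasurePreserving (exchange (d := d)) (D.phase.prod D.angEnergy)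
      (D.phase.prod D.angEnergy) := by
  have h1 := measurePreserving_prodAssoc D.angEnergy (volume.restrict D.Ω) D.angEnergy
  have h2 : MeasurePreserving Prod.swap (D.angEnergy.prod ((volume.restrict D.Ω).prod D.angEnergy))
      (((volume.restrict D.Ω).prod D.angEnergy).prod D.angEnergy) :=
    Measure.measurePreserving_swap
  have h3 : MeasurePreserving (Prod.swap : Space d × (ℝ × Dir d) → _)
      ((volume.restrict D.Ω).prod D.angEnergy) D.phase := Measure.measurePreserving_swap
  exact (h3.prod (MeasurePreserving.id D.angEnergy)).comp (h2.comp h1)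

theorem measurable_kernel : Measurable D.kernel := by
  have h1 : Measurable fun z : ((ℝ × Dir d) × Space d) × (ℝ × Dir d) =>
      ⟪(z.1.1.2 : Space d), (z.2.2 : Space d)⟫ :=
    (measurable_subtype_coe.comp (by fun_prop :
      Measurable fun z : ((ℝ × Dir d) × Space d) × (ℝ × Dir d) => z.1.1.2)).inner
    (measurable_subtype_coe.comp (by fun_prop :
      Measurable fun z : ((ℝ × Dir d) × Space d) × (ℝ × Dir d) => z.2.2))
  have h2 : Measurable fun z : ((ℝ × Dir d) × Space d) × (ℝ × Dir d) =>
      (z.1.2, ⟪(z.1.1.2 : Space d), (z.2.2 : Space d)⟫, z.1.1.1, z.2.1) :=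
    (by fun_prop : Measurable fun z : ((ℝ × Dir d) × Space d) × (ℝ × Dir d) => z.1.2).prodMk
      (h1.prodMk ((by fun_prop : Measurable fun z : ((ℝ × Dir d) × Space d) × (ℝ × Dir d) =>
        z.1.1.1).prodMk (by fun_prop)))
  exact D.θ_measurable.comp h2

theorem ae_mem_phase : ∀ᵐ z ∂D.phase, z.1.1 ∈ D.energies ∧ z.2 ∈ D.Ω :=
  (Measure.quasiMeasurePreserving_fst.ae D.ae_mem_energies).and
    (Measure.quasiMeasurePreserving_snd.ae (ae_restrict_mem D.domain.isOpen.measurableSet))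

theorem ae_kernel_nonneg : ∀ᵐ z ∂(D.phase.prod D.angEnergy), 0 ≤ D.kernel z := by
  have h1 : ∀ᵐ z ∂(D.phase.prod D.angEnergy), z.1.1.1 ∈ D.energies ∧ z.1.2 ∈ D.Ω :=
    Measure.quasiMeasurePreserving_fst.ae D.ae_mem_phase
  have h2 : ∀ᵐ z ∂(D.phase.prod D.angEnergy), z.2.1 ∈ D.energies :=
    Measure.quasiMeasurePreserving_snd.ae D.ae_mem_energies
  filter_upwards [h1, h2] with z h1 h2
  exact D.θ_nonneg _ h1.2 _ (inner_mem _ _) _ h1.1 _ h2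

theorem integrable_kernel_slice {E : ℝ} (hE : E ∈ D.energies) {x : Space d} (hx : x ∈ D.Ω)
    (μ : Dir d) : Integrable (fun b => D.kernel (((E, μ), x), b)) D.angEnergy :=
  (Measure.measurePreserving_swap (μ := volume.restrict D.energies)
    (ν := dirMeasure d)).integrable_comp_of_integrable (D.θ_integrable_out x hx μ E hE)

theorem integral_kernel_slice {E : ℝ} (hE : E ∈ D.energies) {x : Space d} (hx : x ∈ D.Ω)
    (μ : Dir d) : ∫ b, D.kernel (((E, μ), x), b) ∂D.angEnergy = D.β x μ E :=
  integral_prod _ (D.integrable_kernel_slice hE hx μ)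

/-- By Tonelli, since the slices are non-negative with integral β, which is itself integrable. -/
theorem integrable_kernel : Integrable D.kernel (D.phase.prod D.angEnergy) := by
  refine (integrable_prod_iff D.measurable_kernel.aestronglyMeasurable).2 ⟨?_, ?_⟩
  · filter_upwards [D.ae_mem_phase] with z hz
    exact D.integrable_kernel_slice hz.1 hz.2 z.1.2
  · refine D.integrable_β.congr ?_
    filter_upwards [D.ae_mem_phase] with z hz
    rw [← D.integral_kernel_slice hz.1 hz.2]
    refine integral_congr_ae ?_
    filter_upwards [D.ae_mem_energies] with b hb
    exact (Real.norm_of_nonneg (D.θ_nonneg _ hz.2 _ (inner_mem _ _) _ hz.1 _ hb)).symm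

theorem integrable_kernel_exchange :
    Integrable (fun z => D.kernel (exchange z)) (D.phase.prod D.angEnergy) :=
  D.measurePreserving_exchange.integrable_comp_of_integrable D.integrable_kernel

theorem integral_exchange {F : ((ℝ × Dir d) × Space d) × (ℝ × Dir d) → ℝ}
    (hF : AEStronglyMeasurable F (D.phase.prod D.angEnergy)) :
    ∫ z, F (exchange z) ∂(D.phase.prod D.angEnergy) = ∫ z, F z ∂(D.phase.prod D.angEnergy) := by
  have h := D.measurePreserving_exchange
  conv_rhs => rw [← h.map_eq]
  rw [integral_map h.aemeasurable]
  rw [h.map_eq]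
  exact hF

theorem integrable_kernel_exchange_slice {E : ℝ} (hE : E ∈ D.energies) {x : Space d}
    (hx : x ∈ D.Ω) (μ : Dir d) :
    Integrable (fun b => D.kernel (exchange (((E, μ), x), b))) D.angEnergy :=
  (Measure.measurePreserving_swap (μ := volume.restrict D.energies)
    (ν := dirMeasure d)).integrable_comp_of_integrable (D.θ_integrable_in x hx μ E hE)

theorem integral_kernel_exchange_slice {E : ℝ} (hE : E ∈ D.energies) {x : Space d}
    (hx : x ∈ D.Ω) (μ : Dir d) :
    ∫ b, D.kernel (exchange (((E, μ), x), b)) ∂D.angEnergy = D.γ x μ E :=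
  integral_prod _ (D.integrable_kernel_exchange_slice hE hx μ)

/-- The quotients are at most 1 because α ≥ 0, so the supremum is a true upper bound. -/
theorem β_le_total {x : Space d} (hx : x ∈ D.Ω) (μ : Dir d) {E : ℝ} (hE : E ∈ D.energies) :
    D.β x μ E ≤ D.qβ * (D.α x E + D.β x μ E) := by
  rw [← div_le_iff₀ (D.total_pos hx μ hE)]
  refine le_csSup ⟨1, ?_⟩ ⟨x, hx, E, hE, μ, rfl⟩
  rintro _ ⟨y, hy, E', hE', ν, rfl⟩
  rw [div_le_one (D.total_pos hy ν hE')]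
  exact le_add_of_nonneg_left (D.α_nonneg y hy E' hE')

theorem γ_le_total {x : Space d} (hx : x ∈ D.Ω) (μ : Dir d) {E : ℝ} (hE : E ∈ D.energies) :
    D.γ x μ E ≤ D.qγ * (D.α x E + D.β x μ E) := by
  rw [← div_le_iff₀ (D.total_pos hx μ hE)]
  refine le_csSup ⟨2, ?_⟩ ⟨x, hx, E, hE, μ, rfl⟩
  rintro _ ⟨y, hy, E', hE', ν, rfl⟩
  rw [div_le_iff₀ (D.total_pos hy ν hE')]
  exact D.γ_le hy ν hE'

theorem qβ_nonneg : 0 ≤ D.qβ := Real.sSup_nonneg fun _ ⟨_, hx, _, hE, μ, h⟩ =>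
  h ▸ div_nonneg (D.β_nonneg hx μ hE) (D.total_pos hx μ hE).le

theorem qγ_nonneg : 0 ≤ D.qγ := Real.sSup_nonneg fun _ ⟨_, hx, _, hE, μ, h⟩ =>
  h ▸ div_nonneg (D.γ_nonneg hx μ hE) (D.total_pos hx μ hE).le

end TransportData

namespace Discretisation

open TransportData

variable {d : ℕ} {D : TransportData d} (T : Discretisation D)

/-- The values before scattering. -/
def sourceMap : T.feSpace →ₗ[ℝ] (((ℝ × Dir d) × Space d) × (ℝ × Dir d) → ℝ) where
  toFun v z := T.glueMap v z.1
  map_add' v w := by ext z; simp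
  map_smul' c v := by ext z; simp

/-- The values after scattering. -/
def targetMap : T.feSpace →ₗ[ℝ] (((ℝ × Dir d) × Space d) × (ℝ × Dir d) → ℝ) where
  toFun v z := T.glueMap v (exchange z).1
  map_add' v w := by ext z; simp
  map_smul' c v := by ext z; simp

theorem memLp_sourceMap (v : T.feSpace) :
    MemLp (T.sourceMap v) ⊤ (D.phase.prod D.angEnergy) := by
  obtain ⟨h1, h2⟩ := T.memLp_glueMap v
  refine memLp_top_of_bound (h1.comp_quasiMeasurePreserving Measure.quasiMeasurePreserving_fst)
    (eLpNormEssSup (T.glueMap v) D.phase).toReal ?_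
  refine Measure.quasiMeasurePreserving_fst.ae
    (p := fun z => ‖T.glueMap v z‖ ≤ (eLpNormEssSup (T.glueMap v) D.phase).toReal) ?_
  rw [eLpNorm_exponent_top] at h2
  filter_upwards [ae_le_eLpNormEssSup (f := T.glueMap v) (μ := D.phase)] with z hz
  rw [← toReal_enorm]
  exact ENNReal.toReal_mono h2.ne hz

theorem memLp_targetMap (v : T.feSpace) :
    MemLp (T.targetMap v) ⊤ (D.phase.prod D.angEnergy) :=
  (T.memLp_sourceMap v).comp_measurePreserving D.measurePreserving_exchange

/-- The scattering form on the finite element space. -/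
def scatterForm : T.feSpace →ₗ[ℝ] T.feSpace →ₗ[ℝ] ℝ :=
  weightedForm D.integrable_kernel T.memLp_sourceMap T.memLp_targetMap

/-- `formS` has the state after scattering outermost, whereas the kernel integral is arranged with
the state before scattering first; `exchange` reconciles them. The inner iterated integral is a
product integral only for almost every (E, μ, x), which suffices. -/
theorem formS_eq (w v : T.feSpace) : T.formS w v = T.scatterForm w v := by
  have h := integrable_mul_mul D.integrable_kernel (T.memLp_sourceMap w) (T.memLp_targetMap v)
  have h' := D.measurePreserving_exchange.integrable_comp_of_integrable h
  have e1 := D.integral_angEnergy h'.integral_prod_left.integral_prod_left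
  rw [scatterForm, weightedForm_apply, ← D.integral_exchange h.aestronglyMeasurable]
  refine Eq.trans ?_ ((e1.trans (integral_prod _ h'.integral_prod_left).symm).trans
    (integral_prod _ h').symm)
  have hk := D.measurePreserving_exchange.integrable_comp_of_integrable
    (D.integrable_kernel.mul_of_top_left (T.memLp_sourceMap w))
  have hk' := Measure.ae_ae_of_ae_prod (Measure.ae_ae_of_ae_prod hk.prod_right_ae)
  refine integral_congr_ae (hk'.mono fun E h1 => integral_congr_ae (h1.mono fun μ h2 =>
    integral_congr_ae (h2.mono fun x h3 => ?_)))
  simp only [scatter]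
  refine (congrArg (· * T.glue v x μ E) (D.integral_angEnergy h3)).trans ?_
  exact (integral_mul_const _ _).symm

/-- The squared function depends on the first state alone, so the integral over the second state
falls on the kernel and is bounded by q(α + β). -/
theorem integral_kernel_source_sq_le {k : ((ℝ × Dir d) × Space d) × (ℝ × Dir d) → ℝ} {q : ℝ}
    (hk : Integrable k (D.phase.prod D.angEnergy))
    (hq : ∀ E ∈ D.energies, ∀ x ∈ D.Ω, ∀ μ : Dir d,
      ∫ b, k (((E, μ), x), b) ∂D.angEnergy ≤ q * (D.α x E + D.β x μ E)) (v : T.feSpace) :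
    ∫ z, k z * T.sourceMap v z * T.sourceMap v z ∂(D.phase.prod D.angEnergy)
      ≤ q * ∫ z, D.total z * T.glueMap v z ^ 2 ∂D.phase := by
  have h := integrable_mul_mul hk (T.memLp_sourceMap v) (T.memLp_sourceMap v)
  rw [integral_prod _ h, ← integral_const_mul]
  refine integral_mono_ae h.integral_prod_left ((T.integrable_total_glue_sq v).const_mul q) ?_
  filter_upwards [D.ae_mem_phase] with z hz
  have e : ∫ b, k (z, b) * T.sourceMap v (z, b) * T.sourceMap v (z, b) ∂D.angEnergy
      = (∫ b, k (z, b) ∂D.angEnergy) * T.glueMap v z ^ 2 := by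
    rw [← integral_mul_const]
    exact integral_congr_ae (Eventually.of_forall fun b => by
      change k (z, b) * T.glueMap v z * T.glueMap v z = _
      ring)
  change ∫ b, k (z, b) * T.sourceMap v (z, b) * T.sourceMap v (z, b) ∂D.angEnergy ≤ _
  rw [e, ← mul_assoc]
  exact mul_le_mul_of_nonneg_right (hq _ hz.1 _ hz.2 _) (sq_nonneg _)

theorem integral_total_glue_sq_le (v : T.feSpace) :
    ∫ z, D.total z * T.glueMap v z ^ 2 ∂D.phase ≤ T.normA v ^ 2 := by
  rw [T.normA_sq, integral_prod _ (T.integrable_total_glue_sq v)]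
  have := T.integral_jumpEnergy_nonneg v
  refine le_add_of_nonneg_right (a := ∫ a, T.bulkEnergy v a ∂D.angEnergy) ?_
  positivity

/-- Boundedness of the scattering form. -/
theorem abs_scatterForm_le (w v : T.feSpace) :
    |T.scatterForm w v| ≤ √(D.qβ * D.qγ) * (T.normA w * T.normA v) := by
  have hss := integrable_mul_mul D.integrable_kernel (T.memLp_sourceMap w) (T.memLp_sourceMap w)
  have hst := integrable_mul_mul D.integrable_kernel (T.memLp_sourceMap w) (T.memLp_targetMap v)
  have htt := integrable_mul_mul D.integrable_kernel (T.memLp_targetMap v) (T.memLp_targetMap v)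
  have h1 : ∫ z, D.kernel z * T.sourceMap w z * T.sourceMap w z ∂(D.phase.prod D.angEnergy)
      ≤ D.qβ * T.normA w ^ 2 :=
    (T.integral_kernel_source_sq_le D.integrable_kernel (fun E hE x hx μ => by
      rw [D.integral_kernel_slice hE hx μ]
      exact D.β_le_total hx μ hE) w).trans
      (mul_le_mul_of_nonneg_left (T.integral_total_glue_sq_le w) D.qβ_nonneg)
  have h2 : ∫ z, D.kernel z * T.targetMap v z * T.targetMap v z ∂(D.phase.prod D.angEnergy)
      ≤ D.qγ * T.normA v ^ 2 := by
    rw [← D.integral_exchange htt.aestronglyMeasurable]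
    exact (T.integral_kernel_source_sq_le D.integrable_kernel_exchange (fun E hE x hx μ => by
      rw [D.integral_kernel_exchange_slice hE hx μ]
      exact D.γ_le_total hx μ hE) v).trans
      (mul_le_mul_of_nonneg_left (T.integral_total_glue_sq_le v) D.qγ_nonneg)
  -- Cauchy–Schwarz with the weight θ: the quadratic t ↦ ∫ θ (t w + v)², with w before and v after
  -- scattering, is non-negative, so its discriminant is not positive.
  have h3 := discrim_le_zero (K := ℝ)
    (a := ∫ z, D.kernel z * T.sourceMap w z * T.sourceMap w z ∂(D.phase.prod D.angEnergy))
    (b := 2 * T.scatterForm w v)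
    (c := ∫ z, D.kernel z * T.targetMap v z * T.targetMap v z ∂(D.phase.prod D.angEnergy))
    fun t => by
      rw [scatterForm, weightedForm_apply, mul_comm _ (t * t), mul_right_comm 2, ← integral_const_mul,
        ← integral_const_mul,
        ← integral_add (hss.const_mul _) (hst.const_mul _),
        ← integral_add ((hss.const_mul _).fun_add (hst.const_mul _)) htt]
      refine integral_nonneg_of_ae (D.ae_kernel_nonneg.mono fun z hz => ?_)
      have : 0 ≤ D.kernel z * (t * T.sourceMap w z + T.targetMap v z) ^ 2 :=
        mul_nonneg hz (sq_nonneg _)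
      refine this.trans_eq ?_
      ring
  have hn1 : 0 ≤ ∫ z, D.kernel z * T.targetMap v z * T.targetMap v z
      ∂(D.phase.prod D.angEnergy) :=
    integral_nonneg_of_ae (D.ae_kernel_nonneg.mono fun z hz => by
      change 0 ≤ D.kernel z * T.targetMap v z * T.targetMap v z
      rw [mul_assoc]
      exact mul_nonneg hz (mul_self_nonneg _))
  have h4 : T.scatterForm w v ^ 2 ≤ (D.qβ * T.normA w ^ 2) * (D.qγ * T.normA v ^ 2) := by
    rw [discrim] at h3
    have := mul_le_mul h1 h2 hn1 (mul_nonneg D.qβ_nonneg (sq_nonneg _))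
    nlinarith
  refine abs_le_of_sq_le_sq (h4.trans_eq ?_) (mul_nonneg (Real.sqrt_nonneg _)
    (mul_nonneg (T.normA_nonneg w) (T.normA_nonneg v)))
  rw [mul_pow, Real.sq_sqrt (mul_nonneg D.qβ_nonneg D.qγ_nonneg)]
  ring

end Discretisation

/-! ### Fixed-point iterations for coercive forms -/

section Abstract

variable {V : Type*} [AddCommGroup V] [Module ℝ V]

/-- Definiteness on the diagonal makes V → V* injective, and equal finite dimensions make it
surjective; symmetry is not needed. -/
theorem existsUnique_form_eq [FiniteDimensional ℝ V] {A : V →ₗ[ℝ] V →ₗ[ℝ] ℝ} (hA : ∀ v, A v v = 0 → v = 0)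
    (φ : V →ₗ[ℝ] ℝ) : ∃! u, ∀ v, A u v = φ v := by
  have hinj : Function.Injective A := by
    refine (injective_iff_map_eq_zero A).2 fun v hv => hA v ?_
    rw [hv, LinearMap.zero_apply]
  have hsurj : Function.Surjective A :=
    (LinearMap.injective_iff_surjective_of_finrank_eq_finrank
      (Subspace.dual_finrank_eq (K := ℝ) (V := V)).symm).1 hinj
  obtain ⟨u, hu⟩ := hsurj φ
  refine ⟨u, fun v => by rw [hu], fun w hw => hinj ?_⟩
  rw [hu]
  exact LinearMap.ext hw

variable {A S : V →ₗ[ℝ] V →ₗ[ℝ] ℝ} {N : V → ℝ} {q : ℝ}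

/-- The functional is represented by some w through the symmetrised form A + A.flip. Then A(tw + v,
tw + v) = t²N(w)² + tφ(v) + N(v)² is non-negative in t, and its discriminant gives the constant
2N(w). No triangle inequality for N is used. -/
theorem exists_abs_le_of_form [FiniteDimensional ℝ V] (hN : ∀ v, 0 ≤ N v) (hA : ∀ v, A v v = N v ^ 2)
    (h0 : ∀ v, N v = 0 → v = 0) (φ : V →ₗ[ℝ] ℝ) : ∃ C, ∀ v, |φ v| ≤ C * N v := by
  obtain ⟨w, hw, -⟩ := existsUnique_form_eq (A := A + A.flip) (fun v hv => h0 v <| by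
    rw [LinearMap.add_apply, LinearMap.add_apply, LinearMap.flip_apply, hA] at hv
    exact pow_eq_zero_iff two_ne_zero |>.1 (by linarith)) φ
  refine ⟨2 * N w, fun v => ?_⟩
  have hd := discrim_le_zero (K := ℝ) (a := N w ^ 2) (b := φ v) (c := N v ^ 2) fun t => by
    have h := hA (t • w + v)
    have hφ := hw v
    rw [LinearMap.add_apply, LinearMap.add_apply, LinearMap.flip_apply] at hφ
    simp only [map_add, map_smul, LinearMap.add_apply, LinearMap.smul_apply, smul_eq_mul, hA] at h
    have : 0 ≤ N (t • w + v) ^ 2 := sq_nonneg _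
    rw [← h] at this
    rw [← hφ]
    linarith
  refine abs_le_of_sq_le_sq ?_ (mul_nonneg (mul_nonneg zero_le_two (hN w)) (hN v))
  rw [discrim] at hd
  linarith

/-- The equation is tested with e' itself and one factor N e' is divided out. -/
theorem le_mul_of_form_eq (hN : ∀ v, 0 ≤ N v) (hA : ∀ v, A v v = N v ^ 2) (hq : 0 ≤ q)
    (hS : ∀ w v, |S w v| ≤ q * (N w * N v)) {e e' : V} (h : ∀ v, A e' v = S e v) :
    N e' ≤ q * N e := by
  have h1 := h e'
  rw [hA] at h1
  have h2 := (le_abs_self _).trans (hS e e')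
  rcases (hN e').eq_or_lt with h0 | h0
  · rw [← h0]
    exact mul_nonneg hq (hN e)
  · refine le_of_mul_le_mul_right ?_ h0
    linarith

end Abstract

/-! ### Well-posedness of the discrete problems and convergence of source iteration. -/

namespace Discretisation

variable {d : ℕ} {D : TransportData d} (T : Discretisation D)

theorem transportForm_definite (hd : 1 ≤ d) (v : T.feSpace) (h : T.transportForm v v = 0) :
    v = 0 :=
  T.eq_zero_of_normA_eq_zero (pow_eq_zero_iff two_ne_zero |>.1 (T.transportForm_self hd v ▸ h))

/-- A zero of the quadratic form satisfies |||v|||_a² = s(v,v) ≤ √(qβ qγ) |||v|||_a², which forces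
the norm to vanish when the factor is below 1. -/
theorem sub_scatterForm_definite (hd : 1 ≤ d) (hc : √(D.qβ * D.qγ) < 1) (v : T.feSpace)
    (h : (T.transportForm - T.scatterForm) v v = 0) : v = 0 := by
  rw [LinearMap.sub_apply, LinearMap.sub_apply, T.transportForm_self hd, sub_eq_zero] at h
  have h1 := (le_abs_self _).trans (T.abs_scatterForm_le v v)
  refine T.eq_zero_of_normA_eq_zero (pow_eq_zero_iff two_ne_zero |>.1 ?_)
  refine le_antisymm ?_ (sq_nonneg _)
  by_contra! hpos
  nlinarith

theorem existsUnique_isSolution (hd : 1 ≤ d) (hc : √(D.qβ * D.qγ) < 1) :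
    ∃! uh : T.feSpace, T.IsSolution uh := by
  have h := existsUnique_form_eq (T.sub_scatterForm_definite hd hc) T.loadForm
  have e : ∀ u : T.feSpace, T.IsSolution u ↔
      ∀ v, (T.transportForm - T.scatterForm) u v = T.loadForm v := fun u => by
    simp only [IsSolution, formA_eq, formS_eq, load_eq, LinearMap.sub_apply, sub_eq_iff_eq_add']
  simpa only [e] using h

theorem existsUnique_isSourceIteration (hd : 1 ≤ d) (u₀ : T.feSpace) :
    ∃! u : ℕ → T.feSpace, u 0 = u₀ ∧ T.IsSourceIteration u := by
  have h := fun w : T.feSpace =>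
    existsUnique_form_eq (T.transportForm_definite hd) (T.scatterForm w + T.loadForm)
  choose Φ hΦ hΦ' using h
  have e : ∀ u : ℕ → T.feSpace, T.IsSourceIteration u ↔ ∀ n, u (n + 1) = Φ (u n) := fun u => by
    simp only [IsSourceIteration, formA_eq, formS_eq, load_eq]
    refine forall_congr' fun n => ⟨fun hn => hΦ' _ _ fun v => ?_, fun hn v => ?_⟩
    · rw [hn, LinearMap.add_apply]
    · rw [hn]
      exact hΦ (u n) v
  simp only [e]
  refine ⟨fun n => n.rec u₀ fun _ => Φ, ⟨rfl, fun n => rfl⟩, fun u hu => funext fun n => ?_⟩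
  induction n with
  | zero => exact hu.1
  | succ n ih => rw [hu.2, ih]

/-- Subtracting the two equations cancels the load, leaving a(e_{n+1}, v) = s(e_n, v). The estimate
itself is valid for every value of √(qβ qγ). -/
theorem normA_error_le (hd : 1 ≤ d) {uh : T.feSpace} {u : ℕ → T.feSpace} (huh : T.IsSolution uh)
    (hu : T.IsSourceIteration u) (n : ℕ) :
    T.normA ((uh - u n : T.feSpace) : T.Broken)
      ≤ √(D.qβ * D.qγ) ^ n * T.normA ((uh - u 0 : T.feSpace) : T.Broken) := by
  induction n with
  | zero => rw [pow_zero, one_mul]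
  | succ n ih =>
    have h := le_mul_of_form_eq (N := fun v : T.feSpace => T.normA v) (e := uh - u n)
      (e' := uh - u (n + 1)) (fun v => T.normA_nonneg v) (T.transportForm_self hd)
      (Real.sqrt_nonneg (D.qβ * D.qγ)) T.abs_scatterForm_le fun v => by
        have h1 := huh v
        have h2 := hu n v
        rw [formA_eq, formS_eq, load_eq] at h1 h2
        simp only [map_sub, LinearMap.sub_apply]
        linarith
    refine h.trans ?_
    rw [pow_succ', mul_assoc]
    exact mul_le_mul_of_nonneg_left ih (Real.sqrt_nonneg _)

theorem tendsto_normA_error (hd : 1 ≤ d) (hc : √(D.qβ * D.qγ) < 1) {uh : T.feSpace}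
    {u : ℕ → T.feSpace} (huh : T.IsSolution uh) (hu : T.IsSourceIteration u) :
    Tendsto (fun n => T.normA ((uh - u n : T.feSpace) : T.Broken)) atTop (𝓝 0) := by
  refine squeeze_zero (fun n => T.normA_nonneg _) (T.normA_error_le hd huh hu) ?_
  simpa using (tendsto_pow_atTop_nhds_zero_of_lt_one (Real.sqrt_nonneg _) hc).mul_const
    (T.normA ((uh - u 0 : T.feSpace) : T.Broken))

/-- The point evaluations of finite element functions. -/
def evalMap (i : Fin T.space.card) (x : Space d) (μ : Dir d) (E : ℝ) : T.feSpace →ₗ[ℝ] ℝ where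
  toFun v := (v : T.Broken) i x μ E
  map_add' _ _ := rfl
  map_smul' _ _ := rfl

/-- Convergence in the norm `|||·|||_a` implies convergence in the finite element space. -/
theorem tendsto_of_normA (hd : 1 ≤ d) {uh : T.feSpace} {u : ℕ → T.feSpace}
    (h : Tendsto (fun n => T.normA ((uh - u n : T.feSpace) : T.Broken)) atTop (𝓝 0)) :
    Tendsto u atTop (𝓝 uh) := by
  -- The topology of the space is inherited from the product topology on functions, so convergence
  -- is pointwise; each evaluation is a linear functional and so is bounded by the norm.
  rw [tendsto_subtype_rng]
  refine tendsto_pi_nhds.2 fun i => tendsto_pi_nhds.2 fun x => tendsto_pi_nhds.2 fun μ =>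
    tendsto_pi_nhds.2 fun E => ?_
  obtain ⟨C, hC⟩ := exists_abs_le_of_form (N := fun v : T.feSpace => T.normA v)
    (fun v => T.normA_nonneg v) (T.transportForm_self hd)
    (fun v => T.eq_zero_of_normA_eq_zero) (T.evalMap i x μ E)
  have h1 : Tendsto (fun n => T.evalMap i x μ E (uh - u n)) atTop (𝓝 0) :=
    squeeze_zero_norm (fun n => hC (uh - u n)) (by simpa using h.const_mul C)
  have h2 := h1.const_sub (T.evalMap i x μ E uh)
  simp only [map_sub, sub_sub_cancel, sub_zero] at h2
  exact h2

end Discretisation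

end LBT

end

theorem mainTheorem5 (d : ℕ) (hd : d = 2 ∨ d = 3) (D : LBT.TransportData d)
    (hc : √(D.qβ * D.qγ) < 1) (T : LBT.Discretisation D) :
    (∃! uh : T.feSpace, T.IsSolution uh) ∧
    (∀ u₀ : T.feSpace, ∃! u : ℕ → T.feSpace, u 0 = u₀ ∧ T.IsSourceIteration u) ∧
    ∀ (uh : T.feSpace) (u : ℕ → T.feSpace), T.IsSolution uh → T.IsSourceIteration u →
      Filter.Tendsto u Filter.atTop (nhds uh) ∧
      Filter.Tendsto (fun n => T.normA ((uh - u n : T.feSpace) : T.Broken))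
        Filter.atTop (nhds 0) ∧
      ∀ n, T.normA ((uh - u n : T.feSpace) : T.Broken)
        ≤ √(D.qβ * D.qγ) ^ n * T.normA ((uh - u 0 : T.feSpace) : T.Broken) := by
  have hd1 : 1 ≤ d := by omega
  refine ⟨T.existsUnique_isSolution hd1 hc, T.existsUnique_isSourceIteration hd1,
    fun uh u huh hu => ?_⟩
  have h := T.tendsto_normA_error hd1 hc huh hu
  exact ⟨T.tendsto_of_normA hd1 h, h, T.normA_error_le hd1 huh hu⟩
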